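/- **Setting.** Let $\mathfrak g$ be a finite-dimensional real Lie algebra with basis $e_\alpha$, structure constants $[e_\beta,e_\gamma]=c^\alpha_{\beta\gamma}e_\alpha$ and bracket $[X,Y]^\alpha=c^\alpha_{\beta\gamma}X^\beta Y^\gamma$ (extended complex bilinearly). Let $J^\infty(A)$ be the infinite jet space of $\mathfrak g$-valued potentials on Minkowski space, with coordinates $x^i$, $a^\alpha_{i,j_1\cdots j_q}$ ($0\le i,j_s\le 3$, $q\ge0$, symmetric in the $j$'s). A differential function of order $r$ is a smooth function on $J^r(A)$. Let $D_i$ be the total derivative ($D_ix^k=\delta^k_i$, $D_ia^\alpha_{j,k_1\cdots k_q}=a^\alpha_{j,k_1\cdots k_qi}$), let $\nabla_iG=D_iG+[a_i,G]$, and $$F_{ij}=a_{j,i}-a_{i,j}+[a_i,a_j].$$ Indices are raised with $\eta=\mathrm{diag}(-1,1,1,1)$, and $\mathcal R^p\subset J^{p+2}(A)$ is the set of jets at which $\nabla_{k_1}\cdots\nabla_{k_r}\nabla^jF_{ij}=0$ for all $0\le r\le p$ and all indices. Round brackets denote symmetrization (averaging), and indices between vertical bars are not symmetrized. Put $a_{i_1\cdots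 i_p}=a_{(i_1,i_2\cdots i_p)}$ for $p\ge1$. **Spinors.** Let $\sigma^i_{II'}$ be the identity and the Pauli matrices times a fixed nonzero real constant, let $\epsilon_{01}=\epsilon^{01}=1$ with $\epsilon$ skew (the same for primed indices), $\psi^A=\epsilon^{AB}\psi_B$, $\nabla_{II'}=\sigma^i_{II'}\nabla_i$ and $\nabla^2=\nabla_{AA'}\nabla^{AA'}$. Define $\Phi_{IJ;K_1K_1'\cdots K_pK_p'}=\Phi_{(IJ);K_1K_1'\cdots K_pK_p'}$ by $$\sigma^i_{II'}\sigma^j_{JJ'}\sigma^{k_1}_{K_1K_1'}\cdots\sigma^{k_p}_{K_pK_p'}\nabla_{k_1}\cdots\nabla_{k_p}F_{ij}=\epsilon_{I'J'}\Phi_{IJ;K_1K_1'\cdots K_pK_p'}+\epsilon_{IJ}\overline\Phi_{I'J';K_1K_1'\cdots K_pK_p'},$$ where the bar is complex conjugation (which exchanges primed and unprimed indices). The symmetrized variables, for $p\ge0$, are $$\Phi^{\mathbf K_p'}_{\mathbf K_{p+2}}=\Phi_{(K_{p+2}K_{p+1};K_1\cdots K_p)}^{\hphantom{(K_{p+2}K_{p+1};}(K_1'\cdots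 K_p')},\qquad \mathbf K_n=(K_1,\dots,K_n),\quad \mathbf K_n'=(K_1',\dots,K_n').$$ $\Phi^{[m]}$ denotes the collection of all $\Phi^{\mathbf K_q'}_{\mathbf K_{q+2}}$ with $0\le q\le m$ (empty if $m<0$). A smooth function of $\Phi^{[m]}$ is one that is smooth in the real and imaginary parts of these variables. **Proposition.** (i) For every $p\ge1$, $$D_{i_{p+1}}a^\alpha_{i_1\cdots i_p}=a^\alpha_{i_1\cdots i_pi_{p+1}}-\frac1{p+1}\nabla_{(i_1}\cdots\nabla_{i_{p-1}}F^\alpha_{i_p)i_{p+1}}+b^\alpha_{i_1\cdots i_{p+1}},$$ where the $b^\alpha_{i_1\cdots i_{p+1}}$ are differential functions of order $p-1$. (ii) For every $p\ge1$, on $\mathcal R^p$, $$\begin{aligned} \nabla_{K_{p+3}}^{K_{p+1}'}\Phi^{\mathbf K_p'}_{\mathbf K_{p+2}}={}&\Phi^{\mathbf K_{p+1}'}_{\mathbf K_{p+3}}+\frac{p^2+p-2}{2(p+1)}\,\epsilon^{K_{p+1}'(K_p'}[\Phi_{(K_{p+3}K_{p+2}},\Phi^{\mathbf K_{p-1}')}_{\mathbf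 K_{p+1})}]\\ &-\frac{3(1-\delta_{1p})}{p+3}\,\epsilon_{K_{p+3}(K_{p+2}}[\Phi_{K_{p+1}K_p},\overline\Phi^{\mathbf K_{p+1}'}_{\mathbf K_{p-1})}]\\ &+\frac{p(p+5)}{2(p+3)}\,\epsilon_{K_{p+3}(K_{p+2}}[\overline\Phi^{(K_{p+1}'K_p'},\Phi^{\mathbf K_{p-1}')}_{\mathbf K_{p+1})}]\\ &+\Big(\frac{(p+1)(p+2)}{p+3}-\frac34\delta_{1p}\Big)\epsilon_{K_{p+3}(K_{p+2}}\epsilon^{K_{p+1}'(K_p'}[\Phi_{|S|K_{p+1}},\Phi^{\mathbf K_{p-1}')S}_{\mathbf K_p)}]\\ &+\frac{p(p-1)}{p+1}\,\epsilon^{K_{p+1}'(K_p'}\epsilon_{K_{p+3}(K_{p+2}}[\overline\Phi_{|S'|}{}^{K_{p-1}'},\Phi^{\mathbf K_{p-2}')S'}_{\mathbf K_{p+1})}]+\Psi_{1}{}^{\mathbf K_{p+1}'}_{\mathbf K_{p+3}}, \end{aligned}$$ where the components of $\Psi_1$ are smooth functions of $\Phi^{[p-2]}$ only (the last bracket term is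 absent for $p=1$). Moreover, for every $p\ge0$, on $\mathcal R^{p+1}$, $$\nabla^2\Phi^{\mathbf K_p'}_{\mathbf K_{p+2}}=2(p+2-\delta_{0p})[\Phi_{S(K_{p+2}},\Phi^{\mathbf K_p'S}_{\mathbf K_{p+1})}]+2p[\overline\Phi_{S'}{}^{(K_p'},\Phi^{\mathbf K_{p-1}')S'}_{\mathbf K_{p+2}}]+\Psi_{2}{}^{\mathbf K_p'}_{\mathbf K_{p+2}},$$ where the components of $\Psi_2$ are smooth functions of $\Phi^{[p-1]}$ only (the second bracket term is absent for $p=0$). -/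

import Mathlib

open scoped ContDiff

noncomputable section

namespace YangMills

/-! ### Jets of Yang-Mills potentials and total derivatives -/

/-- Points of the infinite jet bundle `J^∞(A)` of `𝔤`-valued potentials on Minkowski space, in
coordinates. A point `z` consists of `z.1 i = x^i` and `z.2 i L α = a^α_{i, l_1 ⋯ l_q}`, where the
multiset `L = {l_1, …, l_q}` records the (symmetric) derivative indices and `α : ι` labels a basis
of `𝔤`. -/
abbrev Jet (ι : Type*) : Type _ := (Fin 4 → ℝ) × (Fin 4 → Multiset (Fin 4) → ι → ℝ)

/-- The finite-dimensional jet space `J^p(A)`. -/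
abbrev JetOrd (ι : Type*) (p : ℕ) : Type _ :=
  (Fin 4 → ℝ) × (Fin 4 → (q : Fin (p + 1)) → Sym (Fin 4) q → ι → ℝ)

/-- The projection `J^∞(A) → J^p(A)`. -/
def Jet.trunc {ι : Type*} (p : ℕ) (z : Jet ι) : JetOrd ι p :=
  (z.1, fun i _ L => z.2 i (L : Multiset (Fin 4)))

/-- `f` is a differential function of order (at most) `p`: a smooth function on `J^p(A)`. -/
def HasOrder {ι : Type*} [Fintype ι] {V : Type*} [NormedAddCommGroup V] [NormedSpace ℝ V]
    (p : ℕ) (f : Jet ι → V) : Prop :=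
  ∃ g : JetOrd ι p → V, ContDiff ℝ ∞ g ∧ ∀ z, f z = g (z.trunc p)

/-- The components of the vector field `D_i` on `J^∞(A)` at the point `z`: the coordinate `x^k` has
velocity `δ_i^k`, and `a_{j, k_1 ⋯ k_p}` has velocity `a_{j, k_1 ⋯ k_p i}`. -/
def totalVec {ι : Type*} (i : Fin 4) (z : Jet ι) : Jet ι :=
  (Pi.single i 1, fun j L => z.2 j (i ::ₘ L))

/-- The total derivative `D_i = ∂_i + ∑_p a^α_{j, k_1 ⋯ k_p i} ∂_{a^α}^{j, k_1 ⋯ k_p}`, as the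
derivative along the vector field `totalVec i`. -/
def totalD {ι : Type*} {V : Type*} [NormedAddCommGroup V] [NormedSpace ℝ V]
    (i : Fin 4) (f : Jet ι → V) : Jet ι → V :=
  fun z => lineDeriv ℝ f z (totalVec i z)

/-! ### Covariant derivatives, field tensor and the solution manifold

Elements of `𝔤` (or of its complexification) are represented by their components in the fixed
basis `e` of `𝔤`. The coefficient field `𝕜` is `ℝ` or `ℂ`. -/

section Covariant

variable {ι : Type*} [Fintype ι] {𝔤 : Type*} [LieRing 𝔤] [LieAlgebra ℝ 𝔤]
  (e : Module.Basis ι ℝ 𝔤) {𝕜 : Type*} [NormedField 𝕜] [NormedAlgebra ℝ 𝕜]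

/-- The structure constants `c^α_{βγ}` of `𝔤`, with `[e_β, e_γ] = c^α_{βγ} e_α`. -/
def structConst (α β γ : ι) : ℝ := e.repr ⁅e β, e γ⁆ α

/-- The bracket `[X, Y]^α = c^α_{βγ} X^β Y^γ`, extended bilinearly to the coefficients `𝕜`. -/
def br (X Y : ι → 𝕜) : ι → 𝕜 :=
  fun α => ∑ β, ∑ γ, structConst e α β γ • (X β * Y γ)

/-- The covariant derivative `∇_i G = D_i G + [a_i, G]`. -/
def cov (i : Fin 4) (G : Jet ι → ι → 𝕜) : Jet ι → ι → 𝕜 :=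
  fun z => totalD i G z + br e (fun β => algebraMap ℝ 𝕜 (z.2 i 0 β)) (G z)

/-- The iterated covariant derivative `∇_{k_1} ⋯ ∇_{k_n} G`. -/
def covs {n : ℕ} (k : Fin n → Fin 4) (G : Jet ι → ι → 𝕜) : Jet ι → ι → 𝕜 :=
  (List.ofFn k).foldr (cov e) G

/-- The field tensor `F_{ij} = a_{j,i} - a_{i,j} + [a_i, a_j]`. -/
def field (i j : Fin 4) : Jet ι → ι → ℝ :=
  fun z => z.2 j {i} - z.2 i {j} + br e (z.2 i 0) (z.2 j 0)

/-- The diagonal entries `η^{ii}` of the Minkowski metric `diag(-1, 1, 1, 1)`. -/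
def eta (i : Fin 4) : ℝ := if i = 0 then -1 else 1

/-- The left-hand side `∇^j F_{ij}` of the Yang-Mills equations. -/
def divField (i : Fin 4) : Jet ι → ι → ℝ :=
  fun z => ∑ j, eta j • cov e j (field e i j) z

/-- The `p`-fold prolonged solution manifold `ℛ^p`, cut out by
`∇_{k_1} ⋯ ∇_{k_r} ∇^j F_{ij} = 0`, `0 ≤ r ≤ p`. These equations only involve the coordinates of
`J^{p+2}(A)`; the set below is the preimage of `ℛ^p` in `J^∞(A)`. -/
def solutionManifold (p : ℕ) : Set (Jet ι) :=
  {z | ∀ r ≤ p, ∀ (k : Fin r → Fin 4) (i : Fin 4), covs e k (divField e i) z = 0}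

end Covariant

/-! ### Multi-indices and symmetrization

A sequence `K : ℕ → I` carries the indices `K_1, K_2, …` (the value `K 0` is never used). -/

/-- The multi-index `(K_1, …, K_n)`. -/
def bold {I : Type*} (n : ℕ) (K : ℕ → I) : Fin n → I := fun s => K (s + 1)

/-- Replace `K_1, …, K_n` by the entries of `k` and keep all the other entries of `K`. -/
def patch {I : Type*} (n : ℕ) (k : Fin n → I) (K : ℕ → I) : ℕ → I :=
  fun j => if h : 1 ≤ j ∧ j ≤ n then k ⟨j - 1, by omega⟩ else K j

/-- Symmetrization `T_{(k_1 ⋯ k_n)}`, the average over all permutations of the indices. -/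
def symAvg {I V : Type*} [AddCommGroup V] [Module ℝ V] {n : ℕ}
    (T : (Fin n → I) → V) (k : Fin n → I) : V :=
  (n.factorial : ℝ)⁻¹ • ∑ s : Equiv.Perm (Fin n), T (k ∘ s)

/-- Symmetrization of an expression `T` in the indices `K_1, …, K_n` only. -/
def symFirst {I V : Type*} [AddCommGroup V] [Module ℝ V] (n : ℕ)
    (T : (ℕ → I) → V) (K : ℕ → I) : V :=
  symAvg (fun k => T (patch n k K)) (bold n K)

/-- The symmetrized potential variable `a_{i_1 i_2 ⋯ i_p} = a_{(i_1, i_2 ⋯ i_p)}`, `p ≥ 1`. -/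
def aSym {ι : Type*} (p : ℕ) (i : ℕ → Fin 4) : Jet ι → ι → ℝ :=
  symFirst p (fun i z => z.2 (i 1) ((Finset.Icc 2 p).val.map i)) i

/-! ### Spinors -/

/-- The spin metric. The matrices `ε_{IJ}`, `ε^{IJ}`, `ε_{I'J'}`, `ε^{I'J'}` all have these
entries. Indices are raised by `ψ^A = ε^{AB} ψ_B`. -/
def eps (A B : Fin 2) : ℂ := !![0, 1; -1, 0] A B

/-- The matrices `σ^i_{II'}`: the identity and the Pauli matrices, times a real constant `c`. -/
def sigma (c : ℝ) (i : Fin 4) (A A' : Fin 2) : ℂ :=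
  (c : ℂ) * (![!![1, 0; 0, 1], !![0, 1; 1, 0], !![0, -Complex.I; Complex.I, 0],
    !![1, 0; 0, -1]] i : Matrix (Fin 2) (Fin 2) ℂ) A A'

section Spinors

variable {ι : Type*} [Fintype ι] {𝔤 : Type*} [LieRing 𝔤] [LieAlgebra ℝ 𝔤] (c : ℝ)
  (e : Module.Basis ι ℝ 𝔤)

/-- The spinor representative `σ^i_{II'} σ^j_{JJ'} σ^{k_1}_{K_1K_1'} ⋯ σ^{k_p}_{K_pK_p'}
∇_{k_1} ⋯ ∇_{k_p} F_{ij}` of the covariant derivatives of the field tensor. -/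
def fieldSp {p : ℕ} (I I' J J' : Fin 2) (K K' : Fin p → Fin 2) : Jet ι → ι → ℂ :=
  fun z α => ∑ i, ∑ j, ∑ k : Fin p → Fin 4,
    sigma c i I I' * sigma c j J J' * (∏ s, sigma c (k s) (K s) (K' s)) *
      ((covs e k (field e i j) z α : ℝ) : ℂ)

/-- The variables `Φ_{IJ; K_1K_1' ⋯ K_pK_p'} = ½ ε^{I'J'} F_{II'JJ'; K_1K_1' ⋯ K_pK_p'}`; these are
the solution of the equations in `fieldSp_eq` below. -/
def phiUnsym {p : ℕ} (I J : Fin 2) (K K' : Fin p → Fin 2) : Jet ι → ι → ℂ :=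
  fun z α => 1 / 2 * ∑ I', ∑ J', eps I' J' * fieldSp c e I I' J J' K K' z α

/-- The symmetrized variables with all indices down,
`Φ_{(K_{p+2}K_{p+1}; K_1 ⋯ K_p) (K_1' ⋯ K_p')}`. -/
def phiLow (p : ℕ) (K : Fin (p + 2) → Fin 2) (K' : Fin p → Fin 2) : Jet ι → ι → ℂ :=
  symAvg (fun K => symAvg (fun K' => phiUnsym c e (K (Fin.last (p + 1))) (K ⟨p, by omega⟩)
    (fun s : Fin p => K ⟨s, by omega⟩) K') K') K

/-- The symmetrized variables with the primed indices raised, indexed by tuples. -/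
def phiFin (p : ℕ) (K : Fin (p + 2) → Fin 2) (K' : Fin p → Fin 2) : Jet ι → ι → ℂ :=
  fun z α => ∑ L : Fin p → Fin 2, (∏ s, eps (K' s) (L s)) * phiLow c e p K L z α

/-- The symmetrized variables `Φ_{K_1 ⋯ K_{p+2}}^{K_1' ⋯ K_p'}`. -/
def phi (p : ℕ) (K K' : ℕ → Fin 2) : Jet ι → ι → ℂ :=
  phiFin c e p (bold (p + 2) K) (bold p K')

/-- The complex conjugate variables `Φ̄^{K_1' ⋯ K_{p+2}'}_{K_1 ⋯ K_p}`, where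
`Φ̄_{K_1' ⋯ K_{p+2}' K_1 ⋯ K_p}` is the conjugate of `Φ_{K_1 ⋯ K_{p+2} K_1' ⋯ K_p'}`. -/
def phiBar (p : ℕ) (K' K : ℕ → Fin 2) : Jet ι → ι → ℂ :=
  fun z α => ∑ L : Fin (p + 2) → Fin 2, (∏ s : Fin (p + 2), eps (K' (s + 1)) (L s)) *
    starRingEnd ℂ (phiLow c e p L (bold p K) z α)

/-- `Φ_{IJ}`. -/
def phi2 (I J : Fin 2) : Jet ι → ι → ℂ := phiLow c e 0 ![I, J] ![]

/-- `Φ̄^{I'J'}`. -/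
def phiBar2Up (I' J' : Fin 2) : Jet ι → ι → ℂ :=
  fun z α => ∑ S, ∑ T, eps I' S * eps J' T * starRingEnd ℂ (phi2 c e S T z α)

/-- `Φ̄_{S'}^{I'}`. -/
def phiBar2Mix (S' I' : Fin 2) : Jet ι → ι → ℂ :=
  fun z α => ∑ T, eps I' T * starRingEnd ℂ (phi2 c e S' T z α)

/-- `∇_{II'} = σ^i_{II'} ∇_i`. -/
def covSp (I I' : Fin 2) (G : Jet ι → ι → ℂ) : Jet ι → ι → ℂ :=
  fun z => ∑ i, sigma c i I I' • cov e i G z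

/-- `∇_I^{I'} = ε^{I'J'} ∇_{IJ'}`. -/
def covUp (I I' : Fin 2) (G : Jet ι → ι → ℂ) : Jet ι → ι → ℂ :=
  fun z => ∑ J', eps I' J' • covSp c e I J' G z

/-- The wave operator `∇² = ∇_{AA'} ∇^{AA'} = ε^{AB} ε^{A'B'} ∇_{AA'} ∇_{BB'}`. -/
def wave (G : Jet ι → ι → ℂ) : Jet ι → ι → ℂ :=
  fun z => ∑ A, ∑ A', ∑ B, ∑ B', (eps A B * eps A' B') • covSp c e A A' (covSp c e B B' G) z

/-- The values of the variables `∂^q Φ`, `0 ≤ q < m`. -/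
abbrev PhiVars (ι : Type*) (m : ℕ) : Type _ :=
  (q : Fin m) → (Fin (q + 2) → Fin 2) → (Fin q → Fin 2) → ι → ℂ

/-- The values `Φ^{[m-1]}` of the variables `∂^q Φ`, `0 ≤ q < m`, at a point `z`. -/
def phiVars (m : ℕ) (z : Jet ι) : PhiVars ι m :=
  fun q K K' => phiFin c e q K K' z

/-! The equations determining `Φ_{IJ; K_1K_1' ⋯ K_pK_p'}`. -/

theorem br_swap (X Y : ι → ℝ) : br e X Y = -br e Y X := by
  funext α
  simp only [br, structConst, Pi.neg_apply]
  rw [Finset.sum_comm, ← Finset.sum_neg_distrib]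
  refine Finset.sum_congr rfl fun γ _ => ?_
  rw [← Finset.sum_neg_distrib]
  refine Finset.sum_congr rfl fun β _ => ?_
  rw [← lie_skew, map_neg, Finsupp.neg_apply, mul_comm (X β), neg_smul]

theorem field_swap (i j : Fin 4) : field e i j = -field e j i := by
  funext z
  simp only [field, Pi.neg_apply]
  rw [br_swap]
  abel

theorem cov_neg (i : Fin 4) (G : Jet ι → ι → ℝ) : cov e i (-G) = -cov e i G := by
  funext z α
  simp [cov, totalD, lineDeriv, br, add_comm]

theorem covs_field_swap {p : ℕ} (k : Fin p → Fin 4) (i j : Fin 4) :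
    covs e k (field e i j) = -covs e k (field e j i) := by
  rw [field_swap, covs, covs]
  induction List.ofFn k with
  | nil => rfl
  | cons a l ih => rw [List.foldr_cons, List.foldr_cons, ih, cov_neg]

theorem sigma_conj (i : Fin 4) (A B : Fin 2) :
    starRingEnd ℂ (sigma c i A B) = sigma c i B A := by
  fin_cases i <;> fin_cases A <;> fin_cases B <;> simp [sigma]

theorem fieldSp_swap {p : ℕ} (I I' J J' : Fin 2) (K K' : Fin p → Fin 2) (z : Jet ι) (α : ι) :
    fieldSp c e I I' J J' K K' z α = -fieldSp c e J J' I I' K K' z α := by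
  simp only [fieldSp]
  rw [Finset.sum_comm, ← Finset.sum_neg_distrib]
  refine Finset.sum_congr rfl fun j _ => ?_
  rw [← Finset.sum_neg_distrib]
  refine Finset.sum_congr rfl fun i _ => ?_
  rw [← Finset.sum_neg_distrib]
  refine Finset.sum_congr rfl fun k _ => ?_
  rw [covs_field_swap]
  simp only [Pi.neg_apply, Complex.ofReal_neg]
  ring

theorem fieldSp_conj {p : ℕ} (I I' J J' : Fin 2) (K K' : Fin p → Fin 2) (z : Jet ι) (α : ι) :
    starRingEnd ℂ (fieldSp c e I I' J J' K K' z α) = fieldSp c e I' I J' J K' K z α := by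
  simp only [fieldSp, map_sum, map_mul, map_prod, sigma_conj, Complex.conj_ofReal]

/-- `F_{II'JJ'; ⋯} = ε_{I'J'} Φ_{IJ; ⋯} + ε_{IJ} Φ̄_{I'J'; ⋯}`. -/
theorem fieldSp_eq {p : ℕ} (I I' J J' : Fin 2) (K K' : Fin p → Fin 2) (z : Jet ι) (α : ι) :
    fieldSp c e I I' J J' K K' z α =
      eps I' J' * phiUnsym c e I J K K' z α +
        eps I J * starRingEnd ℂ (phiUnsym c e I' J' K' K z α) := by
  have h := fun A A' B B' => fieldSp_swap c e A A' B B' K K' z α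
  have h0 : ∀ A A', fieldSp c e A A' A A' K K' z α = 0 := fun A A' => self_eq_neg.mp (h A A' A A')
  have hc : starRingEnd ℂ (phiUnsym c e I' J' K' K z α) =
      1 / 2 * ∑ A, ∑ B, eps A B * fieldSp c e A I' B J' K K' z α := by
    have he : ∀ A B, starRingEnd ℂ (eps A B) = eps A B := by
      intro A B
      fin_cases A <;> fin_cases B <;> simp [eps]
    simp only [phiUnsym, map_mul, map_sum, fieldSp_conj, he, map_div₀, map_one, map_ofNat]
  rw [hc]
  simp only [phiUnsym, Fin.sum_univ_two]
  fin_cases I <;> fin_cases I' <;> fin_cases J <;> fin_cases J' <;>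
    simp [eps, h0, h 1 0 0 0, h 1 0 0 1, h 1 1 0 0, h 1 1 0 1, h 0 1 0 0, h 1 1 1 0] <;>
    ring

/-- `Φ_{IJ; ⋯} = Φ_{(IJ); ⋯}`. -/
theorem phiUnsym_symm {p : ℕ} (I J : Fin 2) (K K' : Fin p → Fin 2) :
    phiUnsym c e I J K K' = phiUnsym c e J I K K' := by
  funext z α
  simp only [phiUnsym, Fin.sum_univ_two]
  rw [fieldSp_swap c e I 0 J 1, fieldSp_swap c e I 1 J 0]
  simp [eps]
  ring

end Spinors

end YangMills

end

/-!
# Total derivatives of the symmetrized Yang-Mills jet variables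

*The potential.* Up to terms of lower order, `D_j a_{i_1 ⋯ i_p}`, `a_{i_1 ⋯ i_p j}` and
`∇_{(i_1} ⋯ ∇_{i_{p-1}} F_{i_p) j}` are linear combinations of the jet variables `a_{j, i_1 ⋯ i_p}`
and `a_{i_s, i_1 ⋯ j ⋯ i_p}`. The coefficients match, so that the remainder is a polynomial of order
`p - 1` in the jet variables (`totalD_aSym_sub_mem`).

*The spinor variables.* Symmetrization is replaced by contraction with spinors: if all unprimed
indices are contracted with `ξ` and all primed ones with `ζ`, then `Φ^{K'_1 ⋯ K'_p}_{K_1 ⋯ K_{p+2}}`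
becomes `𝔇 ^ p Φ(ξ, ξ)` with `𝔇 = ξ^A ζ^{A'} ∇_{AA'}`. The further indices of the derivative are
contracted with spinors `η` and `θ`, and one more totally symmetrized derivative is, up to a factor,
the double polarization `polU` of `𝔇 ^ (p + 1) Φ(ξ, ξ)`. The two identities then only involve the
commutators of the four derivatives along `ξζ`, `ηζ`, `ξθ`, `ηθ`, and the field equations
`∇^A_{A'} Φ_{AB} = 0 = ∇^{A'}_A Φ̄_{A'B'}`, which hold by the Yang-Mills equations and the Bianchi
identities. This is the structure `SpinorGauge` on a complex Lie algebra.

Let `Low m` be the span of all brackets of derivatives of the curvature of order less than `m`,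
modulo the field equations. Moving derivatives past each other produces brackets with the curvature,
and modulo `Low m` only the brackets of the curvature with its derivatives of the highest order
survive. By induction, each derivative which occurs in the recursion for `polU` is a multiple of
`𝔇 ^ p (η^A θ^{A'} ∇_{AA'}) Φ(ξ, ξ)` plus explicit brackets (`mkQ_nab_polV`, `mkQ_nab_polQ`,
`mkQ_nab_ηθ_pow`, `mkQ_polU`). Eliminating this expression yields the two identities in contracted
form, `mkQ_nab_pow_curv` and `mkQ_box_pow_curv`. The first of them also shows that every element of
`Low m` is in the Lie algebra generated by the symmetrized derivatives, modulo the field equations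
(`low_le_symLow`); on the solution manifold it is therefore a smooth, even polynomial, function of
the symmetrized variables (`smoothPhi_of_mkQ_eq`).

It remains to translate. Polynomial functions on the jet space with values in the complexified Lie
algebra form a `SpinorGauge` (`PolyField.gauge`), the contraction of each term of the proposition is
computed (`PolyField.conSeq_term_unprimed` and the following lemmas), and a symmetric spinor all of
whose contractions with `(1, τ)` lie in a subspace has its components in that subspace
(`mem_of_conSeq_mem`).
-/

noncomputable section

namespace YangMills

/-! ### Polynomial differential functions and total derivatives -/

section JetPoly

variable (ι : Type*) (𝕜 : Type*) [NormedField 𝕜] [NormedAlgebra ℝ 𝕜]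

/-- The `𝕜`-valued functions on `J^∞(A)` that are polynomials in the coordinates
`a^α_{i, l_1 ⋯ l_q}` with `q ≤ n`. The base coordinates `x^i` are not needed and left out;
`n = ⊤` allows coordinates of every order. -/
def jetPoly (n : ℕ∞) : Subalgebra 𝕜 (Jet ι → 𝕜) :=
  Algebra.adjoin 𝕜 {f | ∃ i L α, (Multiset.card L : ℕ∞) ≤ n ∧
    f = fun z => algebraMap ℝ 𝕜 (z.2 i L α)}

variable {ι 𝕜}

theorem coord_mem_jetPoly {n : ℕ∞} (i : Fin 4) (L : Multiset (Fin 4)) (α : ι)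
    (h : (Multiset.card L : ℕ∞) ≤ n) :
    (fun z : Jet ι => algebraMap ℝ 𝕜 (z.2 i L α)) ∈ jetPoly ι 𝕜 n :=
  Algebra.subset_adjoin ⟨i, L, α, h, rfl⟩

theorem jetPoly_mono {m n : ℕ∞} (h : m ≤ n) : jetPoly ι 𝕜 m ≤ jetPoly ι 𝕜 n := by
  refine Algebra.adjoin_mono ?_
  rintro _ ⟨i, L, α, hL, rfl⟩
  exact ⟨i, L, α, hL.trans h, rfl⟩

/-- Polynomials in the jet coordinates are differentiable along every line, although `Jet ι` carries
no norm. Hence `totalD` satisfies the usual rules on them. -/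
theorem jetPoly_lineDifferentiable {n : ℕ∞} {f : Jet ι → 𝕜} (hf : f ∈ jetPoly ι 𝕜 n)
    (z v : Jet ι) : DifferentiableAt ℝ (fun t : ℝ => f (z + t • v)) 0 := by
  induction hf using Algebra.adjoin_induction with
  | mem f h =>
    obtain ⟨i, L, α, -, rfl⟩ := h
    simp only [Prod.snd_add, Prod.smul_snd, Pi.add_apply, Pi.smul_apply, smul_eq_mul,
      Algebra.algebraMap_eq_smul_one]
    fun_prop
  | algebraMap r => exact differentiableAt_const _
  | add f g _ _ hf hg => exact hf.add hg
  | mul f g _ _ hf hg => exact hf.mul hg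

theorem totalD_add_of_mem {n : ℕ∞} {f g : Jet ι → 𝕜} (hf : f ∈ jetPoly ι 𝕜 n)
    (hg : g ∈ jetPoly ι 𝕜 n) (i : Fin 4) : totalD i (f + g) = totalD i f + totalD i g := by
  funext z
  exact deriv_add (jetPoly_lineDifferentiable hf z _) (jetPoly_lineDifferentiable hg z _)

theorem totalD_mul_of_mem {n : ℕ∞} {f g : Jet ι → 𝕜} (hf : f ∈ jetPoly ι 𝕜 n)
    (hg : g ∈ jetPoly ι 𝕜 n) (i : Fin 4) :
    totalD i (f * g) = totalD i f * g + f * totalD i g := by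
  funext z
  have := deriv_fun_mul (jetPoly_lineDifferentiable hf z (totalVec i z))
    (jetPoly_lineDifferentiable hg z (totalVec i z))
  simpa [totalD, lineDeriv] using this

theorem totalD_const (r : 𝕜) (i : Fin 4) : totalD i (fun _ : Jet ι => r) = 0 := by
  funext z
  simp [totalD, lineDeriv]

theorem totalD_smul_of_mem {n : ℕ∞} {f : Jet ι → 𝕜} (hf : f ∈ jetPoly ι 𝕜 n) (r : 𝕜)
    (i : Fin 4) : totalD i (r • f) = r • totalD i f := by
  have h : r • f = (fun _ => r) * f := rfl
  have hr : (fun _ => r) ∈ jetPoly ι 𝕜 n := (jetPoly ι 𝕜 n).algebraMap_mem r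
  rw [h, totalD_mul_of_mem hr hf, totalD_const]
  funext z
  simp

theorem totalD_coord (i j : Fin 4) (L : Multiset (Fin 4)) (α : ι) :
    totalD i (fun z : Jet ι => algebraMap ℝ 𝕜 (z.2 j L α)) =
      fun z => algebraMap ℝ 𝕜 (z.2 j (i ::ₘ L) α) := by
  funext z
  have h : HasDerivAt (fun t : ℝ => algebraMap ℝ 𝕜 ((z + t • totalVec i z).2 j L α))
      (algebraMap ℝ 𝕜 (z.2 j (i ::ₘ L) α)) 0 := by
    simp only [Prod.snd_add, Prod.smul_snd, Pi.add_apply, Pi.smul_apply, smul_eq_mul,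
      Algebra.algebraMap_eq_smul_one]
    have := (((hasDerivAt_id (0 : ℝ)).mul_const ((totalVec i z).2 j L α)).const_add
      (z.2 j L α)).smul_const (1 : 𝕜)
    simpa [totalVec] using this
  exact h.deriv

theorem totalD_mem {n : ℕ∞} {f : Jet ι → 𝕜} (hf : f ∈ jetPoly ι 𝕜 n) (i : Fin 4) :
    totalD i f ∈ jetPoly ι 𝕜 (n + 1) := by
  have hle : jetPoly ι 𝕜 n ≤ jetPoly ι 𝕜 (n + 1) := jetPoly_mono le_self_add
  induction hf using Algebra.adjoin_induction with
  | mem f h =>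
    obtain ⟨j, L, α, hL, rfl⟩ := h
    rw [totalD_coord]
    refine coord_mem_jetPoly _ _ _ ?_
    rw [Multiset.card_cons]
    push_cast
    gcongr
  | algebraMap r =>
    have : totalD i (algebraMap 𝕜 (Jet ι → 𝕜) r) = 0 := totalD_const r i
    rw [this]
    exact zero_mem _
  | add f g hf' hg' hf hg =>
    rw [totalD_add_of_mem (n := n) hf' hg']
    exact add_mem hf hg
  | mul f g hf' hg' hf hg =>
    rw [totalD_mul_of_mem (n := n) hf' hg']
    exact add_mem (mul_mem hf (hle hg')) (mul_mem (hle hf') hg)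

theorem totalD_comm {n : ℕ∞} {f : Jet ι → 𝕜} (hf : f ∈ jetPoly ι 𝕜 n) (i j : Fin 4) :
    totalD i (totalD j f) = totalD j (totalD i f) := by
  induction hf using Algebra.adjoin_induction with
  | mem f h =>
    obtain ⟨k, L, α, hL, rfl⟩ := h
    simp only [totalD_coord, Multiset.cons_swap]
  | algebraMap r =>
    have h (i : Fin 4) : totalD i (algebraMap 𝕜 (Jet ι → 𝕜) r) = 0 := totalD_const r i
    have h0 (i : Fin 4) : totalD i (0 : Jet ι → 𝕜) = 0 := totalD_const 0 i
    simp only [h, h0]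
  | add f g hf' hg' hf hg =>
    rw [totalD_add_of_mem (n := n) hf' hg', totalD_add_of_mem (n := n) hf' hg',
      totalD_add_of_mem (n := n + 1) (totalD_mem hf' j) (totalD_mem hg' j),
      totalD_add_of_mem (n := n + 1) (totalD_mem hf' i) (totalD_mem hg' i), hf, hg]
  | mul f g hf' hg' hf hg =>
    have hle : jetPoly ι 𝕜 n ≤ jetPoly ι 𝕜 (n + 1) := jetPoly_mono le_self_add
    have e (i j : Fin 4) : totalD i (totalD j f * g + f * totalD j g) =
        totalD i (totalD j f) * g + totalD j f * totalD i g +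
          (totalD i f * totalD j g + f * totalD i (totalD j g)) := by
      rw [totalD_add_of_mem (n := n + 1) (mul_mem (totalD_mem hf' j) (hle hg'))
        (mul_mem (hle hf') (totalD_mem hg' j)),
        totalD_mul_of_mem (n := n + 1) (totalD_mem hf' j) (hle hg'),
        totalD_mul_of_mem (n := n + 1) (hle hf') (totalD_mem hg' j)]
    rw [totalD_mul_of_mem (n := n) hf' hg', totalD_mul_of_mem (n := n) hf' hg', e, e, hf, hg]
    ring

/-- A polynomial in the coordinates of order at most `n` factors through `J^n(A)`. -/
theorem hasOrder_of_mem_jetPoly [Fintype ι] {n : ℕ} {f : Jet ι → ℝ}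
    (hf : f ∈ jetPoly ι ℝ n) : HasOrder n f := by
  induction hf using Algebra.adjoin_induction with
  | mem f h =>
    obtain ⟨i, L, α, hL, rfl⟩ := h
    have hL' : Multiset.card L < n + 1 := by
      have : Multiset.card L ≤ n := by exact_mod_cast hL
      omega
    refine ⟨fun w => w.2 i ⟨Multiset.card L, hL'⟩ ⟨L, rfl⟩ α, ?_, fun z => rfl⟩
    have h₁ : ContDiff ℝ ∞ fun w : JetOrd ι n => w.2 i ⟨Multiset.card L, hL'⟩ :=
      contDiff_pi.1 (contDiff_pi.1 contDiff_snd i) _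
    have h₂ (S : Sym (Fin 4) (Multiset.card L)) :
        ContDiff ℝ ∞ fun w : JetOrd ι n => w.2 i ⟨Multiset.card L, hL'⟩ S :=
      (contDiff_pi (F' := fun _ : Sym (Fin 4) (Multiset.card L) => ι → ℝ)).1 h₁ S
    exact contDiff_pi.1 (h₂ _) α
  | algebraMap r => exact ⟨fun _ => r, contDiff_const, fun _ => rfl⟩
  | add f g _ _ hf hg =>
    obtain ⟨F, hF, hf⟩ := hf
    obtain ⟨G, hG, hg⟩ := hg
    exact ⟨F + G, hF.add hG, fun z => by simp [hf, hg]⟩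
  | mul f g _ _ hf hg =>
    obtain ⟨F, hF, hf⟩ := hf
    obtain ⟨G, hG, hg⟩ := hg
    exact ⟨F * G, hF.mul hG, fun z => by simp [hf, hg]⟩

variable (ι 𝕜) in
/-- The `𝔤`-valued (more precisely, component-valued) functions on `J^∞(A)` all of whose components
are polynomials in the coordinates of order at most `n`. -/
def jetPolyVec (n : ℕ∞) : Submodule 𝕜 (Jet ι → ι → 𝕜) where
  carrier := {G | ∀ α, (fun z => G z α) ∈ jetPoly ι 𝕜 n}
  add_mem' hG hH α := add_mem (hG α) (hH α)
  zero_mem' _ := zero_mem (jetPoly ι 𝕜 n)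
  smul_mem' r _ hG α := (jetPoly ι 𝕜 n).smul_mem (hG α) r

theorem jetPolyVec_mono {m n : ℕ∞} (h : m ≤ n) : jetPolyVec ι 𝕜 m ≤ jetPolyVec ι 𝕜 n :=
  fun _ hG α => jetPoly_mono h (hG α)

variable (𝕜) in
/-- The jet variable `a_{i, L}` with coefficients in `𝕜`. -/
def coordVec (i : Fin 4) (L : Multiset (Fin 4)) : Jet ι → ι → 𝕜 :=
  fun z α => algebraMap ℝ 𝕜 (z.2 i L α)

theorem coordVec_mem {n : ℕ∞} (i : Fin 4) (L : Multiset (Fin 4))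
    (h : (Multiset.card L : ℕ∞) ≤ n) : (coordVec 𝕜 i L : Jet ι → ι → 𝕜) ∈ jetPolyVec ι 𝕜 n :=
  fun α => coord_mem_jetPoly i L α h

variable [Fintype ι]

theorem totalD_apply_of_mem {n : ℕ∞} {G : Jet ι → ι → 𝕜} (hG : G ∈ jetPolyVec ι 𝕜 n)
    (i : Fin 4) (z : Jet ι) (α : ι) : totalD i G z α = totalD i (fun z => G z α) z := by
  have h := deriv_pi (φ := fun (t : ℝ) => G (z + t • totalVec i z)) (x := 0)
    (fun α => jetPoly_lineDifferentiable (hG α) z (totalVec i z))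
  exact congrFun h α

theorem totalD_mem_vec {n : ℕ∞} {G : Jet ι → ι → 𝕜} (hG : G ∈ jetPolyVec ι 𝕜 n) (i : Fin 4) :
    totalD i G ∈ jetPolyVec ι 𝕜 (n + 1) := by
  intro α
  simp only [totalD_apply_of_mem hG]
  exact totalD_mem (hG α) i

theorem totalD_coordVec (i j : Fin 4) (L : Multiset (Fin 4)) :
    totalD i (coordVec 𝕜 j L : Jet ι → ι → 𝕜) = coordVec 𝕜 j (i ::ₘ L) := by
  funext z α
  rw [totalD_apply_of_mem (coordVec_mem j L le_top)]
  exact congrFun (totalD_coord i j L α) z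

theorem totalD_add_vec {n : ℕ∞} {G H : Jet ι → ι → 𝕜} (hG : G ∈ jetPolyVec ι 𝕜 n)
    (hH : H ∈ jetPolyVec ι 𝕜 n) (i : Fin 4) : totalD i (G + H) = totalD i G + totalD i H := by
  funext z α
  rw [totalD_apply_of_mem (add_mem hG hH)]
  simp only [Pi.add_apply]
  rw [totalD_apply_of_mem hG, totalD_apply_of_mem hH]
  exact congrFun (totalD_add_of_mem (hG α) (hH α) i) z

theorem totalD_smul_vec {n : ℕ∞} {G : Jet ι → ι → 𝕜} (hG : G ∈ jetPolyVec ι 𝕜 n) (r : 𝕜)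
    (i : Fin 4) : totalD i (r • G) = r • totalD i G := by
  funext z α
  rw [totalD_apply_of_mem (Submodule.smul_mem _ r hG)]
  simp only [Pi.smul_apply]
  rw [totalD_apply_of_mem hG]
  exact congrFun (totalD_smul_of_mem (hG α) r i) z

theorem totalD_comm_vec {n : ℕ∞} {G : Jet ι → ι → 𝕜} (hG : G ∈ jetPolyVec ι 𝕜 n)
    (i j : Fin 4) : totalD i (totalD j G) = totalD j (totalD i G) := by
  funext z α
  rw [totalD_apply_of_mem (totalD_mem_vec hG j), totalD_apply_of_mem (totalD_mem_vec hG i)]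
  have e (i : Fin 4) : (fun z => totalD i G z α) = totalD i (fun z => G z α) :=
    funext fun z => totalD_apply_of_mem hG i z α
  rw [e, e, totalD_comm (hG α)]

variable {𝔤 : Type*} [LieRing 𝔤] [LieAlgebra ℝ 𝔤] (e : Module.Basis ι ℝ 𝔤)

theorem br_mem {n : ℕ∞} {G H : Jet ι → ι → 𝕜} (hG : G ∈ jetPolyVec ι 𝕜 n)
    (hH : H ∈ jetPolyVec ι 𝕜 n) : (fun z => br e (G z) (H z)) ∈ jetPolyVec ι 𝕜 n := by
  intro α
  have h : (fun z => br e (G z) (H z) α) = ∑ β, ∑ γ, algebraMap ℝ 𝕜 (structConst e α β γ) •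
      ((fun z => G z β) * fun z => H z γ) := by
    funext z
    simp [br, Algebra.smul_def]
  rw [h]
  exact sum_mem fun β _ => sum_mem fun γ _ =>
    (jetPoly ι 𝕜 n).smul_mem (mul_mem (hG β) (hH γ)) _

theorem totalD_br {n : ℕ∞} {G H : Jet ι → ι → 𝕜} (hG : G ∈ jetPolyVec ι 𝕜 n)
    (hH : H ∈ jetPolyVec ι 𝕜 n) (i : Fin 4) (z : Jet ι) :
    totalD i (fun z => br e (G z) (H z)) z =
      br e (totalD i G z) (H z) + br e (G z) (totalD i H z) := by
  funext α
  rw [totalD_apply_of_mem (br_mem e hG hH)]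
  have hd (β : ι) := (jetPoly_lineDifferentiable (hG β) z (totalVec i z)).hasDerivAt
  have hd' (β : ι) := (jetPoly_lineDifferentiable (hH β) z (totalVec i z)).hasDerivAt
  have h := HasDerivAt.fun_sum (u := Finset.univ) fun β _ =>
    HasDerivAt.fun_sum (u := Finset.univ) fun γ _ =>
      ((hd β).mul (hd' γ)).const_smul (structConst e α β γ)
  refine h.deriv.trans ?_
  simp only [zero_smul, add_zero, br, Pi.add_apply, ← Finset.sum_add_distrib, ← smul_add]
  refine Finset.sum_congr rfl fun β _ => Finset.sum_congr rfl fun γ _ => ?_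
  rw [totalD_apply_of_mem hG, totalD_apply_of_mem hH]
  rfl

theorem cov_mem {n : ℕ∞} {G : Jet ι → ι → 𝕜} (hG : G ∈ jetPolyVec ι 𝕜 n) (i : Fin 4) :
    cov e i G ∈ jetPolyVec ι 𝕜 (n + 1) :=
  add_mem (totalD_mem_vec hG i)
    (br_mem e (coordVec_mem i 0 (by simp)) (jetPolyVec_mono le_self_add hG))

end JetPoly

/-! ### Total derivatives of the symmetrized potential -/

section Bracket

variable {ι : Type*} [Fintype ι] {𝕜 : Type*} [NormedField 𝕜] [NormedAlgebra ℝ 𝕜]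
  {𝔤 : Type*} [LieRing 𝔤] [LieAlgebra ℝ 𝔤] (e : Module.Basis ι ℝ 𝔤)

theorem br_add_right (X Y Z : ι → 𝕜) : br e X (Y + Z) = br e X Y + br e X Z := by
  funext α
  simp [br, mul_add, Finset.sum_add_distrib]

theorem br_smul_right (r : 𝕜) (X Y : ι → 𝕜) : br e X (r • Y) = r • br e X Y := by
  funext α
  simp only [br, Pi.smul_apply, smul_eq_mul, Finset.mul_sum, mul_smul_comm, mul_left_comm]

theorem field_mem (i j : Fin 4) : field e i j ∈ jetPolyVec ι ℝ 1 :=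
  add_mem (sub_mem (coordVec_mem j {i} (by simp)) (coordVec_mem i {j} (by simp)))
    (br_mem e (coordVec_mem i 0 (by simp)) (coordVec_mem j 0 (by simp)))

/-- The highest order part of `∇_{k_1} ⋯ ∇_{k_n} F_{ij}` is linear in the jet variables. -/
theorem covs_field_sub_mem (k : List (Fin 4)) (i j : Fin 4) :
    k.foldr (cov e) (field e i j) -
      (coordVec ℝ j (i ::ₘ (k : Multiset (Fin 4))) - coordVec ℝ i (j ::ₘ (k : Multiset (Fin 4))))
      ∈ jetPolyVec ι ℝ k.length := by
  induction k with
  | nil =>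
    have h : List.foldr (cov e) (field e i j) [] -
        (coordVec ℝ j (i ::ₘ (([] : List (Fin 4)) : Multiset (Fin 4))) -
          coordVec ℝ i (j ::ₘ (([] : List (Fin 4)) : Multiset (Fin 4)))) =
        fun z => br e (coordVec ℝ i 0 z) (coordVec ℝ j 0 z) := by
      funext z
      change (z.2 j {i} - z.2 i {j} + br e (z.2 i 0) (z.2 j 0)) - (z.2 j {i} - z.2 i {j}) = _
      rw [add_sub_cancel_left]
      rfl
    rw [h]
    exact br_mem e (coordVec_mem i 0 (by simp)) (coordVec_mem j 0 (by simp))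
  | cons a k ih =>
    have hlead (i j : Fin 4) : (coordVec ℝ j (i ::ₘ (k : Multiset (Fin 4))) : Jet ι → ι → ℝ) ∈
        jetPolyVec ι ℝ (k.length + 1 : ℕ) := coordVec_mem _ _ (by simp)
    set G := k.foldr (cov e) (field e i j) with hG
    have hGm : G ∈ jetPolyVec ι ℝ (k.length + 1 : ℕ) := by
      have h1 := jetPolyVec_mono (by exact_mod_cast Nat.le_succ _ :
        (k.length : ℕ∞) ≤ (k.length + 1 : ℕ)) ih
      have := add_mem h1 (sub_mem (hlead i j) (hlead j i))
      rwa [sub_add_cancel] at this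
    have hD : totalD a (G - (coordVec ℝ j (i ::ₘ (k : Multiset (Fin 4))) -
        coordVec ℝ i (j ::ₘ (k : Multiset (Fin 4))))) = totalD a G -
        (coordVec ℝ j (a ::ₘ i ::ₘ (k : Multiset (Fin 4))) -
          coordVec ℝ i (a ::ₘ j ::ₘ (k : Multiset (Fin 4)))) := by
      have hneg {H : Jet ι → ι → ℝ} (hH : H ∈ jetPolyVec ι ℝ (k.length + 1 : ℕ)) :
          totalD a (-H) = -totalD a H := by
        rw [← neg_one_smul ℝ, totalD_smul_vec hH, neg_one_smul]
      rw [sub_eq_add_neg, totalD_add_vec hGm (neg_mem (sub_mem (hlead i j) (hlead j i))),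
        hneg (sub_mem (hlead i j) (hlead j i)), sub_eq_add_neg (coordVec _ _ _),
        totalD_add_vec (hlead i j) (neg_mem (hlead j i)), hneg (hlead j i),
        totalD_coordVec, totalD_coordVec]
      abel
    have h := add_mem (totalD_mem_vec ih a) (br_mem e (coordVec_mem a 0 (by simp)) hGm)
    rw [hD] at h
    have h2 : List.foldr (cov e) (field e i j) (a :: k) -
        (coordVec ℝ j (i ::ₘ ((a :: k : List (Fin 4)) : Multiset (Fin 4))) -
          coordVec ℝ i (j ::ₘ ((a :: k : List (Fin 4)) : Multiset (Fin 4)))) =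
        totalD a G - (coordVec ℝ j (a ::ₘ i ::ₘ (k : Multiset (Fin 4))) -
          coordVec ℝ i (a ::ₘ j ::ₘ (k : Multiset (Fin 4)))) +
          fun z => br e (coordVec ℝ a 0 z) (G z) := by
      rw [List.foldr_cons, ← hG, ← Multiset.cons_coe, Multiset.cons_swap i, Multiset.cons_swap j,
        sub_add_eq_add_sub]
      rfl
    rwa [h2, List.length_cons, Nat.cast_succ]

end Bracket

theorem sum_perm_apply {V : Type*} [AddCommGroup V] [Module ℝ V] {n : ℕ} (H : Fin (n + 1) → V)
    (j : Fin (n + 1)) :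
    (((n + 1).factorial : ℝ)⁻¹) • ∑ s : Equiv.Perm (Fin (n + 1)), H (s j) =
      ((n + 1 : ℝ)⁻¹) • ∑ m, H m := by
  have h1 (i : Fin (n + 1)) : ∑ s : Equiv.Perm (Fin (n + 1)), H (s i) =
      ∑ s : Equiv.Perm (Fin (n + 1)), H (s j) :=
    Fintype.sum_equiv (Equiv.mulRight (Equiv.swap i j)) _ _ fun s => by simp
  have h2 : ∑ i, ∑ s : Equiv.Perm (Fin (n + 1)), H (s i) = ((n + 1).factorial : ℝ) • ∑ m, H m := by
    rw [Finset.sum_comm, Finset.sum_congr rfl fun s _ => Equiv.sum_comp s H]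
    simp [Fintype.card_perm, Nat.cast_smul_eq_nsmul]
  simp only [h1, Finset.sum_const, Finset.card_univ, Fintype.card_fin] at h2
  rw [← Nat.cast_smul_eq_nsmul ℝ] at h2
  have hn : ((n + 1 : ℕ) : ℝ) ≠ 0 := by positivity
  have hf : ((n + 1).factorial : ℝ) ≠ 0 := by positivity
  rw [inv_smul_eq_iff₀ hf, smul_comm, ← h2, ← Nat.cast_succ, inv_smul_smul₀ hn]

/-- The multiset of the entries of a tuple. -/
def entries {n : ℕ} (k : Fin n → Fin 4) : Multiset (Fin 4) := (List.ofFn k : Multiset (Fin 4))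

theorem entries_comp_perm {n : ℕ} (k : Fin n → Fin 4) (s : Equiv.Perm (Fin n)) :
    entries (k ∘ s) = entries k :=
  Multiset.coe_eq_coe.2 (Equiv.Perm.ofFn_comp_perm s k)

theorem entries_cons {n : ℕ} (k : Fin (n + 1) → Fin 4) :
    entries k = k 0 ::ₘ entries (Fin.tail k) := by
  simp only [entries, List.ofFn_succ, Multiset.cons_coe]
  rfl

theorem entries_snoc {n : ℕ} (k : Fin (n + 1) → Fin 4) :
    entries k = k (Fin.last n) ::ₘ entries (Fin.init k) := by
  simp only [entries, List.ofFn_succ', List.concat_eq_append, Multiset.cons_coe]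
  exact Multiset.coe_eq_coe.2 (List.perm_append_singleton _ _)

theorem mem_entries {n : ℕ} (k : Fin n → Fin 4) (m : Fin n) : k m ∈ entries k := by
  simp [entries, List.mem_ofFn]

theorem bold_patch {I : Type*} (n : ℕ) (k : Fin n → I) (K : ℕ → I) :
    bold n (patch n k K) = k := by
  funext s
  have : 1 ≤ (s : ℕ) + 1 ∧ (s : ℕ) + 1 ≤ n := ⟨by omega, by omega⟩
  simp only [bold, patch, dif_pos this]
  rfl

theorem patch_of_lt {I : Type*} {n j : ℕ} (k : Fin n → I) (K : ℕ → I) (h : n < j) :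
    patch n k K j = K j := by
  simp only [patch]
  rw [dif_neg (by omega)]

theorem patch_succ {I : Type*} {n j : ℕ} (k : Fin n → I) (K : ℕ → I) (h : j < n) :
    patch n k K (j + 1) = k ⟨j, h⟩ :=
  congrFun (bold_patch n k K) ⟨j, h⟩

theorem Icc_map_eq {n : ℕ} (i : ℕ → Fin 4) :
    (Finset.Icc 2 (n + 1)).val.map i = entries (Fin.tail (bold (n + 1) i)) := by
  have : (Finset.Icc 2 (n + 1)).val = ((List.range' 2 n : List ℕ) : Multiset ℕ) := by
    rw [Nat.Icc_eq_range']
    rfl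
  rw [this, Multiset.map_coe, entries]
  refine congrArg _ (List.ext_getElem (by simp) fun j h1 h2 => ?_)
  simp [Fin.tail, bold, add_comm, add_left_comm]

section Potential

variable {ι : Type*}

theorem aSym_eq (n : ℕ) (i : ℕ → Fin 4) :
    (aSym (n + 1) i : Jet ι → ι → ℝ) = ((n + 1 : ℝ)⁻¹) • ∑ m : Fin (n + 1),
      coordVec ℝ (i (m + 1)) ((entries (bold (n + 1) i)).erase (i (m + 1))) := by
  rw [← sum_perm_apply (fun m : Fin (n + 1) =>
    (coordVec ℝ (i (m + 1)) ((entries (bold (n + 1) i)).erase (i (m + 1))) : Jet ι → ι → ℝ)) 0]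
  unfold aSym symFirst symAvg
  refine congrArg _ (Finset.sum_congr rfl fun s _ => ?_)
  have h1 : patch (n + 1) (bold (n + 1) i ∘ s) i 1 = i (s 0 + 1) :=
    patch_succ _ _ (Nat.succ_pos n)
  beta_reduce
  simp only [Icc_map_eq, bold_patch, h1]
  have h2 := entries_cons (bold (n + 1) i ∘ s)
  rw [entries_comp_perm] at h2
  have h3 : (bold (n + 1) i ∘ s) 0 = i (s 0 + 1) := rfl
  rw [h2, h3, Multiset.erase_cons_head]
  rfl

variable [Fintype ι] {𝔤 : Type*} [LieRing 𝔤] [LieAlgebra ℝ 𝔤] (e : Module.Basis ι ℝ 𝔤)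

theorem hasOrder_of_mem_jetPolyVec {n : ℕ} {G : Jet ι → ι → ℝ}
    (hG : G ∈ jetPolyVec ι ℝ n) : HasOrder n G := by
  choose g hg h using fun α => hasOrder_of_mem_jetPoly (hG α)
  exact ⟨fun w α => g α w, contDiff_pi.2 hg, fun z => funext fun α => h α z⟩

/-- The leading terms of `D_j a_{i_1 ⋯ i_p}`, `a_{i_1 ⋯ i_p j}` and
`∇_{(i_1} ⋯ ∇_{i_{p-1}} F_{i_p) j}`, `p = n + 1`, cancel in the combination at hand. -/
theorem totalD_aSym_sub_mem (n : ℕ) (i : ℕ → Fin 4) :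
    totalD (i (n + 2)) (aSym (n + 1) i) - aSym (n + 2) i
      + (1 / (n + 2 : ℝ)) • symFirst (n + 1)
          (fun i => covs e (bold n i) (field e (i (n + 1)) (i (n + 2)))) i ∈
        jetPolyVec ι ℝ n := by
  set j := i (n + 2) with hj
  set E := entries (bold (n + 1) i) with hE
  -- The common part of the three expressions, up to lower order.
  set S : Jet ι → ι → ℝ := ∑ m : Fin (n + 1),
    coordVec ℝ (i (m + 1)) (j ::ₘ E.erase (i (m + 1))) with hS
  have h1 : totalD j (aSym (n + 1) i : Jet ι → ι → ℝ) = ((n + 1 : ℝ)⁻¹) • S := by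
    have hsum (t : Finset (Fin (n + 1))) :
        totalD j (∑ m ∈ t, coordVec ℝ (i (m + 1)) (E.erase (i (m + 1))) : Jet ι → ι → ℝ) =
          ∑ m ∈ t, coordVec ℝ (i (m + 1)) (j ::ₘ E.erase (i (m + 1))) := by
      induction t using Finset.induction_on with
      | empty =>
        funext z
        simp [totalD, lineDeriv]
      | insert a t ha ih =>
        rw [Finset.sum_insert ha, Finset.sum_insert ha, totalD_add_vec (n := ⊤)
          (coordVec_mem _ _ le_top) (sum_mem fun m _ => coordVec_mem _ _ le_top), ih,
          totalD_coordVec]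
    rw [aSym_eq, totalD_smul_vec (n := ⊤) (sum_mem fun m _ => coordVec_mem _ _ le_top), hsum]
  have h2 : (aSym (n + 2) i : Jet ι → ι → ℝ) =
      ((n + 2 : ℝ)⁻¹) • (S + coordVec ℝ j E) := by
    have hsn : entries (bold (n + 1 + 1) i) = j ::ₘ E := entries_snoc _
    rw [aSym_eq, Fin.sum_univ_castSucc, hsn]
    have hc : ((n + 1 : ℕ) + 1 : ℝ) = n + 2 := by push_cast; ring
    rw [hc]
    refine congrArg _ (congrArg₂ _ (Finset.sum_congr rfl fun m _ => ?_) ?_)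
    · rw [Multiset.erase_cons_tail_of_mem]
      · rfl
      · exact mem_entries (bold (n + 1) i) m
    · change coordVec ℝ j ((j ::ₘ E).erase j) = _
      rw [Multiset.erase_cons_head]
  have h3 : symFirst (n + 1)
      (fun i => covs e (bold n i) (field e (i (n + 1)) (i (n + 2)))) i -
        (coordVec ℝ j E - ((n + 1 : ℝ)⁻¹) • S) ∈ jetPolyVec ι ℝ n := by
    have hav : coordVec ℝ j E - ((n + 1 : ℝ)⁻¹) • S = (((n + 1).factorial : ℝ)⁻¹) •
        ∑ s : Equiv.Perm (Fin (n + 1)), (coordVec ℝ j E - coordVec ℝ (i (s (Fin.last n) + 1))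
          (j ::ₘ E.erase (i (s (Fin.last n) + 1))) : Jet ι → ι → ℝ) := by
      rw [sum_perm_apply (fun m : Fin (n + 1) => (coordVec ℝ j E - coordVec ℝ (i (m + 1))
          (j ::ₘ E.erase (i (m + 1))) : Jet ι → ι → ℝ)), Finset.sum_sub_distrib, smul_sub]
      have hn : ((n : ℝ) + 1) ≠ 0 := by positivity
      rw [Finset.sum_const, Finset.card_univ, Fintype.card_fin, ← Nat.cast_smul_eq_nsmul ℝ,
        Nat.cast_succ, inv_smul_smul₀ hn]
    rw [hav, symFirst, symAvg, ← smul_sub, ← Finset.sum_sub_distrib]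
    refine Submodule.smul_mem _ _ (sum_mem fun s _ => ?_)
    have hl : patch (n + 1) (bold (n + 1) i ∘ s) i (n + 1) = i (s (Fin.last n) + 1) :=
      patch_succ _ _ (Nat.lt_succ_self n)
    have hb : bold n (patch (n + 1) (bold (n + 1) i ∘ s) i) =
        Fin.init (bold (n + 1) i ∘ s) := by
      funext m
      exact patch_succ _ _ (by omega)
    have hE' : E = i (s (Fin.last n) + 1) ::ₘ entries (Fin.init (bold (n + 1) i ∘ s)) := by
      have := entries_snoc (bold (n + 1) i ∘ s)
      rwa [entries_comp_perm] at this
    rw [hl, hb, patch_of_lt _ _ (Nat.lt_succ_self _), ← hj, hE', Multiset.erase_cons_head]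
    have := covs_field_sub_mem e (List.ofFn (Fin.init (bold (n + 1) i ∘ s)))
      (i (s (Fin.last n) + 1)) j
    rwa [List.length_ofFn] at this
  have h4 : totalD j (aSym (n + 1) i) - aSym (n + 2) i
      + (1 / (n + 2 : ℝ)) • symFirst (n + 1)
          (fun i => covs e (bold n i) (field e (i (n + 1)) (i (n + 2)))) i =
      (1 / (n + 2 : ℝ)) • (symFirst (n + 1)
      (fun i => covs e (bold n i) (field e (i (n + 1)) (i (n + 2)))) i -
        (coordVec ℝ j E - ((n + 1 : ℝ)⁻¹) • S)) := by
    rw [h1, h2]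
    have hn1 : ((n : ℝ) + 1) ≠ 0 := by positivity
    have hn2 : ((n : ℝ) + 2) ≠ 0 := by positivity
    match_scalars <;> field_simp
    ring
  rw [h4]
  exact Submodule.smul_mem _ _ h3

end Potential

/-! ### Spinorial covariant derivatives on a complex Lie algebra -/

/-- Two-component spinors, contracted with spinor indices in place of symmetrization. -/
abbrev Spinor : Type := Fin 2 → ℂ

/-- The pairing `ε_{AB} u^A v^B`. -/
def spinPair (u v : Spinor) : ℂ := u 0 * v 1 - u 1 * v 0

theorem spinPair_self (u : Spinor) : spinPair u u = 0 := by
  simp only [spinPair]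
  ring

theorem spinPair_swap (u v : Spinor) : spinPair v u = -spinPair u v := by
  simp only [spinPair]
  ring

/-- The algebraic content of the Yang-Mills equations in spinor form. `nab u v` is the covariant
derivative `u^A v^{A'} ∇_{AA'}`, acting on a Lie algebra of `𝔤`-valued functions; `Φ u w` and
`Φb v w` are the contractions of the two curvature spinors `Φ_{AB}` and `Φ̄_{A'B'}`. The ideal `J n`
is to be thought of as consisting of the expressions which vanish as a consequence of the field
equations and their derivatives of order less than `n`. -/
structure SpinorGauge (L : Type*) [LieRing L] [LieAlgebra ℂ L] where
  /-- The covariant derivatives. -/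
  nab : Spinor →ₗ[ℂ] Spinor →ₗ[ℂ] L →ₗ[ℂ] L
  /-- The curvature spinor with unprimed indices. -/
  Φ : Spinor →ₗ[ℂ] Spinor →ₗ[ℂ] L
  /-- The curvature spinor with primed indices. -/
  Φb : Spinor →ₗ[ℂ] Spinor →ₗ[ℂ] L
  /-- The consequences of the field equations. -/
  J : ℕ → LieIdeal ℂ L
  nab_lie : ∀ u v x y, nab u v ⁅x, y⁆ = ⁅nab u v x, y⁆ + ⁅x, nab u v y⁆
  nab_comm : ∀ u v u' v' x, nab u v (nab u' v' x) - nab u' v' (nab u v x) =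
    spinPair v v' • ⁅Φ u u', x⁆ + spinPair u u' • ⁅Φb v v', x⁆
  Φ_symm : ∀ u w, Φ u w = Φ w u
  Φb_symm : ∀ v w, Φb v w = Φb w v
  J_mono : Monotone J
  J_nab : ∀ n u v x, x ∈ J n → nab u v x ∈ J (n + 1)
  field_eq : ∀ u u' v w, nab u' v (Φ u w) - nab u v (Φ u' w) ∈ J 1
  field_eq_bar : ∀ u v v' w, nab u v' (Φb v w) - nab u v (Φb v' w) ∈ J 1

namespace SpinorGauge

variable {L : Type*} [LieRing L] [LieAlgebra ℂ L] (G : SpinorGauge L)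

/-- Exchange of primed and unprimed indices. -/
def dual : SpinorGauge L where
  nab := G.nab.flip
  Φ := G.Φb
  Φb := G.Φ
  J := G.J
  nab_lie u v := G.nab_lie v u
  nab_comm u v u' v' x := by
    simp only [LinearMap.flip_apply, G.nab_comm]
    exact add_comm _ _
  Φ_symm := G.Φb_symm
  Φb_symm := G.Φ_symm
  J_mono := G.J_mono
  J_nab n u v x hx := G.J_nab n v u x hx
  field_eq u u' v w := G.field_eq_bar v u u' w
  field_eq_bar u v v' w := G.field_eq v v' u w

/-- Membership in the span of all brackets of derivatives of the curvature of order less than `m`,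
modulo the field equations. -/
inductive IsLow : ℕ → L → Prop
  | curv (u w) : IsLow 1 (G.Φ u w)
  | curvBar (v w) : IsLow 1 (G.Φb v w)
  | eqn {m x} : x ∈ G.J (m + 2) → IsLow m x
  | nab {m x} (u v) : IsLow m x → IsLow (m + 1) (G.nab u v x)
  | mono {m x} : IsLow m x → IsLow (m + 1) x
  | add {m x y} : IsLow m x → IsLow m y → IsLow m (x + y)
  | smul {m x} (r : ℂ) : IsLow m x → IsLow m (r • x)
  | lie {m x y} : IsLow m x → IsLow m y → IsLow m ⁅x, y⁆

/-- The span of all brackets of derivatives of the curvature of order less than `m`, modulo the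
field equations. -/
def Low (m : ℕ) : Submodule ℂ L where
  carrier := {x | G.IsLow m x}
  add_mem' := .add
  zero_mem' := .eqn (zero_mem _)
  smul_mem' r _ := .smul r

theorem low_mono : Monotone G.Low := monotone_nat_of_le_succ fun _ _ => .mono

variable {G}

theorem low_lie {m : ℕ} {x y : L} (hx : x ∈ G.Low m) (hy : y ∈ G.Low m) : ⁅x, y⁆ ∈ G.Low m :=
  .lie hx hy

theorem low_nab {m : ℕ} {x : L} (u v : Spinor) (hx : x ∈ G.Low m) : G.nab u v x ∈ G.Low (m + 1) :=
  .nab u v hx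

theorem low_curv {m : ℕ} (u w : Spinor) : G.Φ u w ∈ G.Low (m + 1) :=
  G.low_mono (Nat.le_add_left 1 m) (.curv u w)

theorem low_curvBar {m : ℕ} (v w : Spinor) : G.Φb v w ∈ G.Low (m + 1) :=
  G.low_mono (Nat.le_add_left 1 m) (.curvBar v w)

theorem low_eqn {m n : ℕ} {x : L} (hx : x ∈ G.J n) (h : n ≤ m + 2) : x ∈ G.Low m :=
  .eqn (G.J_mono h hx)

theorem low_pow {m : ℕ} {x : L} (u v : Spinor) (hx : x ∈ G.Low m) (n : ℕ) :
    ((G.nab u v) ^ n) x ∈ G.Low (m + n) := by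
  induction n with
  | zero => exact hx
  | succ n ih =>
    rw [pow_succ', Module.End.mul_apply]
    exact low_nab u v ih

theorem low_pow_curv {m n : ℕ} (h : n < m) (u v a b : Spinor) :
    ((G.nab u v) ^ n) (G.Φ a b) ∈ G.Low m :=
  G.low_mono (by omega) (low_pow u v (low_curv (m := 0) a b) n)

/-- `Low m` is symmetric under the exchange of primed and unprimed indices. -/
theorem low_dual {m : ℕ} {x : L} (hx : x ∈ G.dual.Low m) : x ∈ G.Low m := by
  change G.dual.IsLow m x at hx
  change G.IsLow m x
  induction hx with
  | curv u w => exact .curvBar u w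
  | curvBar v w => exact .curv v w
  | eqn h => exact .eqn h
  | nab u v _ ih => exact .nab v u ih
  | mono _ ih => exact .mono ih
  | add _ _ h1 h2 => exact .add h1 h2
  | smul r _ ih => exact .smul r ih
  | lie _ _ h1 h2 => exact .lie h1 h2

variable (G)

/-- Equality modulo `Low m`, in a form suited to linear combinations. -/
theorem mkQ_eq {m : ℕ} {x y : L} : (G.Low m).mkQ x = (G.Low m).mkQ y ↔ x - y ∈ G.Low m :=
  Submodule.Quotient.eq _

variable {G}

/-- A covariant derivative raises the order of the remainder by one. -/
theorem mkQ_nab {m : ℕ} {x y : L} (u v : Spinor) (h : (G.Low m).mkQ x = (G.Low m).mkQ y) :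
    (G.Low (m + 1)).mkQ (G.nab u v x) = (G.Low (m + 1)).mkQ (G.nab u v y) := by
  rw [mkQ_eq] at h ⊢
  rw [← map_sub]
  exact low_nab u v h

/-- Bracketing with the curvature, or with anything of low order, does not lose an order. -/
theorem mkQ_lie {m : ℕ} {a x y : L} (ha : a ∈ G.Low m)
    (h : (G.Low m).mkQ x = (G.Low m).mkQ y) :
    (G.Low m).mkQ ⁅a, x⁆ = (G.Low m).mkQ ⁅a, y⁆ := by
  rw [mkQ_eq] at h ⊢
  rw [← lie_sub]
  exact low_lie ha h

theorem mkQ_mono {m n : ℕ} {x y : L} (hmn : m ≤ n) (h : (G.Low m).mkQ x = (G.Low m).mkQ y) :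
    (G.Low n).mkQ x = (G.Low n).mkQ y :=
  (G.mkQ_eq).2 (G.low_mono hmn ((G.mkQ_eq).1 h))

theorem mkQ_zero {m : ℕ} {x : L} (h : x ∈ G.Low m) : (G.Low m).mkQ x = 0 :=
  (Submodule.Quotient.mk_eq_zero _).2 h

variable (G)
variable (ξ η ζ θ : Spinor)

/-- The polarization `η^A ∂/∂ξ^A` of `(ξζ∇)^n Φ(ξ, ξ)`. -/
def polQ : ℕ → L
  | 0 => (2 : ℂ) • G.Φ η ξ
  | n + 1 => G.nab ξ ζ (polQ n) + G.nab η ζ (((G.nab ξ ζ) ^ n) (G.Φ ξ ξ))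

/-- The polarization `θ^{A'} ∂/∂ζ^{A'}` of `(ξζ∇)^n Φ(ξ, ξ)`. -/
def polV : ℕ → L
  | 0 => 0
  | n + 1 => G.nab ξ ζ (polV n) + G.nab ξ θ (((G.nab ξ ζ) ^ n) (G.Φ ξ ξ))

/-- The double polarization of `(ξζ∇)^n Φ(ξ, ξ)` with respect to `ξ` and `ζ`. -/
def polU : ℕ → L
  | 0 => 0
  | n + 1 => G.nab ξ ζ (polU n) + G.nab η ζ (G.polV ξ ζ θ n) + G.nab ξ θ (G.polQ ξ η ζ n) +
      G.nab η θ (((G.nab ξ ζ) ^ n) (G.Φ ξ ξ))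

end SpinorGauge

namespace SpinorGauge

variable {L : Type*} [LieRing L] [LieAlgebra ℂ L] (G : SpinorGauge L) (ξ η ζ θ : Spinor)

/-! ### Reordering covariant derivatives -/

section Contracted

/-! The spinors `ξ` and `ζ` carry the symmetrized unprimed and primed indices, `η` and `θ` one
further index of each kind. -/

local notation "𝔇" => G.nab ξ ζ
local notation "𝔜" => G.nab η ζ
local notation "ℨ" => G.nab ξ θ
local notation "𝔛" => G.nab η θ
local notation "φ₀" => G.Φ ξ ξ
local notation "φ₁" => G.Φ η ξ
local notation "ψ₀" => G.Φb ζ ζ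
local notation "ψ₁" => G.Φb θ ζ
local notation "𝔰" => spinPair ξ η
local notation "𝔱" => spinPair ζ θ

theorem pow_succ_der (u v : Spinor) (n : ℕ) (x : L) :
    ((G.nab u v) ^ (n + 1)) x = G.nab u v (((G.nab u v) ^ n) x) := by
  rw [pow_succ', Module.End.mul_apply]

theorem nab_ηζ_comm (x : L) : 𝔜 (𝔇 x) = 𝔇 (𝔜 x) - 𝔰 • ⁅ψ₀, x⁆ := by
  have h := G.nab_comm ξ ζ η ζ x
  rw [spinPair_self, zero_smul, zero_add] at h
  rw [← h]
  abel

theorem nab_ξθ_comm (x : L) : ℨ (𝔇 x) = 𝔇 (ℨ x) - 𝔱 • ⁅φ₀, x⁆ := by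
  have h := G.nab_comm ξ ζ ξ θ x
  rw [spinPair_self, zero_smul, add_zero] at h
  rw [← h]
  abel

theorem nab_ηθ_comm (x : L) : 𝔛 (𝔇 x) = 𝔇 (𝔛 x) - 𝔱 • ⁅φ₁, x⁆ - 𝔰 • ⁅ψ₁, x⁆ := by
  have h := G.nab_comm ξ ζ η θ x
  rw [G.Φ_symm ξ η, G.Φb_symm ζ θ] at h
  rw [sub_sub, ← h]
  abel

theorem nab_ηζ_ξθ_comm (x : L) : 𝔜 (ℨ x) = ℨ (𝔜 x) + 𝔱 • ⁅φ₁, x⁆ - 𝔰 • ⁅ψ₁, x⁆ := by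
  have h := G.nab_comm η ζ ξ θ x
  rw [G.Φb_symm ζ θ, spinPair_swap ξ η, neg_smul, ← sub_eq_add_neg] at h
  rw [add_sub_assoc, ← h]
  abel

/-- Modulo lower order, the derivatives of `Φ(ξ, ξ)` only depend on the symmetrized indices. -/
theorem mkQ_nab_ηζ_pow (n : ℕ) :
    (G.Low n).mkQ (𝔜 ((𝔇 ^ n) φ₀)) = (G.Low n).mkQ ((𝔇 ^ (n + 1)) φ₁) := by
  induction n with
  | zero => exact G.mkQ_eq.2 (low_eqn (G.field_eq ξ η ζ ξ) (by norm_num))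
  | succ n ih =>
    have h1 := mkQ_nab ξ ζ ih
    have h2 := mkQ_zero (low_lie (low_curvBar (G := G) ζ ζ) (low_pow_curv n.lt_succ_self ξ ζ ξ ξ))
    rw [pow_succ_der, nab_ηζ_comm, pow_succ_der _ _ _ (n + 1), map_sub, map_smul, h1, h2]
    simp

/-- Modulo lower order, all `n + 2` terms of the polarization with respect to `ξ` agree, by the
field equations. -/
theorem mkQ_polQ (n : ℕ) :
    (G.Low n).mkQ (G.polQ ξ η ζ n) = (G.Low n).mkQ ((n + 2 : ℂ) • (𝔇 ^ n) φ₁) := by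
  induction n with
  | zero => simp [polQ]
  | succ n ih =>
    have h1 := mkQ_nab ξ ζ ih
    have h2 := mkQ_mono n.le_succ (G.mkQ_nab_ηζ_pow ξ η ζ n)
    rw [map_smul, ← pow_succ_der, map_smul] at h1
    rw [polQ, map_add, h1, h2, map_smul]
    push_cast
    module

theorem mkQ_polV (n : ℕ) :
    (G.Low (n + 1)).mkQ (G.polV ξ ζ θ (n + 1)) =
      (G.Low (n + 1)).mkQ ((n + 1 : ℂ) • ℨ ((𝔇 ^ n) φ₀)) := by
  induction n with
  | zero => simp [polV]
  | succ n ih =>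
    have h1 := mkQ_nab ξ ζ ih
    have h2 := mkQ_zero (low_lie (low_curv (G := G) ξ ξ)
      (low_pow_curv (show n < n + 1 + 1 by omega) ξ ζ ξ ξ))
    have h3 : 𝔇 (ℨ ((𝔇 ^ n) φ₀)) = ℨ ((𝔇 ^ (n + 1)) φ₀) + 𝔱 • ⁅φ₀, (𝔇 ^ n) φ₀⁆ := by
      rw [pow_succ_der, G.nab_ξθ_comm ξ ζ θ]
      abel
    rw [map_smul, h3, map_smul, map_add, map_smul, h2] at h1
    rw [polV, map_add, h1, map_smul]
    push_cast
    module

/-! Differentiating a bracket of the curvature with its derivative of order `k + 1`, the terms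
in which the derivative hits the first factor are of lower order. -/

theorem mkQ_der_lie {m : ℕ} {a b : L} (ha : a ∈ G.Low 1) (hb : b ∈ G.Low (m + 2)) :
    (G.Low (m + 2)).mkQ (𝔇 ⁅a, b⁆) = (G.Low (m + 2)).mkQ ⁅a, 𝔇 b⁆ := by
  rw [G.nab_lie, map_add, mkQ_zero (low_lie (G.low_mono (by omega) (low_nab ξ ζ ha)) hb), zero_add]

theorem mkQ_der_lie_pow (k : ℕ) {a b : L} (ha : a ∈ G.Low 1) (hb : b ∈ G.Low 1) :
    (G.Low (k + 2)).mkQ (𝔇 ⁅a, (𝔇 ^ (k + 1)) b⁆) = (G.Low (k + 2)).mkQ ⁅a, (𝔇 ^ (k + 2)) b⁆ := by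
  rw [G.mkQ_der_lie ξ ζ ha (G.low_mono (by omega) (low_pow ξ ζ hb (k + 1))),
    ← pow_succ_der]

theorem mkQ_der_lie_nab (k : ℕ) :
    (G.Low (k + 2)).mkQ (𝔇 ⁅ψ₀, ℨ ((𝔇 ^ k) φ₀)⁆) =
      (G.Low (k + 2)).mkQ ⁅ψ₀, ℨ ((𝔇 ^ (k + 1)) φ₀)⁆ := by
  have h0 := low_pow_curv (G := G) (show k < k + 1 by omega) ξ ζ ξ ξ
  have h3 : 𝔇 (ℨ ((𝔇 ^ k) φ₀)) = ℨ ((𝔇 ^ (k + 1)) φ₀) + 𝔱 • ⁅φ₀, (𝔇 ^ k) φ₀⁆ := by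
    rw [pow_succ_der, G.nab_ξθ_comm ξ ζ θ]
    abel
  rw [G.mkQ_der_lie ξ ζ (low_curvBar ζ ζ) (low_nab _ _ h0), h3, lie_add, map_add, lie_smul,
    map_smul,
    mkQ_zero (low_lie (low_curvBar ζ ζ) (low_lie (low_curv ξ ξ) (G.low_mono (by omega) h0))),
    smul_zero, add_zero]

/-- The brackets of the curvature with its derivatives of order `k + 1` which occur when
derivatives are reordered. -/
def quad (k : ℕ) (c₁ c₂ c₃ c₄ c₅ : ℂ) : L :=
  c₁ • ⁅φ₁, (𝔇 ^ (k + 1)) φ₀⁆ + c₂ • ⁅φ₀, (𝔇 ^ (k + 1)) φ₁⁆ + c₃ • ⁅ψ₁, (𝔇 ^ (k + 1)) φ₀⁆ +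
    c₄ • ⁅φ₀, (𝔇 ^ (k + 1)) ψ₁⁆ + c₅ • ⁅ψ₀, ℨ ((𝔇 ^ k) φ₀)⁆

/-- Modulo lower order, `𝔇` only acts on the second factors of the brackets. -/
theorem mkQ_der_quad (k : ℕ) (c₁ c₂ c₃ c₄ c₅ : ℂ) :
    (G.Low (k + 2)).mkQ (𝔇 (G.quad ξ η ζ θ k c₁ c₂ c₃ c₄ c₅)) =
      (G.Low (k + 2)).mkQ (G.quad ξ η ζ θ (k + 1) c₁ c₂ c₃ c₄ c₅) := by
  have a₀ := low_curv (G := G) (m := 0) ξ ξ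
  have a₁ := low_curv (G := G) (m := 0) η ξ
  have b₁ := low_curvBar (G := G) (m := 0) θ ζ
  simp only [quad, map_add, map_smul, G.mkQ_der_lie_pow ξ ζ k a₁ a₀,
    G.mkQ_der_lie_pow ξ ζ k a₀ a₁, G.mkQ_der_lie_pow ξ ζ k b₁ a₀, G.mkQ_der_lie_pow ξ ζ k a₀ b₁,
    G.mkQ_der_lie_nab ξ ζ θ k]

/-- The brackets which occur when two derivatives are reordered. -/
def quad₀ (c₁ c₂ : ℂ) : L := c₁ • ⁅φ₁, φ₀⁆ + c₂ • ⁅ψ₁, φ₀⁆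

theorem der_quad₀ (c₁ c₂ : ℂ) :
    𝔇 (G.quad₀ ξ η ζ θ c₁ c₂) = G.quad ξ η ζ θ 0 c₁ (-c₁) c₂ (-c₂) 0 := by
  simp only [quad₀, quad, map_add, map_smul, G.nab_lie, zero_add, pow_one]
  rw [← lie_skew (𝔇 φ₁), ← lie_skew (𝔇 ψ₁)]
  module

/-- A known expression for `x` yields one for its derivative. -/
theorem mkQ_der_step {k : ℕ} {x y : L} {N c₁ c₂ c₃ c₄ c₅ : ℂ}
    (h : (G.Low (k + 1)).mkQ x = (G.Low (k + 1)).mkQ (N • y + G.quad ξ η ζ θ k c₁ c₂ c₃ c₄ c₅)) :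
    (G.Low (k + 2)).mkQ (𝔇 x) =
      (G.Low (k + 2)).mkQ (N • 𝔇 y + G.quad ξ η ζ θ (k + 1) c₁ c₂ c₃ c₄ c₅) := by
  have h1 := mkQ_nab ξ ζ h
  rw [map_add, map_add, G.mkQ_der_quad, ← map_add, map_smul] at h1
  exact h1

theorem mkQ_der_step₀ {x y : L} {N c₁ c₂ : ℂ}
    (h : (G.Low 0).mkQ x = (G.Low 0).mkQ (N • y + G.quad₀ ξ η ζ θ c₁ c₂)) :
    (G.Low 1).mkQ (𝔇 x) =
      (G.Low 1).mkQ (N • 𝔇 y + G.quad ξ η ζ θ 0 c₁ (-c₁) c₂ (-c₂) 0) := by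
  have h1 := mkQ_nab ξ ζ h
  rw [map_add, map_smul, der_quad₀] at h1
  exact h1

/-! The expressions occurring in the recursion for the double polarization of
`(ξζ∇)^n Φ(ξ, ξ)`, in terms of `(ξζ∇)^n (ηθ∇) Φ(ξ, ξ)`. -/

theorem mkQ_nab_ηθ_pow_one :
    (G.Low 0).mkQ (𝔛 ((𝔇 ^ 1) φ₀)) =
      (G.Low 0).mkQ ((1 : ℂ) • (𝔇 ^ 1) (𝔛 φ₀) + G.quad₀ ξ η ζ θ (-𝔱) (-𝔰)) := by
  rw [pow_one, nab_ηθ_comm, quad₀]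
  congr 1
  module

theorem mkQ_nab_ηθ_pow (k : ℕ) :
    (G.Low (k + 1)).mkQ (𝔛 ((𝔇 ^ (k + 2)) φ₀)) =
      (G.Low (k + 1)).mkQ ((1 : ℂ) • (𝔇 ^ (k + 2)) (𝔛 φ₀) +
        G.quad ξ η ζ θ k (-(k + 2) * 𝔱) 𝔱 (-(k + 2) * 𝔰) 𝔰 0) := by
  induction k with
  | zero =>
    have h := G.mkQ_der_step₀ ξ η ζ θ (G.mkQ_nab_ηθ_pow_one ξ η ζ θ)
    rw [pow_succ_der _ _ _ 1, nab_ηθ_comm, pow_succ_der _ _ _ 1]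
    simp only [quad, map_add, map_sub, map_smul, Nat.cast_zero] at h ⊢
    linear_combination (norm := module) h
  | succ k ih =>
    have h := G.mkQ_der_step ξ η ζ θ ih
    rw [pow_succ_der _ _ _ (k + 2), nab_ηθ_comm, pow_succ_der _ _ _ (k + 2)]
    simp only [quad, map_add, map_sub, map_smul, Nat.cast_succ] at h ⊢
    linear_combination (norm := module) h

theorem nab_ξθ_ηζ_der (x : L) : ℨ (𝔜 (𝔇 x)) =
    𝔇 (ℨ (𝔜 x)) - 𝔱 • ⁅φ₀, 𝔜 x⁆ - 𝔰 • ⁅ℨ ψ₀, x⁆ - 𝔰 • ⁅ψ₀, ℨ x⁆ := by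
  rw [G.nab_ηζ_comm ξ η ζ, map_sub, map_smul, G.nab_ξθ_comm ξ ζ θ, G.nab_lie]
  module

theorem mkQ_field_eq {n : ℕ} :
    (G.Low n).mkQ (𝔜 φ₀) = (G.Low n).mkQ (𝔇 φ₁) :=
  G.mkQ_eq.2 (low_eqn (G.field_eq ξ η ζ ξ) (by omega))

theorem mkQ_der_field_eq (u v : Spinor) {n : ℕ} :
    (G.Low n).mkQ (G.nab u v (𝔜 φ₀)) = (G.Low n).mkQ (G.nab u v (𝔇 φ₁)) := by
  rw [mkQ_eq, ← map_sub]
  exact low_eqn (G.J_nab 1 u v _ (G.field_eq ξ η ζ ξ)) (by omega)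

theorem mkQ_der_field_eq' (u v : Spinor) {n : ℕ} :
    (G.Low n).mkQ (G.nab u v (ℨ φ₁)) = (G.Low n).mkQ (G.nab u v (𝔛 φ₀)) := by
  rw [mkQ_eq, ← map_sub, ← neg_mem_iff, ← map_neg, neg_sub]
  exact low_eqn (G.J_nab 1 u v _ (G.field_eq ξ η θ ξ)) (by omega)

theorem mkQ_field_eq_bar {n : ℕ} :
    (G.Low n).mkQ (ℨ ψ₀) = (G.Low n).mkQ (𝔇 ψ₁) :=
  G.mkQ_eq.2 (low_eqn (G.field_eq_bar ξ ζ θ ζ) (by omega))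

theorem mkQ_nab_ξθ_ηζ_pow_zero :
    (G.Low 0).mkQ (ℨ (𝔜 ((𝔇 ^ 0) φ₀))) =
      (G.Low 0).mkQ ((1 : ℂ) • (𝔇 ^ 1) (𝔛 φ₀) + G.quad₀ ξ η ζ θ 𝔱 0) := by
  rw [pow_zero, Module.End.one_apply, G.mkQ_der_field_eq, G.nab_ξθ_comm ξ ζ θ, map_sub,
    G.mkQ_der_field_eq', ← map_sub, quad₀, pow_one, ← lie_skew φ₀]
  congr 1
  module

theorem mkQ_nab_ξθ_ηζ_pow (k : ℕ) :
    (G.Low (k + 1)).mkQ (ℨ (𝔜 ((𝔇 ^ (k + 1)) φ₀))) =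
      (G.Low (k + 1)).mkQ ((1 : ℂ) • (𝔇 ^ (k + 2)) (𝔛 φ₀) +
        G.quad ξ η ζ θ k 𝔱 (-(k + 2) * 𝔱) 0 𝔰 (-(k + 1) * 𝔰)) := by
  induction k with
  | zero =>
    have h := G.mkQ_der_step₀ ξ η ζ θ (G.mkQ_nab_ξθ_ηζ_pow_zero ξ η ζ θ)
    have h1 := mkQ_lie (low_curv ξ ξ) (G.mkQ_field_eq ξ η ζ (n := 0 + 1))
    have h2 := mkQ_lie (low_curv ξ ξ) (G.mkQ_field_eq_bar ξ ζ θ (n := 0 + 1))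
    rw [pow_succ_der _ _ _ 0, nab_ξθ_ηζ_der, pow_succ_der _ _ _ 1]
    simp only [quad, map_add, map_sub, map_smul, Nat.cast_zero, zero_add, pow_one, pow_zero,
      Module.End.one_apply] at h h1 h2 ⊢
    rw [← lie_skew (ℨ ψ₀), map_neg, h1, h2]
    linear_combination (norm := module) h
  | succ k ih =>
    have h := G.mkQ_der_step ξ η ζ θ ih
    have h1 := mkQ_lie (low_curv ξ ξ) (mkQ_mono (Nat.le_succ _) (G.mkQ_nab_ηζ_pow ξ η ζ (k + 1)))
    have h2 := mkQ_zero (low_lie (G.low_mono (show 2 ≤ k + 2 by omega)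
      (low_nab (G := G) ξ θ (low_curvBar ζ ζ)))
      (low_pow_curv (show k + 1 < k + 2 by omega) ξ ζ ξ ξ))
    rw [pow_succ_der _ _ _ (k + 1), nab_ξθ_ηζ_der, pow_succ_der _ _ _ (k + 2)]
    simp only [quad, map_add, map_sub, map_smul, Nat.cast_succ] at h ⊢
    rw [h1, h2]
    linear_combination (norm := module) h

theorem nab_ξθ_polQ_succ (n : ℕ) : ℨ (G.polQ ξ η ζ (n + 1)) =
    𝔇 (ℨ (G.polQ ξ η ζ n)) - 𝔱 • ⁅φ₀, G.polQ ξ η ζ n⁆ + ℨ (𝔜 ((𝔇 ^ n) φ₀)) := by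
  rw [polQ, map_add, G.nab_ξθ_comm ξ ζ θ]

theorem nab_ηζ_polV_succ (n : ℕ) : 𝔜 (G.polV ξ ζ θ (n + 1)) =
    𝔇 (𝔜 (G.polV ξ ζ θ n)) - 𝔰 • ⁅ψ₀, G.polV ξ ζ θ n⁆ + ℨ (𝔜 ((𝔇 ^ n) φ₀)) +
      𝔱 • ⁅φ₁, (𝔇 ^ n) φ₀⁆ - 𝔰 • ⁅ψ₁, (𝔇 ^ n) φ₀⁆ := by
  rw [polV, map_add, G.nab_ηζ_comm ξ η ζ, G.nab_ηζ_ξθ_comm ξ η ζ θ]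
  abel

theorem mkQ_nab_polQ_one :
    (G.Low 0).mkQ (ℨ (G.polQ ξ η ζ 1)) =
      (G.Low 0).mkQ ((3 : ℂ) • (𝔇 ^ 1) (𝔛 φ₀) + G.quad₀ ξ η ζ θ (3 * 𝔱) 0) := by
  have h := G.mkQ_nab_ξθ_ηζ_pow_zero ξ η ζ θ
  have h1 := G.mkQ_der_field_eq' ξ η θ ξ ζ (n := 0)
  rw [nab_ξθ_polQ_succ, polQ, ← lie_skew φ₀]
  simp only [quad₀, map_add, map_sub, map_smul, map_neg, smul_lie, pow_one] at h ⊢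
  rw [h1]
  linear_combination (norm := module) h

theorem mkQ_nab_polQ (k : ℕ) :
    (G.Low (k + 1)).mkQ (ℨ (G.polQ ξ η ζ (k + 2))) =
      (G.Low (k + 1)).mkQ ((k + 4 : ℂ) • (𝔇 ^ (k + 2)) (𝔛 φ₀) +
        G.quad ξ η ζ θ k ((k + 4) * 𝔱) (-(k + 2) * (k + 4) * 𝔱) 0 ((k + 1) * 𝔰)
          (-(k + 1) * (k + 2) / 2 * 𝔰)) := by
  induction k with
  | zero =>
    have h := G.mkQ_der_step₀ ξ η ζ θ (G.mkQ_nab_polQ_one ξ η ζ θ)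
    have h1 := G.mkQ_nab_ξθ_ηζ_pow ξ η ζ θ 0
    have h2 := mkQ_lie (low_curv ξ ξ) (G.mkQ_polQ ξ η ζ 1)
    rw [nab_ξθ_polQ_succ, pow_succ_der _ _ _ 1]
    rw [pow_succ_der _ _ _ 1] at h1
    simp only [quad, map_add, map_sub, map_smul, Nat.cast_zero, Nat.cast_one, zero_add,
      lie_smul] at h h1 h2 ⊢
    linear_combination (norm := module) h + h1 - 𝔱 • h2
  | succ k ih =>
    have h := G.mkQ_der_step ξ η ζ θ ih
    have h1 := G.mkQ_nab_ξθ_ηζ_pow ξ η ζ θ (k + 1)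
    have h2 := mkQ_lie (low_curv ξ ξ) (G.mkQ_polQ ξ η ζ (k + 2))
    rw [nab_ξθ_polQ_succ, pow_succ_der _ _ _ (k + 2)]
    rw [pow_succ_der _ _ _ (k + 2)] at h1
    simp only [quad, map_add, map_sub, map_smul, Nat.cast_succ, lie_smul] at h h1 h2 ⊢
    linear_combination (norm := module) h + h1 - 𝔱 • h2

theorem mkQ_nab_polV_one :
    (G.Low 0).mkQ (𝔜 (G.polV ξ ζ θ 1)) =
      (G.Low 0).mkQ ((1 : ℂ) • (𝔇 ^ 1) (𝔛 φ₀) + G.quad₀ ξ η ζ θ (2 * 𝔱) (-𝔰)) := by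
  have h := G.mkQ_nab_ξθ_ηζ_pow_zero ξ η ζ θ
  rw [nab_ηζ_polV_succ, polV]
  simp only [quad₀, map_add, map_sub, map_smul, map_zero, lie_zero, pow_one, pow_zero,
    Module.End.one_apply] at h ⊢
  linear_combination (norm := module) h

theorem mkQ_nab_polV (k : ℕ) :
    (G.Low (k + 1)).mkQ (𝔜 (G.polV ξ ζ θ (k + 2))) =
      (G.Low (k + 1)).mkQ ((k + 2 : ℂ) • (𝔇 ^ (k + 2)) (𝔛 φ₀) +
        G.quad ξ η ζ θ k (2 * (k + 2) * 𝔱) (-(k ^ 2 + 5 * k + 8) / 2 * 𝔱) (-(k + 2) * 𝔰)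
          ((k + 2) * 𝔰) (-(k + 1) * (k + 2) * 𝔰)) := by
  induction k with
  | zero =>
    have h := G.mkQ_der_step₀ ξ η ζ θ (G.mkQ_nab_polV_one ξ η ζ θ)
    have h1 := G.mkQ_nab_ξθ_ηζ_pow ξ η ζ θ 0
    have h2 := mkQ_lie (low_curvBar ζ ζ) (G.mkQ_polV ξ ζ θ 0)
    rw [nab_ηζ_polV_succ, pow_succ_der _ _ _ 1]
    rw [pow_succ_der _ _ _ 1] at h1
    simp only [quad, map_add, map_sub, map_smul, Nat.cast_zero, zero_add,
      lie_smul] at h h1 h2 ⊢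
    linear_combination (norm := module) h + h1 - 𝔰 • h2
  | succ k ih =>
    have h := G.mkQ_der_step ξ η ζ θ ih
    have h1 := G.mkQ_nab_ξθ_ηζ_pow ξ η ζ θ (k + 1)
    have h2 := mkQ_lie (low_curvBar ζ ζ) (G.mkQ_polV ξ ζ θ (k + 1))
    rw [nab_ηζ_polV_succ, pow_succ_der _ _ _ (k + 2)]
    rw [pow_succ_der _ _ _ (k + 2)] at h1
    simp only [quad, map_add, map_sub, map_smul, Nat.cast_succ, lie_smul] at h h1 h2 ⊢
    linear_combination (norm := module) h + h1 - 𝔰 • h2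

theorem polU_one : G.polU ξ η ζ θ 1 = (2 : ℂ) • ℨ φ₁ + 𝔛 φ₀ := by
  simp [polU, polV, polQ]

theorem mkQ_polU_two :
    (G.Low 0).mkQ (G.polU ξ η ζ θ 2) =
      (G.Low 0).mkQ ((8 : ℂ) • (𝔇 ^ 1) (𝔛 φ₀) + G.quad₀ ξ η ζ θ (4 * 𝔱) (-2 * 𝔰)) := by
  have h0 := G.mkQ_der_field_eq' ξ η θ ξ ζ (n := 0)
  have h1 := G.mkQ_nab_polV_one ξ η ζ θ
  have h2 := G.mkQ_nab_polQ_one ξ η ζ θ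
  have h3 := G.mkQ_nab_ηθ_pow_one ξ η ζ θ
  rw [polU, polU_one]
  simp only [quad₀, map_add, map_smul, pow_one] at h1 h2 h3 ⊢
  linear_combination (norm := module) (2 : ℂ) • h0 + h1 + h2 + h3

theorem mkQ_polU (k : ℕ) :
    (G.Low (k + 1)).mkQ (G.polU ξ η ζ θ (k + 3)) =
      (G.Low (k + 1)).mkQ (((k + 3) * (k + 5) : ℂ) • (𝔇 ^ (k + 2)) (𝔛 φ₀) +
        G.quad ξ η ζ θ k ((k + 2) * (k + 5) * 𝔱) (-(k + 2) * (k + 3) * (k + 5) / 2 * 𝔱)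
          (-(k + 2) * (k + 3) * 𝔰) ((k + 2) * (k + 3) * 𝔰)
          (-(k + 1) * (k + 2) * (k + 3) / 2 * 𝔰)) := by
  have h1 := G.mkQ_nab_polV ξ η ζ θ k
  have h2 := G.mkQ_nab_polQ ξ η ζ θ k
  have h3 := G.mkQ_nab_ηθ_pow ξ η ζ θ k
  rw [polU]
  induction k with
  | zero =>
    have h := G.mkQ_der_step₀ ξ η ζ θ (G.mkQ_polU_two ξ η ζ θ)
    rw [← pow_succ_der] at h
    simp only [quad, map_add, map_smul, Nat.cast_zero, zero_add] at h h1 h2 h3 ⊢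
    linear_combination (norm := module) h + h1 + h2 + h3
  | succ k ih =>
    have h := G.mkQ_der_step ξ η ζ θ (ih (G.mkQ_nab_polV ξ η ζ θ k) (G.mkQ_nab_polQ ξ η ζ θ k)
      (G.mkQ_nab_ηθ_pow ξ η ζ θ k))
    rw [← pow_succ_der, ← polU] at h
    simp only [quad, map_add, map_smul, Nat.cast_succ] at h h1 h2 h3 ⊢
    linear_combination (norm := module) h + h1 + h2 + h3

/-! ### The contracted form of the two spinor identities -/

/-- The bracket `ε_{AB} ε^{CD} [Φ_{CE}, Φ_{D ⋯}]` of the curvature with a symmetrized derivative of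
order `m`, where `ξ` is inserted for `A`, `η` for `B` and `ξ` for the other indices. -/
def brUnprimed (m : ℕ) : L :=
  ((m + 2 : ℂ)⁻¹) • ⁅φ₀, G.polQ ξ η ζ m⁆ - ⁅φ₁, (𝔇 ^ m) φ₀⁆

/-- The primed counterpart of `brUnprimed`, with `Φ̄` in place of the first `Φ`. For `m = 0` the
second factor has no primed index to contract with; this value only occurs with the coefficient
zero. -/
def brPrimed (m : ℕ) : L :=
  ((m : ℂ)⁻¹) • ⁅ψ₀, G.polV ξ ζ θ m⁆ - ⁅ψ₁, (𝔇 ^ m) φ₀⁆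

theorem mkQ_lie_polQ (k : ℕ) : (G.Low (k + 1)).mkQ ⁅φ₀, G.polQ ξ η ζ (k + 1)⁆ =
    (G.Low (k + 1)).mkQ ((k + 3 : ℂ) • ⁅φ₀, (𝔇 ^ (k + 1)) φ₁⁆) := by
  rw [mkQ_lie (low_curv ξ ξ) (G.mkQ_polQ ξ η ζ (k + 1)), lie_smul]
  push_cast
  congr 2
  ring

theorem mkQ_lie_polQ_dual (k : ℕ) : (G.Low (k + 1)).mkQ ⁅φ₀, G.dual.polQ ζ θ ξ (k + 1)⁆ =
    (G.Low (k + 1)).mkQ ((k + 3 : ℂ) • ⁅φ₀, (𝔇 ^ (k + 1)) ψ₁⁆) := by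
  have h : (G.Low (k + 1)).mkQ (G.dual.polQ ζ θ ξ (k + 1)) =
      (G.Low (k + 1)).mkQ (((k + 1 : ℕ) + 2 : ℂ) • (𝔇 ^ (k + 1)) ψ₁) :=
    G.mkQ_eq.2 (low_dual (G.dual.mkQ_eq.1 (G.dual.mkQ_polQ ζ θ ξ (k + 1))))
  rw [mkQ_lie (low_curv ξ ξ) h, lie_smul]
  push_cast
  congr 2
  ring

theorem mkQ_lie_polV (k : ℕ) : (G.Low (k + 1)).mkQ ⁅ψ₀, G.polV ξ ζ θ (k + 1)⁆ =
    (G.Low (k + 1)).mkQ ((k + 1 : ℂ) • ⁅ψ₀, ℨ ((𝔇 ^ k) φ₀)⁆) := by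
  rw [mkQ_lie (low_curvBar ζ ζ) (G.mkQ_polV ξ ζ θ k), lie_smul]

/-- The identity for `∇ Φ^{K'_1 ⋯ K'_p}_{K_1 ⋯ K_{p+2}}`, `p = m + 1`, contracted with spinors. Both
`polU` and the left-hand side are known in terms of `𝔇 ^ p (𝔛 φ₀)`, which is eliminated. -/
theorem mkQ_nab_pow_curv (m : ℕ) {p δ : ℂ} (hp : p = m + 1) (hδ : δ = if m = 0 then 1 else 0) :
    (G.Low m).mkQ (𝔛 ((𝔇 ^ (m + 1)) φ₀)) = (G.Low m).mkQ
      (((p + 1) * (p + 3))⁻¹ • G.polU ξ η ζ θ (m + 2)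
      + ((p ^ 2 + p - 2) / (2 * (p + 1))) • ((-𝔱 / (p + 3)) •
          ((2 : ℂ) • ⁅φ₁, (𝔇 ^ m) φ₀⁆ + ⁅φ₀, G.polQ ξ η ζ m⁆))
      - (3 * (1 - δ) / (p + 3)) • ((-𝔰 / (p + 1)) • ⁅φ₀, G.dual.polQ ζ θ ξ m⁆)
      + (p * (p + 5) / (2 * (p + 3))) • ((-𝔰 / (p + 1)) •
          ((2 : ℂ) • ⁅ψ₁, (𝔇 ^ m) φ₀⁆ + ⁅ψ₀, G.polV ξ ζ θ m⁆))
      + ((p + 1) * (p + 2) / (p + 3) - 3 / 4 * δ) • (𝔱 • G.brUnprimed ξ η ζ m)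
      + (p * (p - 1) / (p + 1)) • (𝔰 • G.brPrimed ξ ζ θ m)) := by
  subst hp hδ
  rcases m with _ | k
  · have h1 := G.mkQ_polU_two ξ η ζ θ
    have h2 := G.mkQ_nab_ηθ_pow_one ξ η ζ θ
    have h3 : ⁅φ₀, φ₁⁆ = -⁅φ₁, φ₀⁆ := (lie_skew _ _).symm
    simp only [quad₀, brUnprimed, brPrimed, polQ, polV, map_add, map_sub, map_smul, map_neg,
      if_true, Nat.cast_zero, zero_add, pow_zero, Module.End.one_apply, lie_smul, h3, lie_zero,
      map_zero] at h1 h2 ⊢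
    linear_combination (norm := skip) h2 - (8 : ℂ)⁻¹ • h1
    match_scalars <;> ring
  · have h1 := G.mkQ_polU ξ η ζ θ k
    have h2 := G.mkQ_nab_ηθ_pow ξ η ζ θ k
    have k1 : (k : ℂ) + 1 ≠ 0 := Nat.cast_add_one_ne_zero k
    have k3 : (k : ℂ) + 3 ≠ 0 := by exact_mod_cast (show k + 3 ≠ 0 by omega)
    have k5 : (k : ℂ) + 5 ≠ 0 := by exact_mod_cast (show k + 5 ≠ 0 by omega)
    simp only [quad, brUnprimed, brPrimed, map_add, map_sub, map_smul, mkQ_lie_polQ,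
      mkQ_lie_polQ_dual, mkQ_lie_polV, Nat.cast_succ, Nat.succ_ne_zero, if_false] at h1 h2 ⊢
    linear_combination (norm := skip) h2 - ((k + 3) * (k + 5) : ℂ)⁻¹ • h1
    have e2 : (k : ℂ) + 2 + 1 = k + 3 := by ring
    have e3 : (k : ℂ) + 2 + 3 = k + 5 := by ring
    have e4 : (k : ℂ) + 1 + 2 = k + 3 := by ring
    have e5 : (k : ℂ) + 1 + 1 = k + 2 := by ring
    simp only [e2, e3, e4, e5]
    match_scalars <;> field_simp
    all_goals ring

/-- The operator `(ε_{AB} ξ^A η^B) (ε_{A'B'} ζ^{A'} θ^{B'}) ∇²`. -/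
def box (x : L) : L := 𝔇 (𝔛 x) + 𝔛 (𝔇 x) - 𝔜 (ℨ x) - ℨ (𝔜 x)

theorem box_eq (x : L) : G.box ξ η ζ θ x =
    (2 : ℂ) • 𝔛 (𝔇 x) - (2 : ℂ) • ℨ (𝔜 x) + (2 : ℂ) • 𝔰 • ⁅ψ₁, x⁆ := by
  rw [box, G.nab_ηζ_ξθ_comm ξ η ζ θ, G.nab_ηθ_comm ξ η ζ θ]
  module

/-- The identity for `∇² Φ^{K'_1 ⋯ K'_p}_{K_1 ⋯ K_{p+2}}`, contracted with spinors. -/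
theorem mkQ_box_pow_curv (m : ℕ) {p δ : ℂ} (hp : p = m) (hδ : δ = if m = 0 then 1 else 0) :
    (G.Low m).mkQ (G.box ξ η ζ θ ((𝔇 ^ m) φ₀)) = (G.Low m).mkQ
      ((2 * (p + 2 - δ)) • (𝔱 • G.brUnprimed ξ η ζ m)
      + (2 * p) • (𝔰 • G.brPrimed ξ ζ θ m)) := by
  subst hp hδ
  rw [box_eq, ← pow_succ_der]
  rcases m with _ | k
  · have h1 := G.mkQ_nab_ξθ_ηζ_pow_zero ξ η ζ θ
    have h2 := G.mkQ_nab_ηθ_pow_one ξ η ζ θ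
    have h3 : ⁅φ₀, φ₁⁆ = -⁅φ₁, φ₀⁆ := (lie_skew _ _).symm
    simp only [quad₀, brUnprimed, brPrimed, polQ, polV, map_add, map_sub, map_smul, map_neg,
      if_true, Nat.cast_zero, zero_add, pow_zero, Module.End.one_apply, lie_smul, h3, lie_zero,
      map_zero] at h1 h2 ⊢
    linear_combination (norm := module) (2 : ℂ) • h2 - (2 : ℂ) • h1
  · have h1 := G.mkQ_nab_ξθ_ηζ_pow ξ η ζ θ k
    have h2 := G.mkQ_nab_ηθ_pow ξ η ζ θ k
    have k1 : (k : ℂ) + 1 ≠ 0 := Nat.cast_add_one_ne_zero k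
    have k3 : (k : ℂ) + 3 ≠ 0 := by exact_mod_cast (show k + 3 ≠ 0 by omega)
    have e4 : (k : ℂ) + 1 + 2 = k + 3 := by ring
    simp only [quad, brUnprimed, brPrimed, map_add, map_sub, map_smul, mkQ_lie_polQ,
      mkQ_lie_polV, Nat.cast_succ, Nat.succ_ne_zero, if_false, e4] at h1 h2 ⊢
    linear_combination (norm := skip) (2 : ℂ) • h2 - (2 : ℂ) • h1
    match_scalars <;> field_simp
    all_goals ring

end Contracted

end SpinorGauge

/-! ### Polynomial families in a vector space -/

/-- `h τ` depends polynomially on `τ`, with constant term `a` and linear coefficient `b`. -/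
def HasExpansion {V : Type*} [AddCommGroup V] [Module ℂ V] (h : ℂ → V) (a b : V) : Prop :=
  ∃ c : ℕ →₀ V, (∀ τ, h τ = c.sum fun k v => τ ^ k • v) ∧ c 0 = a ∧ c 1 = b

/-- If all values of a polynomial lie in a subspace, then so do its coefficients. -/
theorem coeff_mem_of_forall_mem {V : Type*} [AddCommGroup V] [Module ℂ V] (W : Submodule ℂ V)
    (N : ℕ) (c : ℕ → V) (h : ∀ τ : ℂ, ∑ k ∈ Finset.range N, τ ^ k • c k ∈ W) :
    ∀ k < N, c k ∈ W := by
  induction N generalizing c with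
  | zero => simp
  | succ N ih =>
    -- Comparing the values at `2 τ` and `τ` eliminates the coefficient of `τ ^ N`.
    have h1 := ih (fun k => ((2 : ℂ) ^ k - 2 ^ N) • c k) fun τ => by
      have h2 := W.sub_mem (h (2 * τ)) (W.smul_mem (2 ^ N) (h τ))
      rw [Finset.sum_range_succ, Finset.sum_range_succ] at h2
      convert h2 using 1
      rw [smul_add, add_sub_add_comm, mul_pow, mul_smul, sub_self, add_zero, Finset.smul_sum,
        ← Finset.sum_sub_distrib]
      refine Finset.sum_congr rfl fun k _ => ?_
      module
    have h2 : ∀ k < N, c k ∈ W := fun k hk => by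
      have hne : ((2 : ℂ) ^ k - 2 ^ N) ≠ 0 := by
        rw [sub_ne_zero]
        exact_mod_cast (Nat.pow_lt_pow_right (by norm_num : 1 < 2) hk).ne
      exact (W.smul_mem_iff hne).1 (h1 k hk)
    intro k hk
    rcases Nat.lt_succ_iff_lt_or_eq.1 hk with hk | rfl
    · exact h2 k hk
    · have h3 := h 1
      simp only [one_pow, one_smul, Finset.sum_range_succ] at h3
      exact (W.add_mem_iff_right (W.sum_mem fun j hj => h2 j (Finset.mem_range.1 hj))).1 h3

namespace HasExpansion

variable {V : Type*} [AddCommGroup V] [Module ℂ V] {h h' : ℂ → V} {a b a' b' : V}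

theorem mem (H : HasExpansion h a b) (W : Submodule ℂ V) (hW : ∀ τ, h τ ∈ W) : b ∈ W := by
  obtain ⟨c, hc, -, rfl⟩ := H
  by_cases h1 : c 1 = 0
  · rw [h1]
    exact W.zero_mem
  refine coeff_mem_of_forall_mem W (c.support.sup id + 1) c (fun τ => ?_) 1
    (Nat.lt_succ_of_le (Finset.le_sup (f := id) (Finsupp.mem_support_iff.2 h1)))
  have := hW τ
  rwa [hc, Finsupp.sum_of_support_subset c (fun k hk => Finset.mem_range.2
    (Nat.lt_succ_of_le (Finset.le_sup (f := id) hk))) _ fun _ _ => smul_zero _] at this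

theorem add (H : HasExpansion h a b) (H' : HasExpansion h' a' b') :
    HasExpansion (fun τ => h τ + h' τ) (a + a') (b + b') := by
  obtain ⟨c, hc, rfl, rfl⟩ := H
  obtain ⟨d, hd, rfl, rfl⟩ := H'
  refine ⟨c + d, fun τ => ?_, rfl, rfl⟩
  beta_reduce
  rw [hc, hd, Finsupp.sum_add_index' (fun _ => smul_zero _) fun _ _ _ => smul_add _ _ _]

theorem map (H : HasExpansion h a b) (A B : V →ₗ[ℂ] V) :
    HasExpansion (fun τ => (A + τ • B) (h τ)) (A a) (A b + B a) := by
  obtain ⟨c, hc, rfl, rfl⟩ := H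
  refine ⟨c.mapRange A A.map_zero + (c.mapRange B B.map_zero).mapDomain Nat.succ,
    fun τ => ?_, ?_, ?_⟩
  · beta_reduce
    rw [Finsupp.sum_add_index' (fun _ => smul_zero _) fun _ _ _ => smul_add _ _ _,
      Finsupp.sum_mapDomain_index (fun _ => smul_zero _) fun _ _ _ => smul_add _ _ _,
      Finsupp.sum_mapRange_index fun _ => smul_zero _,
      Finsupp.sum_mapRange_index fun _ => smul_zero _, hc, LinearMap.add_apply,
      LinearMap.smul_apply, map_finsuppSum, map_finsuppSum, Finsupp.smul_sum]
    simp only [map_smul, smul_smul, pow_succ']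
  · rw [Finsupp.add_apply, Finsupp.mapDomain_of_notMem_range _ _ (by simp), add_zero,
      Finsupp.mapRange_apply]
  · rw [Finsupp.add_apply, Finsupp.mapRange_apply]
    exact congrArg _ (Finsupp.mapDomain_apply Nat.succ_injective _ 0)

theorem quadratic (a b d : V) : HasExpansion (fun τ => a + τ • b + τ ^ 2 • d) a b := by
  refine ⟨Finsupp.single 0 a + Finsupp.single 1 b + Finsupp.single 2 d, fun τ => ?_, ?_, ?_⟩
  · rw [Finsupp.sum_add_index' (fun _ => smul_zero _) fun _ _ _ => smul_add _ _ _,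
      Finsupp.sum_add_index' (fun _ => smul_zero _) fun _ _ _ => smul_add _ _ _]
    simp
  · simp
  · simp

end HasExpansion

namespace SpinorGauge

variable {L : Type*} [LieRing L] [LieAlgebra ℂ L] (G : SpinorGauge L)

/-! ### Lower order terms only depend on the symmetrized derivatives of the curvature -/

/-- `polQ` is the linear coefficient of the derivatives along `ξ + τ η`. -/
theorem hasExpansion_polQ (ξ η ζ : Spinor) (n : ℕ) :
    HasExpansion (fun τ : ℂ => ((G.nab (ξ + τ • η) ζ) ^ n) (G.Φ (ξ + τ • η) (ξ + τ • η)))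
      (((G.nab ξ ζ) ^ n) (G.Φ ξ ξ)) (G.polQ ξ η ζ n) := by
  induction n with
  | zero =>
    convert HasExpansion.quadratic (G.Φ ξ ξ) ((2 : ℂ) • G.Φ η ξ) (G.Φ η η) using 1
    · funext τ
      simp only [map_add, map_smul, LinearMap.add_apply, LinearMap.smul_apply, pow_zero,
        Module.End.one_apply, G.Φ_symm ξ η]
      module
    · rfl
    · rfl
  | succ n ih =>
    have hn (τ : ℂ) : G.nab (ξ + τ • η) ζ = G.nab ξ ζ + τ • G.nab η ζ := by simp
    have := ih.map (G.nab ξ ζ) (G.nab η ζ)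
    simp only [← hn] at this
    simpa only [pow_succ_der, polQ] using this

/-- `polV` is the linear coefficient of the derivatives along `ζ + τ θ`. -/
theorem hasExpansion_polV (ξ ζ θ : Spinor) (n : ℕ) :
    HasExpansion (fun τ : ℂ => ((G.nab ξ (ζ + τ • θ)) ^ n) (G.Φ ξ ξ))
      (((G.nab ξ ζ) ^ n) (G.Φ ξ ξ)) (G.polV ξ ζ θ n) := by
  induction n with
  | zero => simpa [polV] using HasExpansion.quadratic (G.Φ ξ ξ) 0 0
  | succ n ih =>
    have hn (τ : ℂ) : G.nab ξ (ζ + τ • θ) = G.nab ξ ζ + τ • G.nab ξ θ := by simp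
    have := ih.map (G.nab ξ ζ) (G.nab ξ θ)
    simp only [← hn] at this
    simpa only [pow_succ_der, polV] using this

/-- `polU` is the linear coefficient of `polQ` along `ζ + τ θ`. -/
theorem hasExpansion_polU (ξ η ζ θ : Spinor) (n : ℕ) :
    HasExpansion (fun τ : ℂ => G.polQ ξ η (ζ + τ • θ) n)
      (G.polQ ξ η ζ n) (G.polU ξ η ζ θ n) := by
  induction n with
  | zero => simpa [polU, polQ] using HasExpansion.quadratic ((2 : ℂ) • G.Φ η ξ) 0 0
  | succ n ih =>
    have h := (ih.map (G.nab ξ ζ) (G.nab ξ θ)).add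
      ((G.hasExpansion_polV ξ ζ θ n).map (G.nab η ζ) (G.nab η θ))
    have e : G.polU ξ η ζ θ (n + 1) = G.nab ξ ζ (G.polU ξ η ζ θ n) + G.nab ξ θ (G.polQ ξ η ζ n) +
        (G.nab η ζ (G.polV ξ ζ θ n) + G.nab η θ (((G.nab ξ ζ) ^ n) (G.Φ ξ ξ))) := by
      rw [polU]
      abel
    simp only [polQ, map_add, map_smul, LinearMap.add_apply, LinearMap.smul_apply] at h e ⊢
    rw [e]
    exact h

/-- The Lie algebra generated by the symmetrized derivatives of the curvature of order less than
`m`. -/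
def symAlg (m : ℕ) : LieSubalgebra ℂ L :=
  LieSubalgebra.lieSpan ℂ L {x | ∃ q < m, ∃ u v,
    x = ((G.nab u v) ^ q) (G.Φ u u) ∨ x = ((G.nab u v) ^ q) (G.Φb v v)}

/-- The elements of `symAlg m`, modulo the field equations. -/
def symLow (m : ℕ) : Submodule ℂ L := (G.symAlg m).toSubmodule ⊔ (G.J (m + 2)).toSubmodule

variable {G}

theorem symAlg_mono : Monotone G.symAlg := by
  intro m n h
  refine LieSubalgebra.lieSpan_mono ?_
  rintro x ⟨q, hq, u, v, hx⟩
  exact ⟨q, hq.trans_le h, u, v, hx⟩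

theorem symLow_mono : Monotone G.symLow := fun _ _ h =>
  sup_le_sup (symAlg_mono h) (G.J_mono (by omega))

theorem symLow_eqn {m : ℕ} {x : L} (hx : x ∈ G.J (m + 2)) : x ∈ G.symLow m :=
  Submodule.mem_sup_right hx

theorem symLow_alg {m : ℕ} {x : L} (hx : x ∈ G.symAlg m) : x ∈ G.symLow m :=
  Submodule.mem_sup_left hx

theorem symLow_lie {m : ℕ} {x y : L} (hx : x ∈ G.symLow m) (hy : y ∈ G.symLow m) :
    ⁅x, y⁆ ∈ G.symLow m := by
  obtain ⟨a, ha, j, hj, rfl⟩ := Submodule.mem_sup.1 hx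
  obtain ⟨b, hb, l, hl, rfl⟩ := Submodule.mem_sup.1 hy
  rw [add_lie, lie_add, ← lie_skew j]
  exact add_mem (add_mem (symLow_alg (LieSubalgebra.lie_mem _ ha hb))
    (symLow_eqn (LieSubmodule.lie_mem _ hl))) (neg_mem (symLow_eqn (LieSubmodule.lie_mem _ hj)))

theorem symAlg_pow_curv {m q : ℕ} (h : q < m) (u v : Spinor) :
    ((G.nab u v) ^ q) (G.Φ u u) ∈ G.symAlg m :=
  LieSubalgebra.subset_lieSpan ⟨q, h, u, v, .inl rfl⟩

theorem symAlg_polQ {m q : ℕ} (h : q < m) (ξ η ζ : Spinor) : G.polQ ξ η ζ q ∈ G.symAlg m :=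
  (G.hasExpansion_polQ ξ η ζ q).mem (G.symAlg m).toSubmodule fun _ => symAlg_pow_curv h _ _

theorem symAlg_polU {m q : ℕ} (h : q < m) (ξ η ζ θ : Spinor) : G.polU ξ η ζ θ q ∈ G.symAlg m :=
  (G.hasExpansion_polU ξ η ζ θ q).mem (G.symAlg m).toSubmodule fun _ => symAlg_polQ h _ _ _

theorem symAlg_dual (m : ℕ) : G.dual.symAlg m = G.symAlg m := by
  refine congrArg (LieSubalgebra.lieSpan ℂ L) (Set.ext fun x => ?_)
  constructor
  · rintro ⟨q, hq, u, v, h⟩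
    exact ⟨q, hq, v, u, h.symm⟩
  · rintro ⟨q, hq, u, v, h⟩
    exact ⟨q, hq, v, u, h.symm⟩

theorem symLow_dual (m : ℕ) : G.dual.symLow m = G.symLow m := by
  unfold symLow
  rw [symAlg_dual]
  rfl

theorem low_polQ (ξ η ζ : Spinor) (n : ℕ) : G.polQ ξ η ζ n ∈ G.Low (n + 1) := by
  induction n with
  | zero => exact Submodule.smul_mem _ _ (low_curv η ξ)
  | succ n ih => exact add_mem (low_nab _ _ ih) (low_nab _ _ (low_pow_curv n.lt_succ_self _ _ _ _))

theorem low_polV (ξ ζ θ : Spinor) (n : ℕ) : G.polV ξ ζ θ n ∈ G.Low (n + 1) := by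
  induction n with
  | zero => exact zero_mem _
  | succ n ih => exact add_mem (low_nab _ _ ih) (low_nab _ _ (low_pow_curv n.lt_succ_self _ _ _ _))

/-- An arbitrary derivative of a symmetrized derivative of the curvature is a symmetrized
derivative, up to lower order. -/
theorem nab_pow_curv_sub_mem (ξ η ζ θ : Spinor) (q : ℕ) :
    ∃ r : ℂ, G.nab η θ (((G.nab ξ ζ) ^ q) (G.Φ ξ ξ)) - r • G.polU ξ η ζ θ (q + 1) ∈
      G.Low (q + 1) := by
  rcases q with _ | n
  · refine ⟨3⁻¹, ?_⟩
    have h := low_eqn (m := 1) (G.field_eq ξ η θ ξ) (by norm_num)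
    convert Submodule.smul_mem _ (2 / 3 : ℂ) h using 1
    rw [polU_one, pow_zero, Module.End.one_apply]
    module
  · refine ⟨((((n : ℂ) + 1) + 1) * (((n : ℂ) + 1) + 3))⁻¹, ?_⟩
    have h := G.low_mono (show n ≤ n + 1 + 1 by omega)
      (G.mkQ_eq.1 (G.mkQ_nab_pow_curv ξ η ζ θ n rfl rfl))
    have a₀ := low_curv (G := G) (m := n + 1) ξ ξ
    have a₁ := low_curv (G := G) (m := n + 1) η ξ
    have b₀ := low_curvBar (G := G) (m := n + 1) ζ ζ
    have b₁ := low_curvBar (G := G) (m := n + 1) θ ζ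
    have hp := low_pow_curv (G := G) (show n < n + 1 + 1 by omega) ξ ζ ξ ξ
    have hQ := G.low_mono (Nat.le_succ _) (low_polQ (G := G) ξ η ζ n)
    have hV := G.low_mono (Nat.le_succ _) (low_polV (G := G) ξ ζ θ n)
    have hQ' := G.low_mono (Nat.le_succ _) (low_dual (low_polQ (G := G.dual) ζ θ ξ n))
    have sm {x : L} (r : ℂ) (hx : x ∈ G.Low (n + 1 + 1)) : r • x ∈ G.Low (n + 1 + 1) :=
      Submodule.smul_mem _ r hx
    have h1 := sm ((((n : ℂ) + 1) ^ 2 + ((n : ℂ) + 1) - 2) / (2 * (((n : ℂ) + 1) + 1)))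
      (sm (-spinPair ζ θ / (((n : ℂ) + 1) + 3))
        (add_mem (sm 2 (low_lie a₁ hp)) (low_lie a₀ hQ)))
    have h2 := sm (3 * (1 - if n = 0 then 1 else 0) / (((n : ℂ) + 1) + 3))
      (sm (-spinPair ξ η / (((n : ℂ) + 1) + 1)) (low_lie a₀ hQ'))
    have h3 := sm (((n : ℂ) + 1) * (((n : ℂ) + 1) + 5) / (2 * (((n : ℂ) + 1) + 3)))
      (sm (-spinPair ξ η / (((n : ℂ) + 1) + 1)) (add_mem (sm 2 (low_lie b₁ hp)) (low_lie b₀ hV)))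
    have h4 := sm ((((n : ℂ) + 1) + 1) * (((n : ℂ) + 1) + 2) / (((n : ℂ) + 1) + 3) -
      3 / 4 * if n = 0 then 1 else 0) (sm (spinPair ζ θ)
        (sub_mem (sm ((n + 2 : ℂ)⁻¹) (low_lie a₀ hQ)) (low_lie a₁ hp)))
    have h5 := sm (((n : ℂ) + 1) * (((n : ℂ) + 1) - 1) / (((n : ℂ) + 1) + 1))
      (sm (spinPair ξ η) (sub_mem (sm ((n : ℂ)⁻¹) (low_lie b₀ hV)) (low_lie b₁ hp)))
    have := add_mem h (add_mem (add_mem (add_mem (sub_mem h1 h2) h3) h4) h5)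
    convert this using 1
    simp only [brUnprimed, brPrimed]
    abel

theorem symLow_nab_curv {m q : ℕ} (h : G.Low m ≤ G.symLow m) (hq : q < m) (ξ η ζ θ : Spinor) :
    G.nab η θ (((G.nab ξ ζ) ^ q) (G.Φ ξ ξ)) ∈ G.symLow (m + 1) := by
  obtain ⟨r, hr⟩ := nab_pow_curv_sub_mem (G := G) ξ η ζ θ q
  have h1 := symLow_mono m.le_succ (h (G.low_mono (show q + 1 ≤ m from hq) hr))
  have h2 := Submodule.smul_mem _ r
    (symLow_alg (symAlg_polU (G := G) (show q + 1 < m + 1 by omega) ξ η ζ θ))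
  have := add_mem h1 h2
  rwa [sub_add_cancel] at this

/-- The derivative of a symmetrized derivative is a symmetrized derivative up to terms in `Low m`,
and these are covered by the hypothesis. -/
theorem symLow_nab {m : ℕ} (h : G.Low m ≤ G.symLow m) (u v : Spinor) {x : L}
    (hx : x ∈ G.symLow m) : G.nab u v x ∈ G.symLow (m + 1) := by
  obtain ⟨a, ha, j, hj, rfl⟩ := Submodule.mem_sup.1 hx
  rw [map_add]
  refine add_mem ?_ (symLow_eqn (G.J_nab _ u v j hj))
  clear hx
  change a ∈ LieSubalgebra.lieSpan ℂ L _ at ha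
  induction ha using LieSubalgebra.lieSpan_induction with
  | mem x hx =>
    obtain ⟨q, hq, a, b, rfl | rfl⟩ := hx
    · exact symLow_nab_curv h hq a u b v
    · have hd : G.dual.Low m ≤ G.dual.symLow m := fun y hy => by
        rw [symLow_dual]
        exact h (low_dual hy)
      have := symLow_nab_curv hd hq b v a u
      rw [symLow_dual] at this
      exact this
  | zero =>
    rw [map_zero]
    exact zero_mem _
  | add x y _ _ hx hy =>
    rw [map_add]
    exact add_mem hx hy
  | smul r x _ hx =>
    rw [map_smul]
    exact Submodule.smul_mem _ r hx
  | lie x y hx' hy' hx hy =>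
    rw [G.nab_lie]
    exact add_mem (symLow_lie hx (symLow_mono m.le_succ (symLow_alg hy')))
      (symLow_lie (symLow_mono m.le_succ (symLow_alg hx')) hy)

/-- Every expression of lower order is an expression in symmetrized derivatives only, modulo the
field equations. -/
theorem low_le_symLow (m : ℕ) : G.Low m ≤ G.symLow m := by
  induction m using Nat.strong_induction_on with
  | _ m ih =>
    have key : ∀ k x, G.IsLow k x → k ≤ m → x ∈ G.symLow k := by
      intro k x hx
      induction hx with
      | curv u w =>
        intro _
        have := Submodule.smul_mem _ (2⁻¹ : ℂ)
          (symLow_alg (symAlg_polQ (G := G) (Nat.zero_lt_one) w u 0))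
        simpa [polQ] using this
      | curvBar v w =>
        intro _
        have := Submodule.smul_mem _ (2⁻¹ : ℂ)
          (symLow_alg (symAlg_polQ (G := G.dual) (Nat.zero_lt_one) w v 0))
        rw [symLow_dual] at this
        simpa [polQ, dual] using this
      | eqn h => exact fun _ => symLow_eqn h
      | @nab k x u v _ hx => exact fun hk => symLow_nab (ih k (by omega)) u v (hx (by omega))
      | mono _ hx => exact fun hk => symLow_mono (Nat.le_succ _) (hx (by omega))
      | add _ _ hx hy => exact fun hk => add_mem (hx hk) (hy hk)
      | smul r _ hx => exact fun hk => Submodule.smul_mem _ r (hx hk)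
      | lie _ _ hx hy => exact fun hk => symLow_lie (hx hk) (hy hk)
    exact fun x hx => key m x hx le_rfl

end SpinorGauge

/-! ### From covariant derivatives to spinorial covariant derivatives -/

section SpinorOps

variable {L : Type*} [LieRing L] [LieAlgebra ℂ L] (c : ℝ) (cv : Fin 4 → L →ₗ[ℂ] L)
  (F : Fin 4 → Fin 4 → L)

/-- `∇_{AA'} = σ^i_{AA'} ∇_i`. -/
def spNab (A A' : Fin 2) : L →ₗ[ℂ] L := ∑ i, sigma c i A A' • cv i

/-- `σ^i_{AA'} σ^j_{BB'} F_{ij}`. -/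
def spF (A A' B B' : Fin 2) : L := ∑ i, ∑ j, (sigma c i A A' * sigma c j B B') • F i j

/-- `Φ_{AB} = ½ ε^{A'B'} F_{AA'BB'}`. -/
def spΦ (A B : Fin 2) : L := (1 / 2 : ℂ) • ∑ A', ∑ B', eps A' B' • spF c F A A' B B'

/-- `Φ̄_{A'B'} = ½ ε^{AB} F_{AA'BB'}`. -/
def spΦb (A' B' : Fin 2) : L := (1 / 2 : ℂ) • ∑ A, ∑ B, eps A B • spF c F A A' B B'

variable {F}

theorem spF_swap (hF : ∀ i j, F j i = -F i j) (A A' B B' : Fin 2) :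
    spF c F B B' A A' = -spF c F A A' B B' := by
  simp only [spF, ← Finset.sum_neg_distrib]
  rw [Finset.sum_comm]
  refine Finset.sum_congr rfl fun i _ => Finset.sum_congr rfl fun j _ => ?_
  rw [hF i j, mul_comm, smul_neg]

theorem spF_eq (hF : ∀ i j, F j i = -F i j) (A A' B B' : Fin 2) :
    spF c F A A' B B' = eps A' B' • spΦ c F A B + eps A B • spΦb c F A' B' := by
  have h := fun A A' B B' => spF_swap c hF A A' B B'
  have h0 (A A') : spF c F A A' A A' = 0 := by
    have := h A A' A A'
    rwa [eq_neg_iff_add_eq_zero, ← two_smul ℂ, smul_eq_zero_iff_right two_ne_zero] at this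
  simp only [spΦ, spΦb, Fin.sum_univ_two]
  fin_cases A <;> fin_cases A' <;> fin_cases B <;> fin_cases B' <;>
    simp [eps, h0, h 0 0 0 1, h 0 0 1 0, h 0 0 1 1, h 0 1 1 0, h 0 1 1 1, h 1 0 1 1] <;> module

theorem spNab_comm {cv : Fin 4 → L →ₗ[ℂ] L}
    (hcomm : ∀ i j x, cv i (cv j x) - cv j (cv i x) = ⁅F i j, x⁆) (A A' B B' : Fin 2) (x : L) :
    spNab c cv A A' (spNab c cv B B' x) - spNab c cv B B' (spNab c cv A A' x) =
      ⁅spF c F A A' B B', x⁆ := by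
  simp only [spNab, spF, LinearMap.sum_apply, LinearMap.smul_apply, map_sum, map_smul, sum_lie,
    smul_lie, ← hcomm, smul_sub, Finset.sum_sub_distrib, Finset.smul_sum, smul_smul]
  congr 1
  rw [Finset.sum_comm]
  simp only [mul_comm]

/-- The contraction of a matrix of vectors with two spinors. -/
def spBilin {V : Type*} [AddCommGroup V] [Module ℂ V] (M : Fin 2 → Fin 2 → V) :
    Spinor →ₗ[ℂ] Spinor →ₗ[ℂ] V :=
  ∑ A, ∑ B, (LinearMap.proj A : Spinor →ₗ[ℂ] ℂ).smulRight
    ((LinearMap.proj B : Spinor →ₗ[ℂ] ℂ).smulRight (M A B))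

theorem spBilin_apply {V : Type*} [AddCommGroup V] [Module ℂ V] (M : Fin 2 → Fin 2 → V)
    (u v : Spinor) : spBilin M u v = ∑ A, ∑ B, (u A * v B) • M A B := by
  simp [spBilin, mul_smul]

theorem spF_symm (hF : ∀ i j, F j i = -F i j) (A B : Fin 2) : spΦ c F A B = spΦ c F B A := by
  simp only [spΦ, Fin.sum_univ_two]
  rw [spF_swap c hF A 0 B 1, spF_swap c hF A 1 B 0]
  simp [eps]
  module

theorem spFb_symm (hF : ∀ i j, F j i = -F i j) (A B : Fin 2) : spΦb c F A B = spΦb c F B A := by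
  simp only [spΦb, Fin.sum_univ_two]
  rw [spF_swap c hF 0 A 1 B, spF_swap c hF 1 A 0 B]
  simp [eps]
  module

theorem spΦ_explicit (hF : ∀ i j, F j i = -F i j) :
    spΦ c F 0 0 = (c ^ 2 : ℂ) • (F 0 1 - Complex.I • F 0 2 - F 1 3 + Complex.I • F 2 3) ∧
    spΦ c F 0 1 = (c ^ 2 : ℂ) • (-F 0 3 - Complex.I • F 1 2) ∧
    spΦ c F 1 1 = (c ^ 2 : ℂ) • (-F 0 1 - Complex.I • F 0 2 - F 1 3 - Complex.I • F 2 3) := by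
  have h0 (i) : F i i = 0 := by
    have := hF i i
    rwa [eq_neg_iff_add_eq_zero, ← two_smul ℂ, smul_eq_zero_iff_right two_ne_zero] at this
  refine ⟨?_, ?_, ?_⟩ <;>
  · simp only [spΦ, spF, Fin.sum_univ_two, Fin.sum_univ_four, h0, hF 0 1, hF 0 2, hF 0 3, hF 1 2,
      hF 1 3, hF 2 3]
    simp [eps, sigma]
    match_scalars <;> ring_nf

theorem spΦb_explicit (hF : ∀ i j, F j i = -F i j) :
    spΦb c F 0 0 = (c ^ 2 : ℂ) • (F 0 1 + Complex.I • F 0 2 - F 1 3 - Complex.I • F 2 3) ∧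
    spΦb c F 0 1 = (c ^ 2 : ℂ) • (-F 0 3 + Complex.I • F 1 2) ∧
    spΦb c F 1 1 = (c ^ 2 : ℂ) • (-F 0 1 + Complex.I • F 0 2 - F 1 3 + Complex.I • F 2 3) := by
  have h0 (i) : F i i = 0 := by
    have := hF i i
    rwa [eq_neg_iff_add_eq_zero, ← two_smul ℂ, smul_eq_zero_iff_right two_ne_zero] at this
  refine ⟨?_, ?_, ?_⟩ <;>
  · simp only [spΦb, spF, Fin.sum_univ_two, Fin.sum_univ_four, h0, hF 0 1, hF 0 2, hF 0 3, hF 1 2,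
      hF 1 3, hF 2 3]
    simp [eps, sigma]
    match_scalars <;> ring_nf

theorem spNab_explicit (x : L) :
    spNab c cv 0 0 x = (c : ℂ) • (cv 0 x + cv 3 x) ∧
    spNab c cv 0 1 x = (c : ℂ) • (cv 1 x - Complex.I • cv 2 x) ∧
    spNab c cv 1 0 x = (c : ℂ) • (cv 1 x + Complex.I • cv 2 x) ∧
    spNab c cv 1 1 x = (c : ℂ) • (cv 0 x - cv 3 x) := by
  refine ⟨?_, ?_, ?_, ?_⟩ <;>
  · simp only [spNab, Fin.sum_univ_four, LinearMap.add_apply, LinearMap.smul_apply]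
    simp [sigma]
    try module

/-- `∇^j F_{ij}`. -/
def divF (cv : Fin 4 → L →ₗ[ℂ] L) (F : Fin 4 → Fin 4 → L) (i : Fin 4) : L :=
  ∑ j, (eta j : ℂ) • cv j (F i j)

theorem divF_explicit (hF : ∀ i j, F j i = -F i j) :
    divF cv F 0 = cv 1 (F 0 1) + cv 2 (F 0 2) + cv 3 (F 0 3) ∧
    divF cv F 1 = cv 0 (F 0 1) + cv 2 (F 1 2) + cv 3 (F 1 3) ∧
    divF cv F 2 = cv 0 (F 0 2) - cv 1 (F 1 2) + cv 3 (F 2 3) ∧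
    divF cv F 3 = cv 0 (F 0 3) - cv 1 (F 1 3) - cv 2 (F 2 3) := by
  have h0 (i) : F i i = 0 := by
    have := hF i i
    rwa [eq_neg_iff_add_eq_zero, ← two_smul ℂ, smul_eq_zero_iff_right two_ne_zero] at this
  refine ⟨?_, ?_, ?_, ?_⟩ <;>
  · simp only [divF, Fin.sum_univ_four, h0, hF 0 1, hF 0 2, hF 0 3, hF 1 2, hF 1 3, hF 2 3]
    simp [eta]
    try abel

set_option linter.unusedSimpArgs false in
/-- The Bianchi identities and the field equations give `∇^A_{A'} Φ_{AB} = 0`. -/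
theorem spΦ_field_eq (hF : ∀ i j, F j i = -F i j)
    (hB : ∀ i j k, cv i (F j k) + cv j (F k i) + cv k (F i j) = 0)
    (J : Submodule ℂ L) (hJ : ∀ i, divF cv F i ∈ J) (A' B : Fin 2) :
    spNab c cv 0 A' (spΦ c F 1 B) - spNab c cv 1 A' (spΦ c F 0 B) ∈ J := by
  obtain ⟨f0, f1, f2⟩ := spΦ_explicit c hF
  obtain ⟨d0, d1, d2, d3⟩ := divF_explicit cv hF
  have f1' := f1
  rw [spF_symm c hF] at f1'
  have b0 := hB 0 1 2
  have b1 := hB 0 1 3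
  have b2 := hB 0 2 3
  have b3 := hB 1 2 3
  rw [hF 0 2, map_neg] at b0
  rw [hF 0 3, map_neg] at b1 b2
  rw [hF 1 3, map_neg] at b3
  obtain ⟨x, hx, h⟩ : ∃ x ∈ J, spNab c cv 0 A' (spΦ c F 1 B) - spNab c cv 1 A' (spΦ c F 0 B) =
      (c ^ 3 : ℂ) • x := by
    fin_cases A' <;> fin_cases B
    · refine ⟨-divF cv F 0 - divF cv F 3, sub_mem (neg_mem (hJ 0)) (hJ 3), ?_⟩
      simp only [Fin.mk_zero, Fin.mk_one, Fin.zero_eta, Fin.isValue, f0, f1, f1', f2, d0, d3,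
        (spNab_explicit c cv _).1, (spNab_explicit c cv _).2.2.1, map_add, map_sub, map_neg,
        map_smul]
      linear_combination (norm := skip) -((c ^ 3 : ℂ) * Complex.I) • b0 -
        ((c ^ 3 : ℂ) * Complex.I) • b3
      match_scalars <;> ring_nf <;> simp [Complex.I_sq]
    · refine ⟨-divF cv F 1 - Complex.I • divF cv F 2,
        sub_mem (neg_mem (hJ 1)) (J.smul_mem _ (hJ 2)), ?_⟩
      simp only [Fin.mk_zero, Fin.mk_one, Fin.zero_eta, Fin.isValue, f0, f1, f1', f2, d1, d2,
        (spNab_explicit c cv _).1, (spNab_explicit c cv _).2.2.1, map_add, map_sub, map_neg,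
        map_smul]
      linear_combination (norm := skip) -(c ^ 3 : ℂ) • b1 - ((c ^ 3 : ℂ) * Complex.I) • b2
      match_scalars <;> ring_nf <;> simp [Complex.I_sq]
    · refine ⟨-divF cv F 1 + Complex.I • divF cv F 2,
        add_mem (neg_mem (hJ 1)) (J.smul_mem _ (hJ 2)), ?_⟩
      simp only [Fin.mk_zero, Fin.mk_one, Fin.zero_eta, Fin.isValue, f0, f1, f1', f2, d1, d2,
        (spNab_explicit c cv _).2.1, (spNab_explicit c cv _).2.2.2, map_add, map_sub, map_neg,
        map_smul]
      linear_combination (norm := skip) (c ^ 3 : ℂ) • b1 - ((c ^ 3 : ℂ) * Complex.I) • b2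
      match_scalars <;> ring_nf <;> simp [Complex.I_sq]
    · refine ⟨-divF cv F 0 + divF cv F 3, add_mem (neg_mem (hJ 0)) (hJ 3), ?_⟩
      simp only [Fin.mk_zero, Fin.mk_one, Fin.zero_eta, Fin.isValue, f0, f1, f1', f2, d0, d3,
        (spNab_explicit c cv _).2.1, (spNab_explicit c cv _).2.2.2, map_add, map_sub, map_neg,
        map_smul]
      linear_combination (norm := skip) ((c ^ 3 : ℂ) * Complex.I) • b0 -
        ((c ^ 3 : ℂ) * Complex.I) • b3
      match_scalars <;> ring_nf <;> simp [Complex.I_sq]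
  rw [h]
  exact J.smul_mem _ hx

set_option linter.unusedSimpArgs false in
/-- The Bianchi identities and the field equations give `∇^{A'}_A Φ̄_{A'B'} = 0`. -/
theorem spΦb_field_eq (hF : ∀ i j, F j i = -F i j)
    (hB : ∀ i j k, cv i (F j k) + cv j (F k i) + cv k (F i j) = 0)
    (J : Submodule ℂ L) (hJ : ∀ i, divF cv F i ∈ J) (A B' : Fin 2) :
    spNab c cv A 0 (spΦb c F 1 B') - spNab c cv A 1 (spΦb c F 0 B') ∈ J := by
  obtain ⟨f0, f1, f2⟩ := spΦb_explicit c hF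
  obtain ⟨d0, d1, d2, d3⟩ := divF_explicit cv hF
  have f1' := f1
  rw [spFb_symm c hF] at f1'
  have b0 := hB 0 1 2
  have b1 := hB 0 1 3
  have b2 := hB 0 2 3
  have b3 := hB 1 2 3
  rw [hF 0 2, map_neg] at b0
  rw [hF 0 3, map_neg] at b1 b2
  rw [hF 1 3, map_neg] at b3
  obtain ⟨x, hx, h⟩ : ∃ x ∈ J, spNab c cv A 0 (spΦb c F 1 B') - spNab c cv A 1 (spΦb c F 0 B') =
      (c ^ 3 : ℂ) • x := by
    fin_cases A <;> fin_cases B'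
    · refine ⟨-divF cv F 0 - divF cv F 3, sub_mem (neg_mem (hJ 0)) (hJ 3), ?_⟩
      simp only [Fin.mk_zero, Fin.mk_one, Fin.zero_eta, Fin.isValue, f0, f1, f1', f2, d0, d3,
        (spNab_explicit c cv _).1, (spNab_explicit c cv _).2.1, map_add, map_sub, map_neg,
        map_smul]
      linear_combination (norm := skip) ((c ^ 3 : ℂ) * Complex.I) • b0 +
        ((c ^ 3 : ℂ) * Complex.I) • b3
      match_scalars <;> ring_nf <;> simp [Complex.I_sq]
    · refine ⟨-divF cv F 1 + Complex.I • divF cv F 2,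
        add_mem (neg_mem (hJ 1)) (J.smul_mem _ (hJ 2)), ?_⟩
      simp only [Fin.mk_zero, Fin.mk_one, Fin.zero_eta, Fin.isValue, f0, f1, f1', f2, d1, d2,
        (spNab_explicit c cv _).1, (spNab_explicit c cv _).2.1, map_add, map_sub, map_neg,
        map_smul]
      linear_combination (norm := skip) -(c ^ 3 : ℂ) • b1 + ((c ^ 3 : ℂ) * Complex.I) • b2
      match_scalars <;> ring_nf <;> simp [Complex.I_sq]
    · refine ⟨-divF cv F 1 - Complex.I • divF cv F 2,
        sub_mem (neg_mem (hJ 1)) (J.smul_mem _ (hJ 2)), ?_⟩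
      simp only [Fin.mk_zero, Fin.mk_one, Fin.zero_eta, Fin.isValue, f0, f1, f1', f2, d1, d2,
        (spNab_explicit c cv _).2.2.1, (spNab_explicit c cv _).2.2.2, map_add, map_sub, map_neg,
        map_smul]
      linear_combination (norm := skip) (c ^ 3 : ℂ) • b1 + ((c ^ 3 : ℂ) * Complex.I) • b2
      match_scalars <;> ring_nf <;> simp [Complex.I_sq]
    · refine ⟨-divF cv F 0 + divF cv F 3, add_mem (neg_mem (hJ 0)) (hJ 3), ?_⟩
      simp only [Fin.mk_zero, Fin.mk_one, Fin.zero_eta, Fin.isValue, f0, f1, f1', f2, d0, d3,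
        (spNab_explicit c cv _).2.2.1, (spNab_explicit c cv _).2.2.2, map_add, map_sub, map_neg,
        map_smul]
      linear_combination (norm := skip) -((c ^ 3 : ℂ) * Complex.I) • b0 +
        ((c ^ 3 : ℂ) * Complex.I) • b3
      match_scalars <;> ring_nf <;> simp [Complex.I_sq]
  rw [h]
  exact J.smul_mem _ hx

/-- The spinor form of the Yang-Mills equations, from covariant derivatives `cv i` with
curvature `F i j` acting on a complex Lie algebra, and ideals `J n` containing the field equations
and their derivatives. -/
def SpinorGauge.ofCov (c : ℝ) (cv : Fin 4 → L →ₗ[ℂ] L) (F : Fin 4 → Fin 4 → L)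
    (J : ℕ → LieIdeal ℂ L) (hF : ∀ i j, F j i = -F i j)
    (hlie : ∀ i x y, cv i ⁅x, y⁆ = ⁅cv i x, y⁆ + ⁅x, cv i y⁆)
    (hcomm : ∀ i j x, cv i (cv j x) - cv j (cv i x) = ⁅F i j, x⁆)
    (hB : ∀ i j k, cv i (F j k) + cv j (F k i) + cv k (F i j) = 0)
    (hJmono : Monotone J) (hJcv : ∀ n i x, x ∈ J n → cv i x ∈ J (n + 1))
    (hJ : ∀ i, divF cv F i ∈ J 1) : SpinorGauge L where
  nab := spBilin (spNab c cv)
  Φ := spBilin (spΦ c F)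
  Φb := spBilin (spΦb c F)
  J := J
  nab_lie u v x y := by
    have h (A A') : spNab c cv A A' ⁅x, y⁆ = ⁅spNab c cv A A' x, y⁆ + ⁅x, spNab c cv A A' y⁆ := by
      simp only [spNab, LinearMap.sum_apply, LinearMap.smul_apply, hlie, smul_add,
        Finset.sum_add_distrib, sum_lie, lie_sum, smul_lie, lie_smul]
    simp only [spBilin_apply, LinearMap.sum_apply, LinearMap.smul_apply, h, smul_add,
      Finset.sum_add_distrib, sum_lie, lie_sum, smul_lie, lie_smul]
  nab_comm u v u' v' x := by
    have h1 : ∑ A, ∑ A', ∑ B, ∑ B', (u A * v A' * u' B * v' B') •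
        (spNab c cv A A' (spNab c cv B B' x) - spNab c cv B B' (spNab c cv A A' x)) =
        ∑ A, ∑ A', ∑ B, ∑ B', (u A * v A' * u' B * v' B') • ⁅spF c F A A' B B', x⁆ := by
      simp only [spNab_comm c hcomm]
    simp only [spF_eq c hF, add_lie, smul_lie, Fin.sum_univ_two] at h1
    simp only [spBilin_apply, LinearMap.add_apply, LinearMap.smul_apply, map_add, map_smul,
      Fin.sum_univ_two, spinPair, add_lie, smul_lie]
    simp only [eps, Matrix.of_apply, Matrix.cons_val', Matrix.cons_val_zero, Matrix.cons_val_one,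
      Matrix.cons_val_fin_one] at h1
    linear_combination (norm := module) h1
  Φ_symm u w := by
    simp only [spBilin_apply, Fin.sum_univ_two, spF_symm c hF 1 0]
    module
  Φb_symm u w := by
    simp only [spBilin_apply, Fin.sum_univ_two, spFb_symm c hF 1 0]
    module
  J_mono := hJmono
  J_nab n u v x hx := by
    simp only [spBilin_apply, LinearMap.sum_apply, LinearMap.smul_apply, spNab]
    refine sum_mem fun A _ => sum_mem fun A' _ => SMulMemClass.smul_mem _ (sum_mem fun i _ => ?_)
    exact SMulMemClass.smul_mem _ (hJcv n i x hx)
  field_eq u u' v w := by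
    have h (A' B) := spΦ_field_eq c cv hF hB (J 1).toSubmodule hJ A' B
    have h1 := sum_mem fun (A' : Fin 2) (_ : A' ∈ Finset.univ) => sum_mem
      fun (B : Fin 2) (_ : B ∈ Finset.univ) =>
        (J 1).toSubmodule.smul_mem (spinPair u' u * v A' * w B) (h A' B)
    change _ ∈ (J 1).toSubmodule
    convert h1 using 1
    simp only [spBilin_apply, LinearMap.add_apply, LinearMap.smul_apply, map_add, map_smul,
      Fin.sum_univ_two, spinPair]
    module
  field_eq_bar u v v' w := by
    have h (A B') := spΦb_field_eq c cv hF hB (J 1).toSubmodule hJ A B'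
    have h1 := sum_mem fun (A : Fin 2) (_ : A ∈ Finset.univ) => sum_mem
      fun (B' : Fin 2) (_ : B' ∈ Finset.univ) =>
        (J 1).toSubmodule.smul_mem (spinPair v' v * u A * w B') (h A B')
    change _ ∈ (J 1).toSubmodule
    convert h1 using 1
    simp only [spBilin_apply, LinearMap.add_apply, LinearMap.smul_apply, map_add, map_smul,
      Fin.sum_univ_two, spinPair]
    module

end SpinorOps

/-! ### The Lie algebra of polynomial fields -/

section PolyFields

variable {ι : Type*} [Fintype ι] {𝔤 : Type*} [LieRing 𝔤] [LieAlgebra ℝ 𝔤]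
  (e : Module.Basis ι ℝ 𝔤)

open TensorProduct in
/-- The bracket on components is the bracket of `ℂ ⊗ 𝔤`. -/
theorem br_eq_equivFun (X Y : ι → ℂ) :
    br e X Y = (Algebra.TensorProduct.basis ℂ e).equivFun
      ⁅(Algebra.TensorProduct.basis ℂ e).equivFun.symm X,
        (Algebra.TensorProduct.basis ℂ e).equivFun.symm Y⁆ := by
  funext α
  simp only [Module.Basis.equivFun_symm_apply, sum_lie,
    lie_sum, smul_lie, lie_smul, Algebra.TensorProduct.basis_apply, map_sum, map_smul,
    LieAlgebra.ExtendScalars.bracket_tmul, Finset.sum_apply, Pi.smul_apply,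
    Module.Basis.equivFun_apply, Algebra.TensorProduct.basis_repr_tmul, br, structConst]
  refine Finset.sum_comm.trans (Finset.sum_congr rfl fun γ _ => ?_)
  rw [Finset.smul_sum]
  refine Finset.sum_congr rfl fun β _ => ?_
  simp
  ring

theorem br_add_left (X Y Z : ι → ℂ) : br e (X + Y) Z = br e X Z + br e Y Z := by
  simp only [br_eq_equivFun, map_add, add_lie]

theorem br_self (X : ι → ℂ) : br e X X = 0 := by
  rw [br_eq_equivFun, lie_self, map_zero]

theorem br_leibniz (X Y Z : ι → ℂ) :
    br e X (br e Y Z) = br e (br e X Y) Z + br e Y (br e X Z) := by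
  simp only [br_eq_equivFun, LinearEquiv.symm_apply_apply]
  rw [leibniz_lie, map_add]

/-- The polynomial functions on `J^∞(A)` with values in the complexification of `𝔤`. They form a
Lie algebra under the pointwise bracket `br e`. -/
def PolyField (_e : Module.Basis ι ℝ 𝔤) : Type _ := jetPolyVec ι ℂ ⊤

variable {e}

namespace PolyField

instance : AddCommGroup (PolyField e) := inferInstanceAs (AddCommGroup (jetPolyVec ι ℂ ⊤))

instance : Module ℂ (PolyField e) := inferInstanceAs (Module ℂ (jetPolyVec ι ℂ ⊤))

/-- The function underlying a polynomial field. -/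
def toFun : PolyField e →ₗ[ℂ] (Jet ι → ι → ℂ) := (jetPolyVec ι ℂ ⊤).subtype

theorem toFun_injective : Function.Injective (toFun (e := e)) := Subtype.val_injective

instance : Bracket (PolyField e) (PolyField e) :=
  ⟨fun x y => ⟨fun z => br e (toFun x z) (toFun y z), br_mem e x.2 y.2⟩⟩

theorem toFun_lie (x y : PolyField e) (z : Jet ι) :
    toFun ⁅x, y⁆ z = br e (toFun x z) (toFun y z) := rfl

instance : LieRing (PolyField e) where
  add_lie x y w := toFun_injective <| funext fun z => by
    simp only [toFun_lie, map_add, Pi.add_apply, br_add_left]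
  lie_add x y w := toFun_injective <| funext fun z => by
    simp only [toFun_lie, map_add, Pi.add_apply, br_add_right]
  lie_self x := toFun_injective <| funext fun z => by
    simp only [toFun_lie, br_self, map_zero, Pi.zero_apply]
  leibniz_lie x y w := toFun_injective <| funext fun z => by
    simp only [toFun_lie, map_add, Pi.add_apply]
    exact br_leibniz e _ _ _

instance : LieAlgebra ℂ (PolyField e) where
  lie_smul r x y := toFun_injective <| funext fun z => by
    simp only [toFun_lie, map_smul, Pi.smul_apply, br_smul_right]

/-- The total derivative on polynomial fields. -/
def tD (i : Fin 4) : PolyField e →ₗ[ℂ] PolyField e where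
  toFun x := ⟨totalD i (toFun x), totalD_mem_vec x.2 i⟩
  map_add' x y := toFun_injective (totalD_add_vec x.2 y.2 i)
  map_smul' r x := toFun_injective (totalD_smul_vec x.2 r i)

theorem tD_lie (i : Fin 4) (x y : PolyField e) : tD i ⁅x, y⁆ = ⁅tD i x, y⁆ + ⁅x, tD i y⁆ :=
  toFun_injective <| funext fun z => totalD_br e x.2 y.2 i z

theorem tD_comm (i j : Fin 4) (x : PolyField e) : tD i (tD j x) = tD j (tD i x) :=
  toFun_injective (totalD_comm_vec x.2 i j)

/-- The jet variables as polynomial fields. -/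
def coord (i : Fin 4) (L : Multiset (Fin 4)) : PolyField e :=
  ⟨coordVec ℂ i L, coordVec_mem i L le_top⟩

/-- The covariant derivative on polynomial fields. -/
def cv (i : Fin 4) : PolyField e →ₗ[ℂ] PolyField e :=
  tD i + (LieAlgebra.ad ℂ (PolyField e) (coord i 0) : PolyField e →ₗ[ℂ] PolyField e)

theorem cv_apply (i : Fin 4) (x : PolyField e) :
    cv i x = tD i x + ⁅(coord i 0 : PolyField e), x⁆ := rfl

theorem toFun_cv (i : Fin 4) (x : PolyField e) : toFun (cv i x) = cov e i (toFun x) := rfl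

/-- The field tensor as a polynomial field. -/
def fld (i j : Fin 4) : PolyField e :=
  tD i (coord j 0) - tD j (coord i 0) + ⁅(coord i 0 : PolyField e), (coord j 0 : PolyField e)⁆

theorem fld_swap (i j : Fin 4) : (fld j i : PolyField e) = -fld i j := by
  rw [fld, fld, ← lie_skew (coord i 0 : PolyField e)]
  abel

theorem cv_lie (i : Fin 4) (x y : PolyField e) : cv i ⁅x, y⁆ = ⁅cv i x, y⁆ + ⁅x, cv i y⁆ := by
  simp only [cv_apply, tD_lie, add_lie, lie_add, leibniz_lie (coord i 0 : PolyField e) x y]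
  abel

theorem cv_comm (i j : Fin 4) (x : PolyField e) :
    cv i (cv j x) - cv j (cv i x) = ⁅(fld i j : PolyField e), x⁆ := by
  simp only [cv_apply, map_add, tD_lie, add_lie, sub_lie, fld, lie_lie, tD_comm j i]
  abel

theorem bianchi (i j k : Fin 4) :
    cv i (fld j k : PolyField e) + cv j (fld k i : PolyField e) + cv k (fld i j : PolyField e) =
      0 := by
  have h := leibniz_lie (coord i 0 : PolyField e) (coord j 0 : PolyField e)
    (coord k 0 : PolyField e)
  simp only [cv_apply, fld, map_add, map_sub, tD_lie, tD_comm j i, tD_comm k i,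
    tD_comm k j, h]
  rw [← lie_skew (tD i (coord j 0 : PolyField e)) (coord k 0),
    ← lie_skew (tD j (coord k 0 : PolyField e)) (coord i 0),
    ← lie_skew (tD k (coord i 0 : PolyField e)) (coord j 0),
    ← lie_skew (coord i 0 : PolyField e) (coord k 0), lie_neg,
    ← lie_skew ⁅(coord i 0 : PolyField e), coord j 0⁆ (coord k 0)]
  abel

variable (e) in
/-- The consequences of the derivatives of order less than `n` of the field equations. -/
def eqIdeal (n : ℕ) : LieIdeal ℂ (PolyField e) :=
  LieSubmodule.lieSpan ℂ (PolyField e) {x | ∃ (k : List (Fin 4)) (i : Fin 4), k.length < n ∧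
    x = k.foldr (fun i => cv i) (divF cv fld i)}

theorem eqIdeal_mono : Monotone (eqIdeal e) := by
  intro m n h
  refine LieSubmodule.lieSpan_mono ?_
  rintro x ⟨k, i, hk, hx⟩
  exact ⟨k, i, hk.trans_le h, hx⟩

theorem cv_mem_eqIdeal (n : ℕ) (i : Fin 4) (x : PolyField e) (hx : x ∈ eqIdeal e n) :
    cv i x ∈ eqIdeal e (n + 1) := by
  have hm : eqIdeal e n ≤ eqIdeal e (n + 1) := eqIdeal_mono n.le_succ
  change x ∈ LieSubmodule.lieSpan ℂ (PolyField e) _ at hx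
  induction hx using LieSubmodule.lieSpan_induction with
  | mem x hx =>
    obtain ⟨k, j, hk, rfl⟩ := hx
    exact LieSubmodule.subset_lieSpan ⟨i :: k, j, Nat.succ_lt_succ hk, rfl⟩
  | zero =>
    rw [map_zero]
    exact zero_mem _
  | add x y _ _ hx hy =>
    rw [map_add]
    exact add_mem hx hy
  | smul r x _ hx =>
    rw [map_smul]
    exact SMulMemClass.smul_mem r hx
  | lie x y hy' hy =>
    rw [cv_lie]
    exact add_mem (LieSubmodule.lie_mem _ (hm hy')) (LieSubmodule.lie_mem _ hy)

variable (e) in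
/-- The spinor form of the Yang-Mills equations on polynomial fields. -/
def gauge (c : ℝ) : SpinorGauge (PolyField e) :=
  SpinorGauge.ofCov c cv fld (eqIdeal e) (fun i j => fld_swap i j) cv_lie cv_comm bianchi
    eqIdeal_mono cv_mem_eqIdeal fun i => LieSubmodule.subset_lieSpan ⟨[], i, Nat.zero_lt_one, rfl⟩

/-! #### Comparison with real-valued differential functions -/

/-- The complexification of a real-valued function. -/
def toComplex (G : Jet ι → ι → ℝ) : Jet ι → ι → ℂ := fun z α => (G z α : ℂ)

theorem toComplex_mem {n : ℕ∞} {G : Jet ι → ι → ℝ} (hG : G ∈ jetPolyVec ι ℝ n) :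
    toComplex G ∈ jetPolyVec ι ℂ n := by
  intro α
  have h := hG α
  change (fun z => ((fun z => G z α) z : ℂ)) ∈ _
  generalize (fun z => G z α) = f at h
  induction h using Algebra.adjoin_induction with
  | mem f h =>
    obtain ⟨i, L, α, hL, rfl⟩ := h
    exact coord_mem_jetPoly i L α hL
  | algebraMap r => exact (jetPoly ι ℂ n).algebraMap_mem (r : ℂ)
  | add f g _ _ hf hg =>
    convert add_mem hf hg using 1
    funext z
    simp
  | mul f g _ _ hf hg =>
    convert mul_mem hf hg using 1
    funext z
    simp

theorem cov_toComplex {n : ℕ∞} {G : Jet ι → ι → ℝ} (hG : G ∈ jetPolyVec ι ℝ n) (i : Fin 4) :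
    cov e i (toComplex G) = toComplex (cov e i G) := by
  funext z α
  simp only [cov, toComplex, Pi.add_apply, Complex.ofReal_add]
  congr 1
  · have h1 := totalD_apply_of_mem (toComplex_mem hG) i z α
    rw [totalD_apply_of_mem hG i z α]
    refine h1.trans ?_
    have h2 := (jetPoly_lineDifferentiable (hG α) z (totalVec i z)).hasDerivAt
    exact h2.ofReal_comp.deriv
  · simp only [br, Complex.ofReal_sum, Complex.real_smul, Complex.ofReal_mul, smul_eq_mul]
    rfl

theorem toFun_fld (i j : Fin 4) : toFun (fld i j : PolyField e) = toComplex (field e i j) := by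
  have h (i j : Fin 4) : toFun (tD i (coord j 0) : PolyField e) = coordVec ℂ j {i} :=
    totalD_coordVec i j 0
  funext z α
  rw [fld, map_add, map_sub, h, h]
  simp only [Pi.add_apply, Pi.sub_apply, toFun_lie, toComplex, field, Complex.ofReal_add,
    Complex.ofReal_sub]
  congr 1
  simp only [br, Complex.ofReal_sum, Complex.real_smul, Complex.ofReal_mul, smul_eq_mul]
  rfl

theorem toFun_foldr_cv {x : PolyField e} {G : Jet ι → ι → ℝ} (h : toFun x = toComplex G)
    (hG : G ∈ jetPolyVec ι ℝ ⊤) (k : List (Fin 4)) :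
    toFun (k.foldr (fun i => cv i) x) = toComplex (k.foldr (cov e) G) ∧
      k.foldr (cov e) G ∈ jetPolyVec ι ℝ ⊤ := by
  induction k with
  | nil => exact ⟨h, hG⟩
  | cons a k ih =>
    exact ⟨by rw [List.foldr_cons, toFun_cv, ih.1, cov_toComplex ih.2, List.foldr_cons],
      cov_mem e ih.2 a⟩

theorem toFun_covs_fld (k : List (Fin 4)) (i j : Fin 4) :
    toFun (k.foldr (fun i => cv i) (fld i j) : PolyField e) =
      toComplex (k.foldr (cov e) (field e i j)) :=
  (toFun_foldr_cv (toFun_fld i j) (jetPolyVec_mono le_top (field_mem e i j)) k).1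

theorem toFun_covs_divF (k : List (Fin 4)) (i : Fin 4) :
    toFun (k.foldr (fun i => cv i) (divF cv fld i) : PolyField e) =
      toComplex (k.foldr (cov e) (divField e i)) := by
  have hm (j : Fin 4) : cov e j (field e i j) ∈ jetPolyVec ι ℝ ⊤ :=
    cov_mem e (jetPolyVec_mono le_top (field_mem e i j)) j
  refine (toFun_foldr_cv ?_ ?_ k).1
  · have h (j : Fin 4) := toFun_covs_fld (e := e) [j] i j
    simp only [List.foldr_cons, List.foldr_nil] at h
    funext z α
    simp only [divF, map_sum, map_smul, h, Finset.sum_apply, Pi.smul_apply, toComplex, divField,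
      Complex.ofReal_sum, smul_eq_mul, Complex.ofReal_mul]
  · have : divField e i = ∑ j, eta j • cov e j (field e i j) := by
      funext z
      simp only [divField, Finset.sum_apply, Pi.smul_apply]
    rw [this]
    exact sum_mem fun j _ => Submodule.smul_mem _ _ (hm j)

end PolyField

end PolyFields

/-! ### Symmetrization -/

section Symmetrization

theorem patch_patch {I : Type*} (n : ℕ) (k l : Fin n → I) (K : ℕ → I) :
    patch n k (patch n l K) = patch n k K := by
  funext j
  simp only [patch]
  split_ifs <;> rfl

theorem patch_snoc {I : Type*} (n : ℕ) (k : Fin n → I) (a : I) (K : ℕ → I) :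
    patch (n + 1) (Fin.snoc k a : Fin (n + 1) → I) K = patch n k (Function.update K (n + 1) a) := by
  funext j
  rcases j with _ | j
  · simp [patch, Function.update]
  · rcases lt_trichotomy j n with h | rfl | h
    · rw [patch_succ _ _ (show j < n + 1 by omega), patch_succ _ _ h]
      exact Fin.snoc_castSucc (α := fun _ => I) a k ⟨j, h⟩
    · rw [patch_succ _ _ (show j < j + 1 by omega), patch_of_lt _ _ (by omega),
        Function.update_self]
      exact Fin.snoc_last (α := fun _ => I) a k
    · rw [patch_of_lt _ _ (by omega), patch_of_lt _ _ (by omega),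
        Function.update_of_ne (by omega)]

theorem patch_bold {I : Type*} (n : ℕ) (K : ℕ → I) : patch n (bold n K) K = K := by
  funext j
  simp only [patch, bold]
  split_ifs with h
  · congr 1
    omega
  · rfl

variable {V V' : Type*} [AddCommGroup V] [Module ℝ V] [AddCommGroup V'] [Module ℝ V']

theorem map_symAvg {I : Type*} (f : V →ₗ[ℝ] V') {n : ℕ} (T : (Fin n → I) → V) (k : Fin n → I) :
    f (symAvg T k) = symAvg (fun k => f (T k)) k := by
  simp only [symAvg, map_smul, map_sum]

theorem symAvg_eq_of_forall {I : Type*} {n : ℕ} {T : (Fin n → I) → V} {k : Fin n → I} {x : V}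
    (h : ∀ s : Equiv.Perm (Fin n), T (k ∘ s) = x) : symAvg T k = x := by
  simp only [symAvg, h]
  rw [Finset.sum_const, Finset.card_univ, Fintype.card_perm, Fintype.card_fin,
    ← Nat.cast_smul_eq_nsmul ℝ, smul_smul, inv_mul_cancel₀, one_smul]
  exact_mod_cast n.factorial_ne_zero

theorem symAvg_const {I : Type*} {n : ℕ} (T : (Fin n → I) → V) (a : I) :
    symAvg T (fun _ => a) = T fun _ => a :=
  symAvg_eq_of_forall fun _ => rfl

theorem symAvg_update {I : Type*} {n : ℕ} (T : (Fin (n + 1) → I) → V) (a b : I)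
    (j : Fin (n + 1)) :
    symAvg T (Function.update (fun _ => a) j b) =
      (n + 1 : ℝ)⁻¹ • ∑ i, T (Function.update (fun _ => a) i b) := by
  rw [← sum_perm_apply (fun i => T (Function.update (fun _ => a) i b)) j, symAvg]
  congr 1
  refine Fintype.sum_equiv (Equiv.inv _) _ _ fun s => ?_
  congr 1
  exact Function.update_comp_equiv (fun _ => a) s j b

theorem sum_symAvg_update {I : Type*} {n : ℕ} (T : (Fin n → I) → V) (a b : I) :
    ∑ j, symAvg T (Function.update (fun _ => a) j b) =
      ∑ j, T (Function.update (fun _ => a) j b) := by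
  rcases n with _ | n
  · simp
  · simp only [symAvg_update]
    rw [Finset.sum_const, Finset.card_univ, Fintype.card_fin, ← Nat.cast_smul_eq_nsmul ℝ, smul_smul]
    push_cast
    rw [mul_inv_cancel₀ (by positivity), one_smul]

theorem symAvg_comp_perm {I : Type*} {n : ℕ} (T : (Fin n → I) → V) (k : Fin n → I)
    (s : Equiv.Perm (Fin n)) : symAvg T (k ∘ s) = symAvg T k := by
  simp only [symAvg]
  congr 1
  exact Fintype.sum_equiv (Equiv.mulLeft s) _ _ fun t => rfl

/-- A symmetric function is invariant under permutations of its first `m` arguments. -/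
theorem symmetric_bold_patch {I X : Type*} {m : ℕ} (d : ℕ) {f : (Fin (m + d) → I) → X}
    (hf : ∀ k (s : Equiv.Perm (Fin (m + d))), f (k ∘ s) = f k) (k : Fin m → I)
    (s : Equiv.Perm (Fin m)) (K : ℕ → I) :
    f (bold (m + d) (patch m (k ∘ s) K)) = f (bold (m + d) (patch m k K)) := by
  rw [← hf (bold (m + d) (patch m k K))
    (finSumFinEquiv.permCongr (Equiv.sumCongr s (Equiv.refl _)))]
  congr 1
  funext j
  rw [Function.comp_apply]
  refine Fin.addCases (fun i => ?_) (fun i => ?_) j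
  · simp [bold, Equiv.permCongr_apply, patch_succ]
  · simp [bold, Equiv.permCongr_apply, patch_of_lt]

theorem symFirst_patch_comp {I : Type*} {m n : ℕ} (h : m ≤ n) (T : (ℕ → I) → V) (k : Fin m → I)
    (s : Equiv.Perm (Fin m)) (K : ℕ → I) :
    symFirst n T (patch m (k ∘ s) K) = symFirst n T (patch m k K) := by
  obtain ⟨d, rfl⟩ := Nat.exists_eq_add_of_le h
  have hp (l : Fin m → I) (k') : patch (m + d) k' (patch m l K) = patch (m + d) k' K := by
    funext j
    simp only [patch]
    split_ifs <;> first | rfl | omega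
  simp only [symFirst, hp]
  exact symmetric_bold_patch d (fun k s => symAvg_comp_perm _ k s) k s K

end Symmetrization

/-! ### Contraction of spinorial tensors with spinors -/

section Contraction

variable {V V' : Type*} [AddCommGroup V] [Module ℂ V] [AddCommGroup V'] [Module ℂ V']

/-- The contraction of each index of the tensor `T` with a spinor. -/
def con {n : ℕ} (u : Fin n → Spinor) : ((Fin n → Fin 2) → V) →ₗ[ℂ] V :=
  ∑ k : Fin n → Fin 2, (∏ s, u s (k s)) • LinearMap.proj k

theorem con_apply {n : ℕ} (u : Fin n → Spinor) (T : (Fin n → Fin 2) → V) :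
    con u T = ∑ k, (∏ s, u s (k s)) • T k := by
  simp [con]

theorem map_con (f : V →ₗ[ℂ] V') {n : ℕ} (u : Fin n → Spinor) (T : (Fin n → Fin 2) → V) :
    f (con u T) = con u fun k => f (T k) := by
  simp only [con_apply, map_sum, map_smul]

theorem con_smul_fun {n : ℕ} (u : Fin n → Spinor) (r : ℂ) (T : (Fin n → Fin 2) → V) :
    (con u fun k => r • T k) = r • con u T :=
  map_smul (con u) r T

theorem con_comm {m n : ℕ} (u : Fin n → Spinor) (v : Fin m → Spinor)
    (T : (Fin n → Fin 2) → (Fin m → Fin 2) → V) :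
    (con u fun k => con v (T k)) = con v fun l => con u fun k => T k l :=
  (map_con (con u) v fun l k => T k l).symm ▸ congrArg (con u) (funext fun k => by
    simp only [con_apply, Finset.sum_apply, Pi.smul_apply])

theorem con_comp_perm {n : ℕ} (u : Fin n → Spinor) (s : Equiv.Perm (Fin n))
    (T : (Fin n → Fin 2) → V) : (con u fun k => T (k ∘ s)) = con (u ∘ s) T := by
  simp only [con_apply]
  refine Fintype.sum_equiv (s.symm.arrowCongr (Equiv.refl _)) _ _ fun k => ?_
  congr 1
  refine (Fintype.prod_equiv s _ _ fun t => ?_).symm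
  simp [Equiv.arrowCongr]

theorem con_snoc {n : ℕ} (u : Fin (n + 1) → Spinor) (T : (Fin (n + 1) → Fin 2) → V) :
    con u T = ∑ a, u (Fin.last n) a • con (Fin.init u) fun k => T (Fin.snoc k a) := by
  simp only [con_apply]
  rw [← (Fin.snocEquiv fun _ => Fin 2).sum_comp, Fintype.sum_prod_type]
  refine Finset.sum_congr rfl fun a _ => ?_
  rw [Finset.smul_sum]
  refine Finset.sum_congr rfl fun k _ => ?_
  rw [smul_smul]
  congr 1
  simp [Fin.snocEquiv, Fin.prod_univ_castSucc, Fin.init, mul_comm]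

/-! #### Contraction of expressions in sequences of indices -/

/-- The contraction of the indices `K_1, …, K_n` of `T`; the other indices are those of `K`. -/
def conFirst (n : ℕ) (u : Fin n → Spinor) (T : (ℕ → Fin 2) → V) (K : ℕ → Fin 2) : V :=
  con u fun k => T (patch n k K)

theorem conFirst_succ (n : ℕ) (u : Fin (n + 1) → Spinor) (T : (ℕ → Fin 2) → V) (K : ℕ → Fin 2) :
    conFirst (n + 1) u T K =
      ∑ a, u (Fin.last n) a • conFirst n (Fin.init u) T (Function.update K (n + 1) a) := by
  simp only [conFirst, con_snoc u, patch_snoc]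

/-- An index which is not contracted is contracted with a basis spinor. -/
theorem conFirst_eq_succ (n : ℕ) (ξ : Spinor) (T : (ℕ → Fin 2) → V) (K : ℕ → Fin 2) :
    conFirst n (fun _ => ξ) T K = conFirst (n + 1)
      (Function.update (fun _ => ξ) (Fin.last n) (Pi.single (K (n + 1)) 1)) T K := by
  rw [conFirst_succ, Finset.sum_eq_single (K (n + 1))]
  · rw [Function.update_self, Pi.single_eq_same, one_smul, Function.update_eq_self,
      Fin.init_update_last]
    rfl
  · intro b _ hb
    rw [Function.update_self, Pi.single_eq_of_ne hb, zero_smul]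
  · simp

theorem conFirst_bold (n : ℕ) (u : Fin n → Spinor) (X : (Fin n → Fin 2) → V) (K : ℕ → Fin 2) :
    conFirst n u (fun K => X (bold n K)) K = con u X := by
  simp only [conFirst, bold_patch]

variable [Module ℝ V] [IsScalarTower ℝ ℂ V]

/-- Contraction of a symmetrized tensor symmetrizes over the spinors instead. -/
theorem con_symAvg {n : ℕ} (u : Fin n → Spinor) (T : (Fin n → Fin 2) → V) :
    con u (symAvg T) = symAvg (fun u => con u T) u := by
  have : symAvg T =
      (((n.factorial : ℝ)⁻¹ : ℝ) : ℂ) • ∑ s : Equiv.Perm (Fin n), fun k => T (k ∘ s) := by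
    funext k
    rw [symAvg, Pi.smul_apply, Finset.sum_apply, ← algebraMap_smul ℂ]
    rfl
  rw [this, map_smul, map_sum, symAvg, ← algebraMap_smul ℂ (_ : ℝ) (∑ _, _)]
  simp only [con_comp_perm]
  rfl

theorem conFirst_symFirst (n : ℕ) (ξ : Spinor) (T : (ℕ → Fin 2) → V) (K : ℕ → Fin 2) :
    conFirst n (fun _ => ξ) (symFirst n T) K = conFirst n (fun _ => ξ) T K := by
  simp only [conFirst, symFirst, patch_patch, bold_patch]
  exact (con_symAvg _ _).trans (symAvg_const _ _)

/-- If one of the `n + 1` symmetrized indices is left free, the contraction is the average over the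
possible positions of the free index. -/
theorem conFirst_symFirst_succ (n : ℕ) (ξ : Spinor) (T : (ℕ → Fin 2) → V) (K : ℕ → Fin 2) :
    conFirst n (fun _ => ξ) (symFirst (n + 1) T) K =
      ((n : ℂ) + 1)⁻¹ • ∑ j, conFirst (n + 1)
        (Function.update (fun _ => ξ) j (Pi.single (K (n + 1)) 1)) T K := by
  rw [conFirst_eq_succ]
  simp only [conFirst, symFirst, patch_patch, bold_patch]
  refine (con_symAvg _ _).trans ((symAvg_update _ _ _ _).trans ?_)
  rw [← algebraMap_smul ℂ (_ : ℝ)]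
  congr 1
  simp

theorem conFirst_comm_symFirst (m n : ℕ) (u : Fin n → Spinor)
    (T : (ℕ → Fin 2) → (ℕ → Fin 2) → V) (K K' : ℕ → Fin 2) :
    conFirst n u (fun K' => symFirst m (fun K => T K K') K) K' =
      symFirst m (fun K => conFirst n u (T K) K') K := by
  refine Eq.trans (congrArg (con u) (funext fun l => ?_)) (map_symAvg ((con u).restrictScalars ℝ)
    (fun k (l : Fin n → Fin 2) => T (patch m k K) (patch n l K')) (bold m K))
  simp only [symFirst, symAvg, Finset.sum_apply, Pi.smul_apply]

end Contraction

/-! #### Recovering a symmetric tensor from its contractions -/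

theorem exists_perm_of_sum_eq {n : ℕ} {k l : Fin n → Fin 2}
    (h : ∑ s, (k s : ℕ) = ∑ s, (l s : ℕ)) : ∃ s : Equiv.Perm (Fin n), l = k ∘ s := by
  have h1 (k : Fin n → Fin 2) : ∑ s, (k s : ℕ) = Fintype.card {s // k s = 1} := by
    rw [Fintype.card_subtype, Finset.card_filter]
    refine Finset.sum_congr rfl fun s _ => ?_
    generalize k s = a
    fin_cases a <;> rfl
  have h0 (k : Fin n → Fin 2) : Fintype.card {s // k s = 0} = n - Fintype.card {s // k s = 1} := by
    have := Fintype.card_subtype_compl fun s => k s = 1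
    rw [Fintype.card_fin] at this
    rw [← this]
    refine Fintype.card_congr (Equiv.subtypeEquivRight fun s => ?_)
    generalize k s = a
    fin_cases a <;> simp
  rw [h1, h1] at h
  have hc : ∀ a, Nonempty ({s // l s = a} ≃ {s // k s = a}) := by
    intro a
    fin_cases a
    · exact ⟨Fintype.equivOfCardEq ((h0 l).trans (h ▸ (h0 k).symm))⟩
    · exact ⟨Fintype.equivOfCardEq h.symm⟩
  refine ⟨Equiv.ofFiberEquiv fun a => (hc a).some, funext fun s => ?_⟩
  exact (Equiv.ofFiberEquiv_map _ s).symm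

/-- The contraction of a symmetric tensor with `(1, τ)` is a polynomial in `τ`, whose coefficients
are positive multiples of the components. -/
theorem mem_of_con_mem {V : Type*} [AddCommGroup V] [Module ℂ V] (W : Submodule ℂ V) {n : ℕ}
    (T : (Fin n → Fin 2) → V) (hT : ∀ k (s : Equiv.Perm (Fin n)), T (k ∘ s) = T k)
    (h : ∀ τ : ℂ, con (fun _ => ![1, τ]) T ∈ W) (k : Fin n → Fin 2) : T k ∈ W := by
  have h1 := coeff_mem_of_forall_mem W (n + 1)
    (fun j => ∑ l : Fin n → Fin 2 with ∑ s, (l s : ℕ) = j, T l) (fun τ => ?_)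
  · have h2 := h1 (∑ s, (k s : ℕ)) (Nat.lt_succ_of_le (by
      calc ∑ s, (k s : ℕ) ≤ ∑ _s : Fin n, 1 := Finset.sum_le_sum fun s _ => by omega
        _ = n := by simp))
    rw [Finset.sum_congr rfl (g := fun _ => T k), Finset.sum_const,
      ← Nat.cast_smul_eq_nsmul ℂ] at h2
    · refine (W.smul_mem_iff ?_).1 h2
      rw [Nat.cast_ne_zero]
      exact Finset.card_ne_zero_of_mem (Finset.mem_filter.2 ⟨Finset.mem_univ k, rfl⟩)
    · intro l hl
      obtain ⟨s, rfl⟩ := exists_perm_of_sum_eq (Finset.mem_filter.1 hl).2.symm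
      exact hT k s
  · have h3 := h τ
    convert h3 using 1
    rw [con_apply, ← Finset.sum_fiberwise_of_maps_to (s := Finset.univ)
      (t := Finset.range (n + 1)) (g := fun l : Fin n → Fin 2 => ∑ s, (l s : ℕ))]
    · refine Finset.sum_congr rfl fun j _ => ?_
      rw [Finset.smul_sum]
      refine Finset.sum_congr rfl fun l hl => ?_
      rw [← (Finset.mem_filter.1 hl).2, ← Finset.prod_pow_eq_pow_sum]
      congr 1
      refine Finset.prod_congr rfl fun s _ => ?_
      generalize l s = a
      fin_cases a <;> simp
    · intro l _
      refine Finset.mem_range.2 (Nat.lt_succ_of_le ?_)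
      calc ∑ s, (l s : ℕ) ≤ ∑ _s : Fin n, 1 := Finset.sum_le_sum fun s _ => by omega
        _ = n := by simp

/-! ### Derivatives of the curvature contracted with spinors -/

namespace SpinorGauge

variable {L : Type*} [LieRing L] [LieAlgebra ℂ L] (G : SpinorGauge L)

/-- The iterated covariant derivative `u_1^{K_1} v_1^{K_1'} ⋯ u_n^{K_n} v_n^{K_n'}
∇_{K_1K_1'} ⋯ ∇_{K_nK_n'} x`. -/
def word : {n : ℕ} → (Fin n → Spinor) → (Fin n → Spinor) → L →ₗ[ℂ] L
  | 0, _, _ => LinearMap.id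
  | _ + 1, u, v => G.nab (u 0) (v 0) ∘ₗ word (Fin.tail u) (Fin.tail v)

theorem word_succ {n : ℕ} (u v : Fin (n + 1) → Spinor) (x : L) :
    G.word u v x = G.nab (u 0) (v 0) (G.word (Fin.tail u) (Fin.tail v) x) := rfl

theorem word_const (n : ℕ) (ξ ζ : Spinor) (x : L) :
    G.word (fun _ : Fin n => ξ) (fun _ => ζ) x = ((G.nab ξ ζ) ^ n) x := by
  induction n with
  | zero => rfl
  | succ n ih =>
    rw [word_succ, pow_succ', Module.End.mul_apply, ← ih]
    rfl

theorem tail_const {n : ℕ} {α : Type*} (a : α) :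
    Fin.tail (fun _ : Fin (n + 1) => a) = fun _ => a := rfl

/-- Polarization with respect to `ξ` replaces one factor `ξ` at a time by `η`, in the derivatives
and in the curvature. -/
theorem sum_word_left (n : ℕ) (ξ η ζ : Spinor) :
    ∑ j : Fin n, G.word (Function.update (fun _ => ξ) j η) (fun _ => ζ) (G.Φ ξ ξ) +
      ((G.nab ξ ζ) ^ n) ((2 : ℂ) • G.Φ η ξ) = G.polQ ξ η ζ n := by
  induction n with
  | zero => simp [polQ]
  | succ n ih =>
    rw [Fin.sum_univ_succ, pow_succ', Module.End.mul_apply, polQ, ← ih, map_add, map_sum]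
    simp only [word_succ, Function.update_self, Fin.tail_update_zero, Fin.tail_update_succ,
      tail_const, word_const, Function.update_of_ne (Fin.succ_ne_zero _).symm]
    abel

theorem sum_word_right (n : ℕ) (ξ ζ θ : Spinor) :
    ∑ l : Fin n, G.word (fun _ => ξ) (Function.update (fun _ => ζ) l θ) (G.Φ ξ ξ) =
      G.polV ξ ζ θ n := by
  induction n with
  | zero => simp [polV]
  | succ n ih =>
    rw [Fin.sum_univ_succ, polV, ← ih, map_sum]
    simp only [word_succ, Function.update_self, Fin.tail_update_zero, Fin.tail_update_succ,
      tail_const, word_const, Function.update_of_ne (Fin.succ_ne_zero _).symm]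
    abel

theorem sum_word_both (n : ℕ) (ξ η ζ θ : Spinor) :
    ∑ j : Fin n, ∑ l : Fin n,
      G.word (Function.update (fun _ => ξ) j η) (Function.update (fun _ => ζ) l θ) (G.Φ ξ ξ) +
      ∑ l : Fin n, G.word (fun _ => ξ) (Function.update (fun _ => ζ) l θ) ((2 : ℂ) • G.Φ η ξ) =
      G.polU ξ η ζ θ n := by
  induction n with
  | zero => simp [polU]
  | succ n ih =>
    rw [polU, ← ih, ← sum_word_left, ← sum_word_right, map_add, map_sum, map_add, map_sum, map_sum,
      map_sum]
    simp only [Fin.sum_univ_succ, word_succ, Function.update_self, Fin.tail_update_zero,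
      Fin.tail_update_succ, tail_const, word_const, Function.update_of_ne (Fin.succ_ne_zero _).symm,
      map_sum, Finset.sum_add_distrib]
    abel

/-- The tensor `∇_{K_1K_1'} ⋯ ∇_{K_nK_n'} Φ_{K_{n+2}K_{n+1}}` contracted with spinors. -/
def curvWord {n : ℕ} (u : Fin (n + 2) → Spinor) (v : Fin n → Spinor) : L :=
  G.word (fun s => u s.castSucc.castSucc) v
    (G.Φ (u (Fin.last (n + 1))) (u (Fin.last n).castSucc))

theorem curvWord_const (n : ℕ) (ξ ζ : Spinor) :
    G.curvWord (fun _ : Fin (n + 2) => ξ) (fun _ => ζ) = ((G.nab ξ ζ) ^ n) (G.Φ ξ ξ) :=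
  G.word_const n ξ ζ _

theorem curvWord_update (n : ℕ) (ξ η : Spinor) (v : Fin n → Spinor) :
    ∑ j, G.curvWord (Function.update (fun _ : Fin (n + 2) => ξ) j η) v =
      ∑ j, G.word (Function.update (fun _ => ξ) j η) v (G.Φ ξ ξ) +
        (G.word (fun _ => ξ) v (G.Φ ξ η) + G.word (fun _ => ξ) v (G.Φ η ξ)) := by
  have h (j : Fin n) (s : Fin n) :
      Function.update (fun _ : Fin (n + 2) => ξ) j.castSucc.castSucc η s.castSucc.castSucc =
        Function.update (fun _ => ξ) j η s := by
    simp only [Function.update_apply, Fin.castSucc_inj]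
  rw [Fin.sum_univ_castSucc, Fin.sum_univ_castSucc, add_assoc]
  congr 1
  · refine Finset.sum_congr rfl fun j _ => ?_
    simp only [curvWord, h]
    rw [Function.update_of_ne (Fin.castSucc_lt_last _).ne',
      Function.update_of_ne ((Fin.castSucc_injective _).ne (Fin.castSucc_lt_last j).ne')]
  · congr 1
    · simp [curvWord, Fin.ext_iff, fun s : Fin n => s.isLt.ne]
    · have h1 (s : Fin n) : (s : ℕ) ≠ n + 1 := by omega
      simp [curvWord, Fin.ext_iff, h1]

theorem sum_curvWord_left (n : ℕ) (ξ η ζ : Spinor) :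
    ∑ j, G.curvWord (Function.update (fun _ : Fin (n + 2) => ξ) j η) (fun _ => ζ) =
      G.polQ ξ η ζ n := by
  rw [curvWord_update, ← sum_word_left, ← map_add, word_const, G.Φ_symm ξ η, two_smul]

theorem sum_curvWord_right (n : ℕ) (ξ ζ θ : Spinor) :
    ∑ l, G.curvWord (fun _ : Fin (n + 2) => ξ) (Function.update (fun _ => ζ) l θ) =
      G.polV ξ ζ θ n :=
  G.sum_word_right n ξ ζ θ

theorem sum_curvWord_both (n : ℕ) (ξ η ζ θ : Spinor) :
    ∑ j, ∑ l, G.curvWord (Function.update (fun _ : Fin (n + 2) => ξ) j η)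
      (Function.update (fun _ => ζ) l θ) = G.polU ξ η ζ θ n := by
  rw [Finset.sum_comm]
  simp only [curvWord_update, Finset.sum_add_distrib, ← sum_word_both, two_smul, map_add,
    G.Φ_symm ξ η]
  rw [Finset.sum_comm]

end SpinorGauge

/-! ### Contractions of the symmetrized derivatives of the curvature -/

section CurvTensor

/-- The contraction of two groups of indices. -/
def conTwo {V : Type*} [AddCommGroup V] [Module ℂ V] {m n : ℕ} (u : Fin m → Spinor)
    (v : Fin n → Spinor) (T : (Fin m → Fin 2) → (Fin n → Fin 2) → V) : V :=
  con u fun k => con v (T k)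

variable {L : Type*} [LieRing L] [LieAlgebra ℂ L]
  {V : Type*} [AddCommGroup V] [Module ℂ V] [Module ℝ V]

/-- `T` is the image under `f` of the tensor
`∇_{(K_1(K_1'} ⋯ ∇_{K_n K_n')} Φ_{K_{n+2}K_{n+1})}` of `G`. -/
def IsCurvTensor (G : SpinorGauge L) (f : L →ₗ[ℂ] V) {n : ℕ}
    (T : (Fin (n + 2) → Fin 2) → (Fin n → Fin 2) → V) : Prop :=
  ∀ u v, conTwo u v T = symAvg (fun u => symAvg (fun v => f (G.curvWord u v)) v) u

theorem isCurvTensor_symAvg [IsScalarTower ℝ ℂ V] {G : SpinorGauge L} {f : L →ₗ[ℂ] V} {n : ℕ}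
    {U : (Fin (n + 2) → Fin 2) → (Fin n → Fin 2) → V}
    (hU : ∀ u v, conTwo u v U = f (G.curvWord u v)) :
    IsCurvTensor G f fun K K' => symAvg (fun K => symAvg (fun K' => U K K') K') K := by
  intro u v
  have h1 (K : Fin (n + 2) → Fin 2) :
      (con v fun K' => symAvg (fun K => symAvg (fun K' => U K K') K') K) =
        symAvg (fun K => symAvg (fun v => con v (U K)) v) K := by
    simp only [← con_symAvg]
    refine Eq.trans (congrArg (con v) (funext fun l => ?_)) (map_symAvg
      ((con v).restrictScalars ℝ) (fun K => symAvg (U K)) K)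
    simp only [symAvg, Finset.sum_apply, Pi.smul_apply]
  simp only [conTwo, h1]
  refine (con_symAvg u _).trans ?_
  congr 1
  funext u
  refine (Eq.trans (congrArg (con u) (funext fun l => ?_)) (map_symAvg
    ((con u).restrictScalars ℝ) (fun v K => con v (U K)) v)).trans ?_
  · simp only [symAvg, Finset.sum_apply, Pi.smul_apply]
  · simp only [← hU]
    rfl

namespace IsCurvTensor

variable {G : SpinorGauge L} {f : L →ₗ[ℂ] V}

section

variable {n : ℕ} {T : (Fin (n + 2) → Fin 2) → (Fin n → Fin 2) → V}

theorem con_const (h : IsCurvTensor G f T) (ξ ζ : Spinor) :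
    conTwo (fun _ => ξ) (fun _ => ζ) T = f (((G.nab ξ ζ) ^ n) (G.Φ ξ ξ)) := by
  rw [h, symAvg_const, symAvg_const, G.curvWord_const]

theorem sum_con_left (h : IsCurvTensor G f T) (ξ η ζ : Spinor) :
    ∑ j, conTwo (Function.update (fun _ => ξ) j η) (fun _ => ζ) T = f (G.polQ ξ η ζ n) := by
  simp only [h _ _]
  rw [sum_symAvg_update]
  simp only [symAvg_const]
  rw [← G.sum_curvWord_left, map_sum]

theorem con_left [IsScalarTower ℝ ℂ V] (h : IsCurvTensor G f T) (ξ η ζ : Spinor) (j : Fin (n + 2)) :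
    conTwo (Function.update (fun _ => ξ) j η) (fun _ => ζ) T =
      ((n : ℂ) + 2)⁻¹ • f (G.polQ ξ η ζ n) := by
  rw [h, symAvg_update]
  simp only [symAvg_const]
  rw [← G.sum_curvWord_left, map_sum, ← algebraMap_smul ℂ (_ : ℝ)]
  congr 1
  simp only [Complex.coe_algebraMap]
  push_cast
  ring

theorem sum_con_right (h : IsCurvTensor G f T) (ξ ζ θ : Spinor) :
    ∑ l, conTwo (fun _ => ξ) (Function.update (fun _ => ζ) l θ) T = f (G.polV ξ ζ θ n) := by
  simp only [h _ _, symAvg_const]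
  rw [sum_symAvg_update, ← G.sum_curvWord_right, map_sum]

end

section

variable {n : ℕ} {T : (Fin (n + 1 + 2) → Fin 2) → (Fin (n + 1) → Fin 2) → V}

theorem con_right [IsScalarTower ℝ ℂ V] (h : IsCurvTensor G f T) (ξ ζ θ : Spinor)
    (l : Fin (n + 1)) :
    conTwo (fun _ => ξ) (Function.update (fun _ => ζ) l θ) T =
      ((n : ℂ) + 1)⁻¹ • f (G.polV ξ ζ θ (n + 1)) := by
  rw [h, symAvg_const, symAvg_update, ← G.sum_curvWord_right, map_sum, ← algebraMap_smul ℂ (_ : ℝ)]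
  congr 1
  simp

theorem con_both [IsScalarTower ℝ ℂ V] (h : IsCurvTensor G f T) (ξ η ζ θ : Spinor)
    (j : Fin (n + 1 + 2))
    (l : Fin (n + 1)) :
    conTwo (Function.update (fun _ => ξ) j η) (Function.update (fun _ => ζ) l θ) T =
      (((n : ℂ) + 1) * ((n : ℂ) + 3))⁻¹ • f (G.polU ξ η ζ θ (n + 1)) := by
  rw [h, symAvg_update]
  simp only [symAvg_update]
  rw [← G.sum_curvWord_both]
  simp only [map_sum, ← Finset.smul_sum, smul_smul]
  rw [← algebraMap_smul ℂ (_ : ℝ)]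
  congr 1
  simp only [Complex.coe_algebraMap, mul_inv]
  push_cast
  ring

end

end IsCurvTensor

end CurvTensor

/-! ### The symmetrized variables and their contractions -/

theorem SpinorGauge.word_dual {L : Type*} [LieRing L] [LieAlgebra ℂ L] (G : SpinorGauge L) {n : ℕ}
    (u v : Fin n → Spinor) (x : L) : G.dual.word v u x = G.word u v x := by
  induction n with
  | zero => rfl
  | succ n ih => rw [word_succ, word_succ, ih]; rfl

theorem prod_sum_sum {n : ℕ} (g : Fin n → Fin 2 → Fin 2 → ℂ) :
    ∏ s, ∑ A, ∑ B, g s A B = ∑ K : Fin n → Fin 2, ∑ K' : Fin n → Fin 2, ∏ s, g s (K s) (K' s) := by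
  rw [Finset.prod_univ_sum, Fintype.piFinset_univ]
  refine Finset.sum_congr rfl fun K _ => ?_
  rw [Finset.prod_univ_sum, Fintype.piFinset_univ]

theorem conTwo_smul_const {V : Type*} [AddCommGroup V] [Module ℂ V] {n : ℕ}
    (u v : Fin n → Spinor) (g : Fin n → Fin 2 → Fin 2 → ℂ) (x : V) :
    conTwo u v (fun K K' => (∏ s, g s (K s) (K' s)) • x) =
      (∏ s, ∑ A, ∑ B, u s A * v s B * g s A B) • x := by
  simp only [conTwo, con_apply, smul_smul, Finset.smul_sum]
  rw [prod_sum_sum fun s A B => u s A * v s B * g s A B, Finset.sum_smul]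
  refine Finset.sum_congr rfl fun K _ => ?_
  rw [Finset.sum_smul]
  refine Finset.sum_congr rfl fun K' _ => ?_
  simp only [Finset.prod_mul_distrib, mul_assoc]

theorem conTwo_sum {V J : Type*} [AddCommGroup V] [Module ℂ V] {m n : ℕ} (u : Fin m → Spinor)
    (v : Fin n → Spinor) (s : Finset J) (T : J → (Fin m → Fin 2) → (Fin n → Fin 2) → V) :
    conTwo u v (fun K K' => ∑ j ∈ s, T j K K') = ∑ j ∈ s, conTwo u v (T j) := by
  have h (K) : (fun K' => ∑ j ∈ s, T j K K') = ∑ j ∈ s, T j K := by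
    funext
    rw [Finset.sum_apply]
  have h' : (fun K => ∑ j ∈ s, con v (T j K)) = ∑ j ∈ s, fun K => con v (T j K) := by
    funext
    rw [Finset.sum_apply]
  simp only [conTwo, h, map_sum]
  rw [h', map_sum]

theorem map_conTwo {V V' : Type*} [AddCommGroup V] [Module ℂ V] [AddCommGroup V'] [Module ℂ V']
    (f : V →ₗ[ℂ] V') {m n : ℕ} (u : Fin m → Spinor) (v : Fin n → Spinor)
    (T : (Fin m → Fin 2) → (Fin n → Fin 2) → V) :
    f (conTwo u v T) = conTwo u v fun K K' => f (T K K') := by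
  simp only [conTwo, map_con]

/-- Raising an index with `ε`: the contraction of `χ` with `ψ^A` is that of `raise χ` with `ψ_A`. -/
def raise (χ : Spinor) : Spinor := fun L => ∑ a, χ a * eps a L

theorem con_raise {V : Type*} [AddCommGroup V] [Module ℂ V] {n : ℕ} (v : Fin n → Spinor)
    (T : (Fin n → Fin 2) → V) :
    (con v fun K => ∑ L : Fin n → Fin 2, (∏ s, eps (K s) (L s)) • T L) =
      con (fun s => raise (v s)) T := by
  simp only [con_apply, raise, Finset.smul_sum, smul_smul]
  rw [Finset.sum_comm]
  refine Finset.sum_congr rfl fun L _ => ?_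
  rw [Finset.prod_univ_sum, Fintype.piFinset_univ, Finset.sum_smul]
  simp only [Finset.prod_mul_distrib]

section

variable {ι : Type*} [Fintype ι] {𝔤 : Type*} [LieRing 𝔤] [LieAlgebra ℝ 𝔤]
  {e : Module.Basis ι ℝ 𝔤} (c : ℝ)

namespace PolyField

variable (e) in
/-- Evaluation of polynomial fields at a jet. -/
def ev (z : Jet ι) : PolyField e →ₗ[ℂ] (ι → ℂ) := LinearMap.proj z ∘ₗ toFun

theorem ev_apply (z : Jet ι) (x : PolyField e) : ev e z x = toFun x z := rfl

variable (e) in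
/-- The iterated covariant derivative `∇_{k_1} ⋯ ∇_{k_n}` on polynomial fields. -/
def cvs (k : List (Fin 4)) : PolyField e →ₗ[ℂ] PolyField e :=
  k.foldr (fun i A => cv i ∘ₗ A) LinearMap.id

theorem cvs_apply (k : List (Fin 4)) (x : PolyField e) :
    cvs e k x = k.foldr (fun i => cv i) x := by
  induction k with
  | nil => rfl
  | cons i k ih => exact congrArg (cv i) ih

theorem ev_cvs_fld {n : ℕ} (k : Fin n → Fin 4) (i j : Fin 4) (z : Jet ι) (α : ι) :
    ev e z (cvs e (List.ofFn k) (fld i j)) α = ((covs e k (field e i j) z α : ℝ) : ℂ) := by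
  rw [ev_apply, cvs_apply, toFun_covs_fld _ i j]
  rfl

variable (e) in
/-- `σ^{k_1}_{K_1K_1'} ⋯ σ^{k_n}_{K_nK_n'} ∇_{k_1} ⋯ ∇_{k_n}`. -/
def spCvs {n : ℕ} (K K' : Fin n → Fin 2) : PolyField e →ₗ[ℂ] PolyField e :=
  ∑ k : Fin n → Fin 4, (∏ s, sigma c (k s) (K s) (K' s)) • cvs e (List.ofFn k)

theorem fieldSp_eq_ev {n : ℕ} (I I' J J' : Fin 2) (K K' : Fin n → Fin 2) (z : Jet ι) :
    fieldSp c e I I' J J' K K' z = ev e z (spCvs e c K K' (spF c fld I I' J J')) := by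
  funext α
  simp only [fieldSp, spCvs, spF, map_sum, map_smul, LinearMap.sum_apply, LinearMap.smul_apply,
    Finset.sum_apply, Pi.smul_apply, smul_eq_mul, ev_cvs_fld]
  refine Finset.sum_congr rfl fun i _ => Finset.sum_congr rfl fun j _ => ?_
  rw [Finset.mul_sum]
  simp only [mul_assoc]

theorem phiUnsym_eq_ev {n : ℕ} (I J : Fin 2) (K K' : Fin n → Fin 2) (z : Jet ι) :
    phiUnsym c e I J K K' z = ev e z (spCvs e c K K' (spΦ c fld I J)) := by
  funext α
  simp only [phiUnsym, fieldSp_eq_ev, spΦ, map_smul, map_sum, Finset.sum_apply, Pi.smul_apply,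
    smul_eq_mul]

theorem conj_eps (A B : Fin 2) : starRingEnd ℂ (eps A B) = eps A B := by
  fin_cases A <;> fin_cases B <;> simp [eps]

theorem conj_phiUnsym_eq_ev {n : ℕ} (I J : Fin 2) (K K' : Fin n → Fin 2) (z : Jet ι) (α : ι) :
    starRingEnd ℂ (phiUnsym c e I J K' K z α) = ev e z (spCvs e c K K' (spΦb c fld I J)) α := by
  simp only [phiUnsym, map_mul, map_sum, fieldSp_conj, conj_eps, map_div₀, map_one, map_ofNat]
  simp only [fieldSp_eq_ev, spΦb, map_smul, map_sum, Finset.sum_apply, Pi.smul_apply,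
    smul_eq_mul]

theorem nab_eq (u v : Spinor) :
    (gauge e c).nab u v = ∑ i, (∑ A, ∑ A', u A * v A' * sigma c i A A') • cv i := by
  refine LinearMap.ext fun x => ?_
  change spBilin (spNab c cv) u v x = _
  simp only [spBilin_apply, spNab, LinearMap.add_apply, LinearMap.sum_apply, LinearMap.smul_apply,
    Finset.smul_sum, smul_smul, Fin.sum_univ_two, add_smul, Finset.sum_add_distrib]

theorem conTwo_spCvs {n : ℕ} (u v : Fin n → Spinor) (x : PolyField e) :
    conTwo u v (fun K K' => spCvs e c K K' x) = (gauge e c).word u v x := by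
  have h : conTwo u v (fun K K' => spCvs e c K K' x) = ∑ k : Fin n → Fin 4,
      (∏ s, ∑ A, ∑ B, u s A * v s B * sigma c (k s) A B) • cvs e (List.ofFn k) x := by
    simp only [spCvs, LinearMap.sum_apply, LinearMap.smul_apply]
    rw [conTwo_sum]
    exact Finset.sum_congr rfl fun k _ => conTwo_smul_const u v (fun s => sigma c (k s)) _
  rw [h]
  clear h
  induction n with
  | zero =>
    rw [Fintype.sum_unique]
    simp [cvs, SpinorGauge.word]
  | succ n ih =>
    rw [SpinorGauge.word_succ, ← ih, nab_eq, LinearMap.sum_apply,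
      ← (Fin.consEquiv fun _ => Fin 4).sum_comp, Fintype.sum_prod_type]
    refine Finset.sum_congr rfl fun i _ => ?_
    rw [LinearMap.smul_apply, map_sum, Finset.smul_sum]
    refine Finset.sum_congr rfl fun k _ => ?_
    rw [map_smul, smul_smul, Fin.prod_univ_succ]
    simp only [Fin.consEquiv_apply, Fin.cons_zero, Fin.cons_succ, List.ofFn_succ]
    rfl

theorem conTwo_spCvs_curv {n : ℕ} (M : Fin 2 → Fin 2 → PolyField e) (u : Fin (n + 2) → Spinor)
    (v : Fin n → Spinor) :
    conTwo u v (fun K K' => spCvs e c (fun s : Fin n => K s.castSucc.castSucc) K'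
      (M (K (Fin.last (n + 1))) (K (Fin.last n).castSucc))) =
      (gauge e c).word (fun s => u s.castSucc.castSucc) v
        (spBilin M (u (Fin.last (n + 1))) (u (Fin.last n).castSucc)) := by
  simp only [conTwo, con_snoc u, con_snoc (Fin.init u), Fin.snoc_last, Fin.snoc_castSucc,
    spBilin_apply, map_sum, map_smul, ← conTwo_spCvs, Finset.smul_sum, smul_smul]
  rfl

variable (e)

theorem phiLow_apply (n : ℕ) (K : Fin (n + 2) → Fin 2) (K' : Fin n → Fin 2) (z : Jet ι) :
    phiLow c e n K K' z = symAvg (fun K : Fin (n + 2) → Fin 2 => symAvg (fun K' : Fin n → Fin 2 =>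
      phiUnsym c e (K (Fin.last (n + 1))) (K (Fin.last n).castSucc)
        (fun s : Fin n => K s.castSucc.castSucc) K' z) K') K := by
  simp only [phiLow, symAvg, Finset.sum_apply, Pi.smul_apply]
  rfl

/-- The symmetrized variables are the values of the symmetrized derivatives of the curvature. -/
theorem isCurvTensor_phiLow (n : ℕ) (z : Jet ι) :
    IsCurvTensor (gauge e c) (ev e z) fun K K' => phiLow c e n K K' z := by
  simp only [phiLow_apply, phiUnsym_eq_ev]
  refine isCurvTensor_symAvg fun u v => ?_
  rw [← map_conTwo (ev e z), conTwo_spCvs_curv c (spΦ c fld)]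
  rfl

/-- Complex conjugation of the components. -/
def conjVec (ι : Type*) : (ι → ℂ) →ₗ[ℝ] (ι → ℂ) := Complex.conjAe.toLinearMap.compLeft ι

theorem conjVec_apply (X : ι → ℂ) (α : ι) : conjVec ι X α = starRingEnd ℂ (X α) := rfl

/-- The conjugate variables are the values of the symmetrized derivatives of the dual gauge
structure, since conjugation exchanges primed and unprimed indices. -/
theorem isCurvTensor_conj_phiLow (n : ℕ) (z : Jet ι) :
    IsCurvTensor (gauge e c).dual (ev e z) fun K' K => conjVec ι (phiLow c e n K' K z) := by
  have h : (fun K' K => conjVec ι (phiLow c e n K' K z)) = fun K' K => symAvg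
      (fun K' : Fin (n + 2) → Fin 2 => symAvg (fun K => ev e z
        (spCvs e c K (fun s : Fin n => K' s.castSucc.castSucc)
          (spΦb c fld (K' (Fin.last (n + 1))) (K' (Fin.last n).castSucc)))) K) K' := by
    funext K' K
    have h1 (K' : Fin (n + 2) → Fin 2) (K : Fin n → Fin 2) :
        conjVec ι (phiUnsym c e (K' (Fin.last (n + 1))) (K' (Fin.last n).castSucc)
          (fun s : Fin n => K' s.castSucc.castSucc) K z) = ev e z
        (spCvs e c K (fun s : Fin n => K' s.castSucc.castSucc)
          (spΦb c fld (K' (Fin.last (n + 1))) (K' (Fin.last n).castSucc))) :=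
      funext fun α => conj_phiUnsym_eq_ev c _ _ _ _ z α
    simp only [← h1, ← map_symAvg (conjVec ι), phiLow_apply]
  rw [h]
  refine isCurvTensor_symAvg fun u v => ?_
  rw [← map_conTwo (ev e z)]
  congr 1
  simp only [conTwo, con_snoc u, con_snoc (Fin.init u), Fin.snoc_last, Fin.snoc_castSucc,
    SpinorGauge.curvWord, SpinorGauge.word_dual]
  have h2 (x : PolyField e) : (con (Fin.init (Fin.init u)) fun k => con v fun K =>
      spCvs e c K k x) = (gauge e c).word v (fun s => u s.castSucc.castSucc) x := by
    rw [con_comm, ← conTwo_spCvs]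
    rfl
  simp only [h2]
  change _ = (gauge e c).word v _ (spBilin (spΦb c fld) _ _)
  simp only [spBilin_apply, map_sum, map_smul, Finset.smul_sum, smul_smul]
  rfl

theorem conTwo_phiFin (n : ℕ) (z : Jet ι) (u : Fin (n + 2) → Spinor) (v : Fin n → Spinor) :
    conTwo u v (fun K K' => phiFin c e n K K' z) =
      conTwo u (fun s => raise (v s)) fun K K' => phiLow c e n K K' z := by
  simp only [conTwo, ← con_raise]
  congr 2
  funext K
  congr 1
  funext K' α
  simp [phiFin]

/-- The conjugate variables with the primed indices raised, indexed by tuples. -/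
def phiBarFin (p : ℕ) (K' : Fin (p + 2) → Fin 2) (K : Fin p → Fin 2) (z : Jet ι) : ι → ℂ :=
  ∑ L : Fin (p + 2) → Fin 2, (∏ s, eps (K' s) (L s)) • conjVec ι (phiLow c e p L K z)

theorem phiBar_eq (p : ℕ) (K' K : ℕ → Fin 2) (z : Jet ι) :
    phiBar c e p K' K z = phiBarFin e c p (bold (p + 2) K') (bold p K) z := by
  funext α
  simp [phiBar, phiBarFin, bold, conjVec_apply]

theorem conTwo_phiBarFin (n : ℕ) (z : Jet ι) (v : Fin (n + 2) → Spinor) (u : Fin n → Spinor) :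
    conTwo v u (fun K' K => phiBarFin e c n K' K z) =
      conTwo (fun s => raise (v s)) u fun K' K => conjVec ι (phiLow c e n K' K z) := by
  have h (K') : (con u fun K => phiBarFin e c n K' K z) = ∑ L : Fin (n + 2) → Fin 2,
      (∏ s, eps (K' s) (L s)) • con u fun K => conjVec ι (phiLow c e n L K z) := by
    simp only [← con_smul_fun, ← map_sum]
    congr 1
    funext K
    simp [phiBarFin]
  simp only [conTwo, ← con_raise, h]

theorem phiUnsym_zero_eq_ev (k k' : Fin 0 → Fin 2) (A B : Fin 2) (z : Jet ι) :
    phiUnsym c e A B k k' z = ev e z (spΦ c fld A B) := by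
  rw [phiUnsym_eq_ev]
  simp [spCvs, cvs]

theorem phi2_eq_ev (I J : Fin 2) (z : Jet ι) : phi2 c e I J z = ev e z (spΦ c fld I J) := by
  rw [phi2, phiLow_apply]
  refine symAvg_eq_of_forall fun s => symAvg_eq_of_forall fun t => ?_
  rw [phiUnsym_zero_eq_ev]
  change ev e z (spΦ c fld (![I, J] (s 1)) (![I, J] (s 0))) = _
  have hs : s 0 = 0 ∧ s 1 = 1 ∨ s 0 = 1 ∧ s 1 = 0 := by
    have h : ∀ a b : Fin 2, a ≠ b → a = 0 ∧ b = 1 ∨ a = 1 ∧ b = 0 := by decide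
    exact h _ _ (s.injective.ne (by decide))
  rcases hs with ⟨h0, h1⟩ | ⟨h0, h1⟩
  · rw [h0, h1, spF_symm c fld_swap I J]
    rfl
  · rw [h0, h1]
    rfl

theorem spBilin_phi2 (z : Jet ι) (u w : Spinor) :
    spBilin (fun I J => phi2 c e I J z) u w = ev e z ((gauge e c).Φ u w) := by
  change _ = ev e z (spBilin (spΦ c fld) u w)
  simp only [spBilin_apply, phi2_eq_ev, map_sum, map_smul]

theorem conj_phi2 (I J : Fin 2) (z : Jet ι) (α : ι) :
    starRingEnd ℂ (phi2 c e I J z α) = ev e z (spΦb c fld I J) α := by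
  have h := conj_phiUnsym_eq_ev (e := e) c I J (fun s : Fin 0 => 0) (fun _ => 0) z α
  rw [phiUnsym_eq_ev] at h
  rw [phi2_eq_ev]
  simpa [spCvs, cvs] using h

theorem sum_phiBar2Mix (z : Jet ι) (S' : Fin 2) (χ : Spinor) :
    ∑ I', χ I' • phiBar2Mix c e S' I' z =
      ev e z ((gauge e c).Φb (Pi.single S' 1) (raise χ)) := by
  change _ = ev e z (spBilin (spΦb c fld) _ _)
  funext α
  simp only [spBilin_apply, phiBar2Mix, conj_phi2, map_add, map_smul, raise, Fin.sum_univ_two,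
    Pi.add_apply, Pi.smul_apply, smul_eq_mul]
  fin_cases S' <;> simp <;> ring

theorem spBilin_phiBar2Up (z : Jet ι) (χ ψ : Spinor) :
    spBilin (fun I' J' => phiBar2Up c e I' J' z) χ ψ =
      ev e z ((gauge e c).Φb (raise χ) (raise ψ)) := by
  change _ = ev e z (spBilin (spΦb c fld) _ _)
  funext α
  simp only [spBilin_apply, phiBar2Up, conj_phi2, map_add, map_smul, raise, Fin.sum_univ_two,
    Pi.add_apply, Pi.smul_apply, smul_eq_mul]
  ring

/-! #### Covariant derivatives of the symmetrized variables -/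

theorem covSp_toFun (A A' : Fin 2) (x : PolyField e) :
    covSp c e A A' (toFun x) = toFun (spNab c cv A A' x) := by
  funext z
  simp only [covSp, spNab, LinearMap.sum_apply, LinearMap.smul_apply, map_sum, map_smul, toFun_cv,
    Finset.sum_apply, Pi.smul_apply]

theorem covUp_toFun (A A' : Fin 2) (x : PolyField e) (z : Jet ι) :
    covUp c e A A' (toFun x) z =
      ev e z ((gauge e c).nab (Pi.single A 1) (raise (Pi.single A' 1)) x) := by
  change _ = ev e z (spBilin (spNab c cv) _ _ x)
  simp only [covUp, covSp_toFun, spBilin_apply, LinearMap.add_apply, LinearMap.smul_apply, map_add,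
    map_smul, raise, Fin.sum_univ_two, ev_apply]
  fin_cases A <;> fin_cases A' <;> simp

/-- Any two spinor frames with `ε_{AB} ξ^A η^B = 1 = ε_{A'B'} ζ^{A'} θ^{B'}` compute the wave
operator. -/
theorem wave_toFun (ξ η ζ θ : Spinor) (h : spinPair ξ η = 1) (h' : spinPair ζ θ = 1)
    (x : PolyField e) (z : Jet ι) :
    wave c e (toFun x) z = ev e z ((gauge e c).box ξ η ζ θ x) := by
  have h1 : (gauge e c).box ξ η ζ θ x = (spinPair ξ η * spinPair ζ θ) •
      ∑ A, ∑ A', ∑ B, ∑ B', (eps A B * eps A' B') • spNab c cv A A' (spNab c cv B B' x) := by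
    change spBilin (spNab c cv) _ _ (spBilin (spNab c cv) _ _ x) +
      spBilin (spNab c cv) _ _ (spBilin (spNab c cv) _ _ x) -
      spBilin (spNab c cv) _ _ (spBilin (spNab c cv) _ _ x) -
      spBilin (spNab c cv) _ _ (spBilin (spNab c cv) _ _ x) = _
    simp only [spBilin_apply, LinearMap.add_apply, LinearMap.smul_apply, map_add, map_smul,
      Fin.sum_univ_two, spinPair]
    simp [eps]
    module
  rw [h1, h, h', one_mul, one_smul]
  simp only [wave, covSp_toFun, map_sum, map_smul, ev_apply]

theorem symAvg_mem {I V : Type*} [AddCommGroup V] [Module ℂ V] [Module ℝ V] [IsScalarTower ℝ ℂ V]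
    (W : Submodule ℂ V) {n : ℕ} {T : (Fin n → I) → V} (h : ∀ k, T k ∈ W) (k : Fin n → I) :
    symAvg T k ∈ W :=
  W.smul_of_tower_mem _ (sum_mem fun _ _ => h _)

/-- The symmetrized variables are polynomial fields. -/
theorem exists_phiFin_eq (n : ℕ) (K : Fin (n + 2) → Fin 2) (K' : Fin n → Fin 2) :
    ∃ x : PolyField e, toFun x = phiFin c e n K K' := by
  have h : phiFin c e n K K' = ∑ L : Fin n → Fin 2, (∏ s, eps (K' s) (L s)) •
      phiLow c e n K L := by
    funext z α
    simp [phiFin]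
  rw [← LinearMap.mem_range, h]
  refine sum_mem fun L _ => Submodule.smul_mem _ _ (symAvg_mem _ (fun K => symAvg_mem _
    (fun K' => ?_) _) _)
  exact ⟨_, (funext fun z => (phiUnsym_eq_ev c _ _ _ _ z)).symm⟩

theorem conTwo_toFun {n : ℕ} {y : (Fin (n + 2) → Fin 2) → (Fin n → Fin 2) → PolyField e}
    (hy : ∀ K K', toFun (y K K') = phiFin c e n K K') (ξ χ : Spinor) :
    conTwo (fun _ => ξ) (fun _ => χ) y =
      (((gauge e c).nab ξ (raise χ)) ^ n) ((gauge e c).Φ ξ ξ) := by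
  refine toFun_injective (funext fun z => ?_)
  rw [← ev_apply, ← ev_apply, map_conTwo, ← (isCurvTensor_phiLow e c n z).con_const,
    ← conTwo_phiFin e c n z (fun _ => ξ) (fun _ => χ)]
  simp only [← hy]
  rfl

theorem conTwo_covUp (n : ℕ) (ξ χ : Spinor) (A A' : Fin 2) (z : Jet ι) :
    conTwo (fun _ => ξ) (fun _ => χ) (fun K K' => covUp c e A A' (phiFin c e n K K') z) =
      ev e z ((gauge e c).nab (Pi.single A 1) (raise (Pi.single A' 1))
        ((((gauge e c).nab ξ (raise χ)) ^ n) ((gauge e c).Φ ξ ξ))) := by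
  choose y hy using exists_phiFin_eq e c n
  simp only [← hy, covUp_toFun]
  refine (map_conTwo (ev e z ∘ₗ (gauge e c).nab _ _) _ _ y).symm.trans ?_
  rw [conTwo_toFun e c hy, LinearMap.comp_apply]

theorem conTwo_wave (n : ℕ) (ξ η χ θ : Spinor) (h : spinPair ξ η = 1)
    (h' : spinPair (raise χ) θ = 1) (z : Jet ι) :
    conTwo (fun _ => ξ) (fun _ => χ) (fun K K' => wave c e (phiFin c e n K K') z) =
      ev e z ((gauge e c).box ξ η (raise χ) θ
        ((((gauge e c).nab ξ (raise χ)) ^ n) ((gauge e c).Φ ξ ξ))) := by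
  choose y hy using exists_phiFin_eq e c n
  let B : PolyField e →ₗ[ℂ] PolyField e :=
    (gauge e c).nab ξ (raise χ) ∘ₗ (gauge e c).nab η θ +
      (gauge e c).nab η θ ∘ₗ (gauge e c).nab ξ (raise χ) -
      (gauge e c).nab η (raise χ) ∘ₗ (gauge e c).nab ξ θ -
      (gauge e c).nab ξ θ ∘ₗ (gauge e c).nab η (raise χ)
  have hB (x) : (gauge e c).box ξ η (raise χ) θ x = B x := rfl
  simp only [← hy, wave_toFun e c ξ η (raise χ) θ h h', hB]
  refine (map_conTwo (ev e z ∘ₗ B) _ _ y).symm.trans ?_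
  rw [conTwo_toFun e c hy, LinearMap.comp_apply]

end PolyField
end

/-! ### Contractions of the bracket terms -/

section BracketTerms

variable {V : Type*} [AddCommGroup V] [Module ℂ V] (B : V →ₗ[ℂ] V →ₗ[ℂ] V)

theorem sum_mul_eps (χ : Spinor) (A : Fin 2) :
    ∑ a, χ a * eps A a = -spinPair χ (Pi.single A 1) := by
  fin_cases A <;> simp [eps, spinPair, Fin.sum_univ_two]

theorem spinPair_raise (χ ψ : Spinor) : spinPair (raise χ) (raise ψ) = spinPair χ ψ := by
  simp [spinPair, raise, eps, Fin.sum_univ_two]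
  ring

/-- `ε_{AB} ξ^A η^B ε^{CD} = ξ^C η^D - η^C ξ^D`. -/
theorem spinPair_smul_sub (P₀ P₁ y₀ y₁ : V) (ξ η : Spinor) :
    spinPair ξ η • (B P₀ y₁ - B P₁ y₀) =
      B (ξ 0 • P₀ + ξ 1 • P₁) (η 0 • y₀ + η 1 • y₁) -
        B (η 0 • P₀ + η 1 • P₁) (ξ 0 • y₀ + ξ 1 • y₁) := by
  simp only [spinPair, map_add, map_smul, LinearMap.add_apply, LinearMap.smul_apply]
  module

theorem con_sum {J : Type*} {n : ℕ} (u : Fin n → Spinor) (s : Finset J)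
    (T : J → (Fin n → Fin 2) → V) :
    (con u fun k => ∑ j ∈ s, T j k) = ∑ j ∈ s, con u (T j) := by
  rw [← map_sum]
  congr 1
  funext k
  rw [Finset.sum_apply]

theorem con_two {n : ℕ} (u : Fin (n + 2) → Spinor) (P : Fin 2 → Fin 2 → V)
    (Y : (Fin n → Fin 2) → V) :
    (con u fun k => B (P (k (Fin.last (n + 1))) (k (Fin.last n).castSucc))
        (Y fun s => k s.castSucc.castSucc)) =
      B (spBilin P (u (Fin.last (n + 1))) (u (Fin.last n).castSucc))
        (con (fun s => u s.castSucc.castSucc) Y) := by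
  simp only [con_snoc u, con_snoc (Fin.init u), Fin.snoc_last, Fin.snoc_castSucc, ← map_con,
    spBilin_apply, map_sum, map_smul, LinearMap.sum_apply, LinearMap.smul_apply, Finset.smul_sum,
    smul_smul]
  rfl

theorem sum_con_two (n : ℕ) (ξ η : Spinor) (P : Fin 2 → Fin 2 → V) (Y : (Fin n → Fin 2) → V) :
    ∑ j, (con (Function.update (fun _ => ξ) j η) fun k : Fin (n + 2) → Fin 2 =>
        B (P (k (Fin.last (n + 1))) (k (Fin.last n).castSucc)) (Y fun s => k s.castSucc.castSucc)) =
      B (spBilin P ξ η + spBilin P η ξ) (con (fun _ => ξ) Y) +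
        B (spBilin P ξ ξ) (∑ j, con (Function.update (fun _ => ξ) j η) Y) := by
  have h (j : Fin n) : (fun s : Fin n => Function.update (fun _ : Fin (n + 2) => ξ)
      j.castSucc.castSucc η s.castSucc.castSucc) = Function.update (fun _ => ξ) j η := by
    funext s
    simp only [Function.update_apply, Fin.castSucc_inj]
  have h1 : (fun s : Fin n => Function.update (fun _ : Fin (n + 2) => ξ)
      (Fin.last n).castSucc η s.castSucc.castSucc) = fun _ => ξ := by
    funext s
    rw [Function.update_of_ne ((Fin.castSucc_injective _).ne (Fin.castSucc_lt_last s).ne)]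
  have h2 : (fun s : Fin n => Function.update (fun _ : Fin (n + 2) => ξ)
      (Fin.last (n + 1)) η s.castSucc.castSucc) = fun _ => ξ := by
    funext s
    rw [Function.update_of_ne (Fin.castSucc_lt_last _).ne]
  simp only [con_two]
  rw [Fin.sum_univ_castSucc, Fin.sum_univ_castSucc, h1, h2, map_sum, map_add, LinearMap.add_apply]
  simp only [h, Function.update_self, Function.update_of_ne (Fin.castSucc_lt_last _).ne',
    Function.update_of_ne (Fin.castSucc_lt_last _).ne,
    Function.update_of_ne ((Fin.castSucc_injective _).ne (Fin.castSucc_lt_last _).ne')]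
  abel

theorem con_update_last {n : ℕ} (ξ w : Spinor) (Y : (Fin (n + 1) → Fin 2) → V) :
    con (Function.update (fun _ => ξ) (Fin.last n) w) Y =
      ∑ T, w T • con (fun _ => ξ) fun k => Y (Fin.snoc k T) := by
  rw [con_snoc, Function.update_self, Fin.init_update_last]
  rfl

/-- The contraction of `ε^{ST} B(P_{S k_{n+1}}, Y_{k_1 ⋯ k_n T})` with `ξ` in all indices,
multiplied by `ε_{AB} ξ^A η^B`. -/
theorem con_eps_pair {n : ℕ} (ξ η : Spinor) (P : Fin 2 → Fin 2 → V)
    (Y : (Fin (n + 1) → Fin 2) → V) :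
    spinPair ξ η • (con (fun _ => ξ) fun k : Fin (n + 1) → Fin 2 => ∑ S, ∑ T, eps S T •
        B (P S (k (Fin.last n))) (Y (Fin.snoc (Fin.init k) T))) =
      B (spBilin P ξ ξ) (con (Function.update (fun _ => ξ) (Fin.last n) η) Y) -
        B (spBilin P η ξ) (con (fun _ => ξ) Y) := by
  have h1 := con_update_last ξ ξ Y
  rw [Function.update_eq_self] at h1
  rw [h1, con_update_last]
  have h := spinPair_smul_sub B (∑ b, ξ b • P 0 b) (∑ b, ξ b • P 1 b)
    (con (fun _ => ξ) fun k : Fin n → Fin 2 => Y (Fin.snoc k 0))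
    (con (fun _ => ξ) fun k : Fin n → Fin 2 => Y (Fin.snoc k 1)) ξ η
  convert h using 2
  · have h2 (S T a : Fin 2) : (con (fun _ => ξ) fun k : Fin n → Fin 2 =>
        B (P S a) (Y (Fin.snoc k T))) = B (P S a) (con (fun _ => ξ) fun k => Y (Fin.snoc k T)) :=
      (map_con _ _ _).symm
    have h3 (a : Fin 2) : (con (Fin.init fun _ : Fin (n + 1) => ξ) fun k : Fin n → Fin 2 =>
        ∑ S, ∑ T, eps S T • B (P S ((Fin.snoc k a : Fin (n + 1) → Fin 2) (Fin.last n)))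
          (Y (Fin.snoc (Fin.init (Fin.snoc k a : Fin (n + 1) → Fin 2)) T))) =
        B (P 0 a) (con (fun _ => ξ) fun k => Y (Fin.snoc k 1)) -
          B (P 1 a) (con (fun _ => ξ) fun k => Y (Fin.snoc k 0)) := by
      rw [← h2, ← h2, ← map_sub]
      congr 1
      funext k
      simp [eps, Fin.sum_univ_two, sub_eq_add_neg]
    refine ((con_snoc _ _).trans
      (Finset.sum_congr rfl fun a _ => congrArg (fun x => ξ a • x) (h3 a))).trans ?_
    simp only [Fin.sum_univ_two, map_add, map_smul, LinearMap.add_apply, LinearMap.smul_apply]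
    module
  all_goals
    simp only [spBilin_apply, Fin.sum_univ_two, smul_add, smul_smul]

theorem con_mixed_pair {n : ℕ} (χ : Spinor) (P : Fin 2 → Fin 2 → V)
    (Y : (Fin (n + 1) → Fin 2) → V) :
    (con (fun _ => χ) fun k : Fin (n + 1) → Fin 2 => ∑ S,
        B (P S (k (Fin.last n))) (Y (Fin.snoc (Fin.init k) S))) =
      ∑ S, B (∑ b, χ b • P S b)
        (con (Function.update (fun _ => χ) (Fin.last n) (Pi.single S 1)) Y) := by
  have h2 (S a : Fin 2) : (con (fun _ => χ) fun k : Fin n → Fin 2 =>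
      B (P S a) (Y (Fin.snoc k S))) = B (P S a) (con (fun _ => χ) fun k => Y (Fin.snoc k S)) :=
    (map_con _ _ _).symm
  have h3 (a : Fin 2) : (con (Fin.init fun _ : Fin (n + 1) => χ) fun k : Fin n → Fin 2 =>
      ∑ S, B (P S ((Fin.snoc k a : Fin (n + 1) → Fin 2) (Fin.last n)))
        (Y (Fin.snoc (Fin.init (Fin.snoc k a : Fin (n + 1) → Fin 2)) S))) =
      ∑ S, B (P S a) (con (fun _ => χ) fun k => Y (Fin.snoc k S)) := by
    simp only [← h2, ← map_sum]
    congr 1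
    funext k
    simp
  refine ((con_snoc _ _).trans
    (Finset.sum_congr rfl fun a _ => congrArg (fun x => χ a • x) (h3 a))).trans ?_
  simp only [con_update_last, Fin.sum_univ_two, map_add, map_smul, LinearMap.add_apply,
    LinearMap.smul_apply]
  simp
  abel

theorem conFirst_eps (n : ℕ) (χ : Spinor) (F : (Fin n → Fin 2) → V) (K : ℕ → Fin 2) :
    conFirst (n + 1) (fun _ => χ) (fun K => eps (K (n + 2)) (K (n + 1)) • F (bold n K)) K =
      -spinPair χ (Pi.single (K (n + 2)) 1) • con (fun _ => χ) F := by
  have h (K : ℕ → Fin 2) : conFirst n (fun _ => χ)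
      (fun K => eps (K (n + 2)) (K (n + 1)) • F (bold n K)) K =
        eps (K (n + 2)) (K (n + 1)) • con (fun _ => χ) F := by
    rw [conFirst, ← con_smul_fun]
    simp only [bold_patch, patch_of_lt _ _ (show n < n + 1 by omega),
      patch_of_lt _ _ (show n < n + 2 by omega)]
  rw [conFirst_succ, ← sum_mul_eps, Finset.sum_smul]
  refine Finset.sum_congr rfl fun a _ => ?_
  change χ a • conFirst n (fun _ => χ) _ _ = _
  rw [h, smul_smul, Function.update_self, Function.update_of_ne (by omega)]

theorem bold_update {I : Type*} (n : ℕ) (K : ℕ → I) (a : I) :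
    bold (n + 1) (Function.update K (n + 1) a) = Fin.snoc (Fin.init (bold (n + 1) K)) a := by
  funext s
  refine Fin.lastCases ?_ (fun s => ?_) s
  · simp [bold]
  · rw [Fin.snoc_castSucc]
    simp only [bold, Fin.init, Fin.val_castSucc]
    rw [Function.update_of_ne (by omega)]

/-- The contraction of the first `m` unprimed indices with `ξ` and of the first `n` primed indices
with `χ`. -/
def conSeq (m n : ℕ) (ξ χ : Spinor) (T : (ℕ → Fin 2) → (ℕ → Fin 2) → V) (K K' : ℕ → Fin 2) : V :=
  conFirst m (fun _ => ξ) (fun K => conFirst n (fun _ => χ) (T K) K') K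

variable [Module ℝ V] [IsScalarTower ℝ ℂ V] (P : Fin 2 → Fin 2 → V) {m : ℕ}
  (X : (Fin (m + 2) → Fin 2) → (Fin m → Fin 2) → V) (ξ χ : Spinor) (K K' : ℕ → Fin 2)

theorem conSeq_symFirst (k m n : ℕ) (ξ χ : Spinor) (T : (ℕ → Fin 2) → (ℕ → Fin 2) → V)
    (K K' : ℕ → Fin 2) :
    conSeq m n ξ χ (fun K K' => symFirst k (fun K => T K K') K) K K' =
      conFirst m (fun _ => ξ) (symFirst k fun K => conFirst n (fun _ => χ) (T K) K') K := by
  simp only [conSeq, conFirst_comm_symFirst]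

/-! The terms of the two identities, contracted with `ξ` and `χ` in all indices except for
`K_{m+4}` and `K'_{m+2}` (or `K_{m+5}` and `K'_{m+3}`). An index which is not contracted becomes a
basis spinor `Pi.single _ 1`. -/

theorem conSeq_bracket_unprimed :
    conSeq (m + 3) (m + 1) ξ χ (fun K K' => symFirst (m + 4) (fun K => symFirst (m + 1)
      (fun K' => eps (K' (m + 2)) (K' (m + 1)) •
        B (P (K (m + 4)) (K (m + 3))) (X (bold (m + 2) K) (bold m K'))) K') K) K K' =
    -spinPair χ (Pi.single (K' (m + 2)) 1) • ((m : ℂ) + 4)⁻¹ •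
      (B (spBilin P ξ (Pi.single (K (m + 4)) 1) + spBilin P (Pi.single (K (m + 4)) 1) ξ)
        (conTwo (fun _ => ξ) (fun _ => χ) X) +
      B (spBilin P ξ ξ) (∑ j, conTwo (Function.update (fun _ => ξ) j (Pi.single (K (m + 4)) 1))
        (fun _ => χ) X)) := by
  rw [conSeq_symFirst]
  have h (K : ℕ → Fin 2) : conFirst (m + 1) (fun _ => χ) (symFirst (m + 1)
      (fun K' => eps (K' (m + 2)) (K' (m + 1)) •
        B (P (K (m + 4)) (K (m + 3))) (X (bold (m + 2) K) (bold m K')))) K' =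
      -spinPair χ (Pi.single (K' (m + 2)) 1) • B (P (K (m + 4)) (K (m + 3)))
        (con (fun _ => χ) (X (bold (m + 2) K))) := by
    rw [conFirst_symFirst]
    refine (conFirst_eps m χ
      (fun k => B (P (K (m + 4)) (K (m + 3))) (X (bold (m + 2) K) k)) K').trans ?_
    rw [map_con]
  have h' : (fun K => conFirst (m + 1) (fun _ => χ) (fun K' => symFirst (m + 1)
      (fun K' => eps (K' (m + 2)) (K' (m + 1)) •
        B (P (K (m + 4)) (K (m + 3))) (X (bold (m + 2) K) (bold m K'))) K') K') = _ :=
    funext h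
  rw [h', conFirst_symFirst_succ, smul_comm (-spinPair χ _) _]
  push_cast
  rw [show (m : ℂ) + 3 + 1 = m + 4 by ring]
  congr 1
  have h2 (j : Fin (m + 4)) := conFirst_bold (m + 4)
    (Function.update (fun _ => ξ) j (Pi.single (K (m + 4)) 1))
    (fun k => -spinPair χ (Pi.single (K' (m + 2)) 1) •
      B (P (k (Fin.last (m + 3))) (k (Fin.last (m + 2)).castSucc))
        (con (fun _ => χ) (X fun s => k s.castSucc.castSucc))) K
  refine (Finset.sum_congr rfl fun j _ => h2 j).trans ?_
  simp only [con_smul_fun, ← Finset.smul_sum]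
  congr 1
  exact sum_con_two B (m + 2) ξ _ P fun k => con (fun _ => χ) (X k)

theorem conSeq_bracket_conj (Xb : (Fin (m + 2) → Fin 2) → (Fin m → Fin 2) → V) :
    conSeq (m + 3) (m + 1) ξ χ (fun K K' => symFirst (m + 3) (fun K =>
      eps (K (m + 4)) (K (m + 3)) •
        B (P (K (m + 2)) (K (m + 1))) (Xb (bold (m + 2) K') (bold m K))) K) K K' =
    -spinPair ξ (Pi.single (K (m + 4)) 1) • B (spBilin P ξ ξ)
      (conTwo (Function.update (fun _ => χ) (Fin.last (m + 1)) (Pi.single (K' (m + 2)) 1))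
        (fun _ => ξ) Xb) := by
  rw [conSeq_symFirst, conFirst_symFirst]
  have h (K : ℕ → Fin 2) : conFirst (m + 1) (fun _ => χ) (fun K' => eps (K (m + 4)) (K (m + 3)) •
        B (P (K (m + 2)) (K (m + 1))) (Xb (bold (m + 2) K') (bold m K))) K' =
      eps (K (m + 4)) (K (m + 3)) • B (P (K (m + 2)) (K (m + 1)))
        (con (Function.update (fun _ => χ) (Fin.last (m + 1)) (Pi.single (K' (m + 2)) 1))
          fun k' => Xb k' (bold m K)) := by
    rw [conFirst_eq_succ]
    refine (conFirst_bold (m + 2) _ (fun k' => eps (K (m + 4)) (K (m + 3)) •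
        B (P (K (m + 2)) (K (m + 1))) (Xb k' (bold m K))) K').trans ?_
    rw [con_smul_fun, map_con]
  rw [funext h]
  refine (conFirst_eps (m + 2) ξ (fun k => B (P (k (Fin.last (m + 1))) (k (Fin.last m).castSucc))
    (con (Function.update (fun _ => χ) (Fin.last (m + 1)) (Pi.single (K' (m + 2)) 1))
      fun k' => Xb k' fun s => k s.castSucc.castSucc)) K).trans ?_
  congr 1
  refine (con_two B (fun _ => ξ) P fun k => con (Function.update (fun _ => χ) (Fin.last (m + 1))
    (Pi.single (K' (m + 2)) 1)) fun k' => Xb k' k).trans ?_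
  rw [con_comm]
  rfl

theorem conSeq_bracket_primed :
    conSeq (m + 3) (m + 1) ξ χ (fun K K' => symFirst (m + 3) (fun K => symFirst (m + 2)
      (fun K' => eps (K (m + 4)) (K (m + 3)) •
        B (P (K' (m + 2)) (K' (m + 1))) (X (bold (m + 2) K) (bold m K'))) K') K) K K' =
    -spinPair ξ (Pi.single (K (m + 4)) 1) • ((m : ℂ) + 2)⁻¹ •
      (B (spBilin P χ (Pi.single (K' (m + 2)) 1) + spBilin P (Pi.single (K' (m + 2)) 1) χ)
        (conTwo (fun _ => ξ) (fun _ => χ) X) +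
      B (spBilin P χ χ) (∑ j, conTwo (fun _ => ξ)
        (Function.update (fun _ => χ) j (Pi.single (K' (m + 2)) 1)) X)) := by
  rw [conSeq_symFirst, conFirst_symFirst]
  set δ : Spinor := Pi.single (K' (m + 2)) 1
  have h (K : ℕ → Fin 2) : conFirst (m + 1) (fun _ => χ) (symFirst (m + 2)
      (fun K' => eps (K (m + 4)) (K (m + 3)) •
        B (P (K' (m + 2)) (K' (m + 1))) (X (bold (m + 2) K) (bold m K')))) K' =
      eps (K (m + 4)) (K (m + 3)) • ((m : ℂ) + 2)⁻¹ •
        (B (spBilin P χ δ + spBilin P δ χ) (con (fun _ => χ) (X (bold (m + 2) K))) +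
          B (spBilin P χ χ)
            (∑ j, con (Function.update (fun _ => χ) j δ) (X (bold (m + 2) K)))) := by
    rw [conFirst_symFirst_succ, smul_comm (eps _ _) _]
    push_cast
    rw [show (m : ℂ) + 1 + 1 = m + 2 by ring]
    congr 1
    have h2 (j : Fin (m + 2)) := conFirst_bold (m + 2) (Function.update (fun _ => χ) j δ)
      (fun k => eps (K (m + 4)) (K (m + 3)) •
        B (P (k (Fin.last (m + 1))) (k (Fin.last m).castSucc))
          (X (bold (m + 2) K) fun s => k s.castSucc.castSucc)) K'
    refine (Finset.sum_congr rfl fun j _ => h2 j).trans ?_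
    simp only [con_smul_fun, ← Finset.smul_sum]
    congr 1
    exact sum_con_two B m χ _ P (X (bold (m + 2) K))
  have h' : (fun K => conFirst (m + 1) (fun _ => χ) (fun K' => symFirst (m + 2)
      (fun K' => eps (K (m + 4)) (K (m + 3)) •
        B (P (K' (m + 2)) (K' (m + 1))) (X (bold (m + 2) K) (bold m K'))) K') K') = _ :=
    funext h
  rw [h']
  refine (conFirst_eps (m + 2) ξ (fun k => ((m : ℂ) + 2)⁻¹ •
        (B (spBilin P χ δ + spBilin P δ χ) (con (fun _ => χ) (X k)) +
          B (spBilin P χ χ) (∑ j, con (Function.update (fun _ => χ) j δ) (X k)))) K).trans ?_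
  rw [con_smul_fun]
  congr 2
  refine (map_add (con fun _ => ξ) (fun k => B (spBilin P χ δ + spBilin P δ χ)
    (con (fun _ => χ) (X k))) fun k => B (spBilin P χ χ)
      (∑ j, con (Function.update (fun _ => χ) j δ) (X k))).trans ?_
  have h1 := map_con (B (spBilin P χ δ + spBilin P δ χ)) (fun _ => ξ) fun k =>
    con (fun _ => χ) (X k)
  have h2 := map_con (B (spBilin P χ χ)) (fun _ => ξ) fun k =>
    ∑ j, con (Function.update (fun _ => χ) j δ) (X k)
  rw [← h1, ← h2, con_sum]
  rfl

theorem con_eps_pair_two (η : Spinor) :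
    spinPair ξ η • (con (fun _ => ξ) fun k : Fin (m + 2) → Fin 2 =>
      con (fun _ => χ) fun k' => ∑ S, ∑ T, eps S T •
        B (P S (k (Fin.last (m + 1)))) (X (Fin.snoc (Fin.init k) T) k')) =
      B (spBilin P ξ ξ)
        (conTwo (Function.update (fun _ => ξ) (Fin.last (m + 1)) η) (fun _ => χ) X) -
        B (spBilin P η ξ) (conTwo (fun _ => ξ) (fun _ => χ) X) := by
  have h (k : Fin (m + 2) → Fin 2) : (con (fun _ => χ) fun k' => ∑ S, ∑ T, eps S T •
      B (P S (k (Fin.last (m + 1)))) (X (Fin.snoc (Fin.init k) T) k')) = ∑ S, ∑ T, eps S T •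
      B (P S (k (Fin.last (m + 1)))) (con (fun _ => χ) (X (Fin.snoc (Fin.init k) T))) := by
    simp only [con_sum, con_smul_fun, ← map_con]
  simp only [h]
  exact con_eps_pair B ξ η P fun k => con (fun _ => χ) (X k)

theorem conSeq_contract_unprimed :
    conSeq (m + 3) (m + 1) ξ χ (fun K K' => symFirst (m + 3) (fun K => symFirst (m + 1)
      (fun K' => (eps (K (m + 4)) (K (m + 3)) * eps (K' (m + 2)) (K' (m + 1))) •
        ∑ S, ∑ T, eps S T • B (P S (K (m + 2)))
          (X (bold (m + 2) (Function.update K (m + 2) T)) (bold m K'))) K') K) K K' =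
    spinPair χ (Pi.single (K' (m + 2)) 1) • (B (spBilin P ξ ξ)
        (conTwo (Function.update (fun _ => ξ) (Fin.last (m + 1)) (Pi.single (K (m + 4)) 1))
          (fun _ => χ) X) -
        B (spBilin P (Pi.single (K (m + 4)) 1) ξ) (conTwo (fun _ => ξ) (fun _ => χ) X)) := by
  rw [conSeq_symFirst, conFirst_symFirst, ← con_eps_pair_two]
  have h : (fun K => conFirst (m + 1) (fun _ => χ) (fun K' => symFirst (m + 1)
      (fun K' => (eps (K (m + 4)) (K (m + 3)) * eps (K' (m + 2)) (K' (m + 1))) •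
        ∑ S, ∑ T, eps S T • B (P S (K (m + 2)))
          (X (bold (m + 2) (Function.update K (m + 2) T)) (bold m K'))) K') K') =
      fun K => eps (K (m + 4)) (K (m + 3)) • (-spinPair χ (Pi.single (K' (m + 2)) 1) •
        con (fun _ => χ) fun k' => ∑ S, ∑ T, eps S T • B (P S (bold (m + 2) K (Fin.last (m + 1))))
          (X (Fin.snoc (Fin.init (bold (m + 2) K)) T) k')) := by
    funext K
    rw [conFirst_symFirst, smul_comm, ← con_smul_fun]
    refine Eq.trans ?_ (conFirst_eps m χ (fun k' => eps (K (m + 4)) (K (m + 3)) •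
      ∑ S, ∑ T, eps S T • B (P S (bold (m + 2) K (Fin.last (m + 1))))
          (X (Fin.snoc (Fin.init (bold (m + 2) K)) T) k')) K')
    congr 1
    funext K'
    simp only [← bold_update, smul_smul, mul_comm]
    rfl
  rw [h]
  refine (conFirst_eps (m + 2) ξ (fun k => -spinPair χ (Pi.single (K' (m + 2)) 1) •
    con (fun _ => χ) fun k' => ∑ S, ∑ T, eps S T • B (P S (k (Fin.last (m + 1))))
      (X (Fin.snoc (Fin.init k) T) k')) K).trans ?_
  rw [con_smul_fun, smul_smul, smul_smul, neg_mul_neg, mul_comm]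

theorem conSeq_wave_unprimed (η : Spinor) :
    spinPair ξ η • conSeq (m + 2) m ξ χ (fun K K' => symFirst (m + 2) (fun K =>
        ∑ S, ∑ T, eps S T • B (P S (K (m + 2)))
          (X (bold (m + 2) (Function.update K (m + 2) T)) (bold m K'))) K) K K' =
    B (spBilin P ξ ξ)
        (conTwo (Function.update (fun _ => ξ) (Fin.last (m + 1)) η) (fun _ => χ) X) -
        B (spBilin P η ξ) (conTwo (fun _ => ξ) (fun _ => χ) X) := by
  rw [conSeq_symFirst, conFirst_symFirst, ← con_eps_pair_two]
  congr 1
  simp only [bold_update]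
  refine Eq.trans ?_ (conFirst_bold (m + 2) (fun _ => ξ) (fun k => con (fun _ => χ) fun k' =>
    ∑ S, ∑ T, eps S T • B (P S (k (Fin.last (m + 1)))) (X (Fin.snoc (Fin.init k) T) k')) K)
  congr 1
  funext K
  exact conFirst_bold m (fun _ => χ) (fun k' => ∑ S, ∑ T, eps S T •
    B (P S (bold (m + 2) K (Fin.last (m + 1)))) (X (Fin.snoc (Fin.init (bold (m + 2) K)) T) k')) K'

variable (Z : (Fin (m + 3) → Fin 2) → (Fin (m + 1) → Fin 2) → V)

theorem con_mixed_pair_two :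
    (con (fun _ => ξ) fun k => con (fun _ => χ) fun k' : Fin (m + 1) → Fin 2 => ∑ S,
        B (P S (k' (Fin.last m))) (Z k (Fin.snoc (Fin.init k') S))) =
      ∑ S, B (∑ b, χ b • P S b) (conTwo (fun _ => ξ)
        (Function.update (fun _ => χ) (Fin.last m) (Pi.single S 1)) Z) := by
  have h (k : Fin (m + 3) → Fin 2) := con_mixed_pair B χ P (Z k)
  rw [funext h, con_sum]
  exact Finset.sum_congr rfl fun S _ => (map_con _ _ _).symm

theorem conSeq_contract_primed :
    conSeq (m + 4) (m + 2) ξ χ (fun K K' => symFirst (m + 4) (fun K => symFirst (m + 2)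
      (fun K' => (eps (K' (m + 3)) (K' (m + 2)) * eps (K (m + 5)) (K (m + 4))) •
        ∑ S, B (P S (K' (m + 1)))
          (Z (bold (m + 3) K) (bold (m + 1) (Function.update K' (m + 1) S)))) K') K) K K' =
    (spinPair ξ (Pi.single (K (m + 5)) 1) * spinPair χ (Pi.single (K' (m + 3)) 1)) •
      ∑ S, B (∑ b, χ b • P S b) (conTwo (fun _ => ξ)
        (Function.update (fun _ => χ) (Fin.last m) (Pi.single S 1)) Z) := by
  rw [conSeq_symFirst, conFirst_symFirst, ← con_mixed_pair_two]
  have h : (fun K => conFirst (m + 2) (fun _ => χ) (fun K' => symFirst (m + 2)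
      (fun K' => (eps (K' (m + 3)) (K' (m + 2)) * eps (K (m + 5)) (K (m + 4))) •
        ∑ S, B (P S (K' (m + 1)))
          (Z (bold (m + 3) K) (bold (m + 1) (Function.update K' (m + 1) S)))) K') K') =
      fun K => eps (K (m + 5)) (K (m + 4)) • (-spinPair χ (Pi.single (K' (m + 3)) 1) •
        con (fun _ => χ) fun k' : Fin (m + 1) → Fin 2 => ∑ S,
          B (P S (k' (Fin.last m))) (Z (bold (m + 3) K) (Fin.snoc (Fin.init k') S))) := by
    funext K
    rw [conFirst_symFirst, smul_comm, ← con_smul_fun]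
    refine Eq.trans ?_ (conFirst_eps (m + 1) χ (fun k' => eps (K (m + 5)) (K (m + 4)) •
      ∑ S, B (P S (k' (Fin.last m))) (Z (bold (m + 3) K) (Fin.snoc (Fin.init k') S))) K')
    congr 1
    funext K'
    simp only [← bold_update, smul_smul]
    rfl
  rw [h]
  refine (conFirst_eps (m + 3) ξ (fun k => -spinPair χ (Pi.single (K' (m + 3)) 1) •
    con (fun _ => χ) fun k' : Fin (m + 1) → Fin 2 => ∑ S,
      B (P S (k' (Fin.last m))) (Z k (Fin.snoc (Fin.init k') S))) K).trans ?_
  rw [con_smul_fun, smul_smul, neg_mul_neg]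

theorem conSeq_wave_primed :
    conSeq (m + 3) (m + 1) ξ χ (fun K K' => symFirst (m + 1) (fun K' =>
        ∑ S, B (P S (K' (m + 1)))
          (Z (bold (m + 3) K) (bold (m + 1) (Function.update K' (m + 1) S)))) K') K K' =
      ∑ S, B (∑ b, χ b • P S b) (conTwo (fun _ => ξ)
        (Function.update (fun _ => χ) (Fin.last m) (Pi.single S 1)) Z) := by
  rw [← con_mixed_pair_two, conSeq]
  refine Eq.trans ?_ (conFirst_bold (m + 3) (fun _ => ξ) (fun k => con (fun _ => χ)
    fun k' : Fin (m + 1) → Fin 2 => ∑ S,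
      B (P S (k' (Fin.last m))) (Z k (Fin.snoc (Fin.init k') S))) K)
  congr 1
  funext K
  rw [conFirst_symFirst]
  simp only [bold_update]
  exact conFirst_bold (m + 1) (fun _ => χ) (fun k' : Fin (m + 1) → Fin 2 => ∑ S,
      B (P S (k' (Fin.last m))) (Z (bold (m + 3) K) (Fin.snoc (Fin.init k') S))) K'

end BracketTerms

/-! ### The contracted identities for the symmetrized variables -/

theorem raise_update {n : ℕ} (χ w : Spinor) (l : Fin n) :
    (fun s => raise (Function.update (fun _ => χ) l w s)) =
      Function.update (fun _ => raise χ) l (raise w) := by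
  funext s
  simp only [Function.update_apply]
  split_ifs <;> rfl

theorem conTwo_update_last {V : Type*} [AddCommGroup V] [Module ℂ V] {m n : ℕ}
    (u : Fin m → Spinor) (ζ w : Spinor) (T : (Fin m → Fin 2) → (Fin (n + 1) → Fin 2) → V) :
    conTwo u (Function.update (fun _ => ζ) (Fin.last n) w) T =
      w 0 • conTwo u (Function.update (fun _ => ζ) (Fin.last n) (Pi.single 0 1)) T +
      w 1 • conTwo u (Function.update (fun _ => ζ) (Fin.last n) (Pi.single 1 1)) T := by
  simp only [conTwo, con_update_last, Fin.sum_univ_two, ← con_smul_fun, ← map_add]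
  congr 1
  funext k
  simp

section ConSeq

variable {V : Type*} [AddCommGroup V] [Module ℂ V] {m n : ℕ} {ξ χ : Spinor} {K K' : ℕ → Fin 2}

theorem conSeq_add (S T : (ℕ → Fin 2) → (ℕ → Fin 2) → V) :
    conSeq m n ξ χ (fun K K' => S K K' + T K K') K K' =
      conSeq m n ξ χ S K K' + conSeq m n ξ χ T K K' := by
  simp only [conSeq, conFirst, con_apply, smul_add, Finset.sum_add_distrib]

theorem conSeq_sub (S T : (ℕ → Fin 2) → (ℕ → Fin 2) → V) :
    conSeq m n ξ χ (fun K K' => S K K' - T K K') K K' =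
      conSeq m n ξ χ S K K' - conSeq m n ξ χ T K K' := by
  simp only [conSeq, conFirst, con_apply, smul_sub, Finset.sum_sub_distrib]

theorem conSeq_smul [Module ℝ V] [IsScalarTower ℝ ℂ V] (r : ℝ)
    (T : (ℕ → Fin 2) → (ℕ → Fin 2) → V) :
    conSeq m n ξ χ (fun K K' => r • T K K') K K' = (r : ℂ) • conSeq m n ξ χ T K K' := by
  simp only [conSeq, conFirst, con_apply, ← algebraMap_smul ℂ r, Complex.coe_algebraMap,
    smul_comm _ (r : ℂ), ← Finset.smul_sum]

theorem map_conSeq {V' : Type*} [AddCommGroup V'] [Module ℂ V'] (f : V →ₗ[ℂ] V')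
    (T : (ℕ → Fin 2) → (ℕ → Fin 2) → V) :
    f (conSeq m n ξ χ T K K') = conSeq m n ξ χ (fun K K' => f (T K K')) K K' := by
  simp only [conSeq, conFirst, map_con]

/-- To show that an expression symmetric in `K_1, …, K_m` and in `K'_1, …, K'_n` lies in a subspace,
it suffices to contract these indices with spinors `(1, τ)` and `(1, τ')`. -/
theorem mem_of_conSeq_mem (W : Submodule ℂ V) (T : (ℕ → Fin 2) → (ℕ → Fin 2) → V)
    (hK : ∀ K K' k (s : Equiv.Perm (Fin m)), T (patch m (k ∘ s) K) K' = T (patch m k K) K')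
    (hK' : ∀ K K' k (s : Equiv.Perm (Fin n)), T K (patch n (k ∘ s) K') = T K (patch n k K'))
    (K K' : ℕ → Fin 2) (h : ∀ τ τ' : ℂ, conSeq m n ![1, τ] ![1, τ'] T K K' ∈ W) : T K K' ∈ W := by
  have h1 := mem_of_con_mem W (fun k => T (patch m k K) K') (fun k s => hK K K' k s) (fun τ => ?_)
    (bold m K)
  · rwa [patch_bold] at h1
  · have h2 := mem_of_con_mem W
      (fun k' => conFirst m (fun _ => ![1, τ]) (fun K => T K (patch n k' K')) K)
      (fun k s => by simp only [hK']) (fun τ' => ?_) (bold n K')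
    · rw [patch_bold] at h2
      exact h2
    · have := h τ τ'
      change (con _ fun k => con _ fun l => T (patch m k K) (patch n l K')) ∈ W at this
      rw [con_comm] at this
      exact this

end ConSeq

section

variable {ι : Type*} [Fintype ι] {𝔤 : Type*} [LieRing 𝔤] [LieAlgebra ℝ 𝔤]
  (e : Module.Basis ι ℝ 𝔤) (c : ℝ)

/-- The bracket on components as a bilinear map. -/
def brB : (ι → ℂ) →ₗ[ℂ] (ι → ℂ) →ₗ[ℂ] (ι → ℂ) :=
  LinearMap.mk₂ ℂ (br e) (br_add_left e)
    (fun r X Y => by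
      funext α
      simp only [br, Pi.smul_apply, smul_eq_mul, Finset.mul_sum, mul_smul_comm, mul_assoc])
    (br_add_right e) (fun r X Y => br_smul_right e r X Y)

namespace PolyField

theorem brB_ev (x y : PolyField e) (z : Jet ι) : brB e (ev e z x) (ev e z y) = ev e z ⁅x, y⁆ := rfl

variable (m : ℕ) (z : Jet ι) (ξ η χ ψ : Spinor) (K K' : ℕ → Fin 2)

theorem phiFin_con_const :
    conTwo (fun _ => ξ) (fun _ => χ) (fun K K' => phiFin c e m K K' z) =
      ev e z ((((gauge e c).nab ξ (raise χ)) ^ m) ((gauge e c).Φ ξ ξ)) := by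
  rw [conTwo_phiFin]
  exact (isCurvTensor_phiLow e c m z).con_const ξ (raise χ)

theorem phiFin_sum_left :
    ∑ j, conTwo (Function.update (fun _ => ξ) j η) (fun _ => χ) (fun K K' => phiFin c e m K K' z) =
      ev e z ((gauge e c).polQ ξ η (raise χ) m) := by
  simp only [conTwo_phiFin]
  exact (isCurvTensor_phiLow e c m z).sum_con_left ξ η (raise χ)

theorem phiFin_con_left (j : Fin (m + 2)) :
    conTwo (Function.update (fun _ => ξ) j η) (fun _ => χ) (fun K K' => phiFin c e m K K' z) =
      ((m : ℂ) + 2)⁻¹ • ev e z ((gauge e c).polQ ξ η (raise χ) m) := by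
  rw [conTwo_phiFin]
  exact (isCurvTensor_phiLow e c m z).con_left ξ η (raise χ) j

theorem phiFin_sum_right :
    ∑ l, conTwo (fun _ => ξ) (Function.update (fun _ => χ) l ψ) (fun K K' => phiFin c e m K K' z) =
      ev e z ((gauge e c).polV ξ (raise χ) (raise ψ) m) := by
  simp only [conTwo_phiFin, raise_update]
  exact (isCurvTensor_phiLow e c m z).sum_con_right ξ (raise χ) (raise ψ)

theorem phiFin_con_both (j : Fin (m + 1 + 2)) (l : Fin (m + 1)) :
    conTwo (Function.update (fun _ => ξ) j η) (Function.update (fun _ => χ) l ψ)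
      (fun K K' => phiFin c e (m + 1) K K' z) =
      (((m : ℂ) + 1) * ((m : ℂ) + 3))⁻¹ •
        ev e z ((gauge e c).polU ξ η (raise χ) (raise ψ) (m + 1)) := by
  rw [conTwo_phiFin, raise_update]
  exact (isCurvTensor_phiLow e c (m + 1) z).con_both ξ η (raise χ) (raise ψ) j l

theorem phiBarFin_con_left (j : Fin (m + 2)) :
    conTwo (Function.update (fun _ => χ) j ψ) (fun _ => ξ)
      (fun K' K => phiBarFin e c m K' K z) =
      ((m : ℂ) + 2)⁻¹ • ev e z ((gauge e c).dual.polQ (raise χ) (raise ψ) ξ m) := by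
  rw [conTwo_phiBarFin, raise_update]
  exact (isCurvTensor_conj_phiLow e c m z).con_left (raise χ) (raise ψ) ξ j

theorem phi2_contract :
    brB e (spBilin (fun I J => phi2 c e I J z) ξ ξ)
        (conTwo (Function.update (fun _ => ξ) (Fin.last (m + 1)) η) (fun _ => χ)
          fun K K' => phiFin c e m K K' z) -
      brB e (spBilin (fun I J => phi2 c e I J z) η ξ)
        (conTwo (fun _ => ξ) (fun _ => χ) fun K K' => phiFin c e m K K' z) =
    ev e z ((gauge e c).brUnprimed ξ η (raise χ) m) := by
  rw [phiFin_con_left, phiFin_con_const, spBilin_phi2, spBilin_phi2, map_smul, brB_ev, brB_ev,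
    SpinorGauge.brUnprimed, map_sub, map_smul]

/-- The contraction of the primed indices of the two curvature factors; `spinPair (raise χ) θ` is
the factor `ε_{A'B'} ζ^{A'} θ^{B'}` of `brPrimed`, with `ζ = raise χ`. -/
theorem phiBar2_contract (θ : Spinor) :
    spinPair (raise χ) θ • ∑ S, brB e (∑ b, χ b • phiBar2Mix c e S b z)
      (conTwo (fun _ => ξ) (Function.update (fun _ => χ) (Fin.last m) (Pi.single S 1))
        fun K K' => phiFin c e (m + 1) K K' z) =
    ev e z ((gauge e c).brPrimed ξ (raise χ) θ (m + 1)) := by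
  have hT := isCurvTensor_phiLow e c (m + 1) z
  have h0 : raise (Pi.single 0 1) = Pi.single 1 1 := by
    funext a
    fin_cases a <;> simp [raise, eps]
  have h1 : raise (Pi.single 1 1) = -Pi.single 0 1 := by
    funext a
    fin_cases a <;> simp [raise, eps]
  have h2 := hT.con_const ξ (raise χ)
  have h3 := hT.con_right ξ (raise χ) θ (Fin.last m)
  rw [← Function.update_eq_self (Fin.last m) (fun _ : Fin (m + 1) => raise χ),
    conTwo_update_last] at h2
  rw [conTwo_update_last] at h3
  have h4 := spinPair_smul_sub (brB e) (ev e z ((gauge e c).Φb (Pi.single 0 1) (raise χ)))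
    (ev e z ((gauge e c).Φb (Pi.single 1 1) (raise χ))) (conTwo (fun _ => ξ)
      (Function.update (fun _ => raise χ) (Fin.last m) (Pi.single 0 1)) fun K K' =>
        phiLow c e (m + 1) K K' z) (conTwo (fun _ => ξ)
      (Function.update (fun _ => raise χ) (Fin.last m) (Pi.single 1 1)) fun K K' =>
        phiLow c e (m + 1) K K' z) (raise χ) θ
  have h5 (w : Spinor) : w 0 • ev e z ((gauge e c).Φb (Pi.single 0 1) (raise χ)) +
      w 1 • ev e z ((gauge e c).Φb (Pi.single 1 1) (raise χ)) =
      ev e z ((gauge e c).Φb w (raise χ)) := by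
    have : w = w 0 • Pi.single 0 1 + w 1 • Pi.single 1 1 := by
      funext a
      fin_cases a <;> simp
    conv_rhs => rw [this]
    simp only [map_add, map_smul, LinearMap.add_apply, LinearMap.smul_apply]
  rw [h5, h5] at h4
  have h6 (w : Spinor) : conTwo (fun _ => ξ) (Function.update (fun _ => raise χ) (Fin.last m) (-w))
      (fun K K' => phiLow c e (m + 1) K K' z) = -conTwo (fun _ => ξ)
        (Function.update (fun _ => raise χ) (Fin.last m) w)
          (fun K K' => phiLow c e (m + 1) K K' z) := by
    rw [conTwo_update_last, conTwo_update_last _ _ w, Pi.neg_apply, Pi.neg_apply]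
    module
  simp only [sum_phiBar2Mix]
  simp only [conTwo_phiFin, raise_update, Fin.sum_univ_two, h0, h1, h6, map_neg,
    ← sub_eq_add_neg]
  rw [h4, h2, h3, map_smul, brB_ev, brB_ev, SpinorGauge.brPrimed, map_sub, map_smul]
  push_cast
  rfl

end PolyField

end

section

variable {ι : Type*} [Fintype ι] {𝔤 : Type*} [LieRing 𝔤] [LieAlgebra ℝ 𝔤]
  (e : Module.Basis ι ℝ 𝔤) (c : ℝ)

/-! ### Smooth functions of the symmetrized variables -/

/-- The functions which agree on the solution manifold `ℛ^{m+1}` with smooth functions of the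
symmetrized variables of order less than `m`. -/
def smoothPhi (m : ℕ) : Submodule ℂ (Jet ι → ι → ℂ) where
  carrier := {g | ∃ Ψ : PhiVars ι m → ι → ℂ, ContDiff ℝ ∞ Ψ ∧
    ∀ z ∈ solutionManifold e (m + 1), g z = Ψ (phiVars c e m z)}
  add_mem' := by
    rintro f g ⟨Ψ, hΨ, hf⟩ ⟨Θ, hΘ, hg⟩
    exact ⟨_, hΨ.add hΘ, fun z hz => congrArg₂ (· + ·) (hf z hz) (hg z hz)⟩
  zero_mem' := ⟨0, contDiff_const, fun _ _ => rfl⟩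
  smul_mem' := by
    rintro r f ⟨Ψ, hΨ, hf⟩
    exact ⟨_, hΨ.const_smul r, fun z hz => congrArg (r • ·) (hf z hz)⟩

variable {e c} in
theorem smoothPhi_br {m : ℕ} {f g : Jet ι → ι → ℂ} (hf : f ∈ smoothPhi e c m)
    (hg : g ∈ smoothPhi e c m) : (fun z => br e (f z) (g z)) ∈ smoothPhi e c m := by
  obtain ⟨Ψ, hΨ, hf⟩ := hf
  obtain ⟨Θ, hΘ, hg⟩ := hg
  refine ⟨fun y => br e (Ψ y) (Θ y), ?_, fun z hz => by beta_reduce; rw [hf z hz, hg z hz]⟩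
  rw [contDiff_pi] at hΨ hΘ ⊢
  exact fun α => ContDiff.sum fun β _ => ContDiff.sum fun γ _ =>
    ((hΨ β).mul (hΘ γ)).const_smul _

variable {e c} in
theorem smoothPhi_conj {m : ℕ} {f : Jet ι → ι → ℂ} (hf : f ∈ smoothPhi e c m) :
    (fun z => PolyField.conjVec ι (f z)) ∈ smoothPhi e c m := by
  obtain ⟨Ψ, hΨ, hf⟩ := hf
  refine ⟨fun y => PolyField.conjVec ι (Ψ y), ?_, fun z hz => by beta_reduce; rw [hf z hz]⟩
  rw [contDiff_pi] at hΨ ⊢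
  exact fun α => Complex.conjCLE.contDiff.comp (hΨ α)

namespace PolyField

theorem smoothPhi_pow_curv {m q : ℕ} (hq : q < m) (u v : Spinor) :
    toFun ((((gauge e c).nab u v) ^ q) ((gauge e c).Φ u u)) ∈ smoothPhi e c m := by
  have hv : raise ![v 1, -v 0] = v := by
    funext a
    fin_cases a <;> simp [raise, eps]
  refine ⟨fun y => conTwo (fun _ => u) (fun _ => ![v 1, -v 0]) (y (⟨q, hq⟩ : Fin m)), ?_,
    fun z _ => ?_⟩
  · simp only [conTwo, con_apply]
    have h1 : ContDiff ℝ ∞ fun y : PhiVars ι m => y ⟨q, hq⟩ :=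
      contDiff_pi.1 contDiff_id (⟨q, hq⟩ : Fin m)
    have h2 (k) : ContDiff ℝ ∞ fun y : PhiVars ι m => y ⟨q, hq⟩ k := contDiff_pi.1 h1 k
    exact ContDiff.sum fun k _ => (ContDiff.sum fun l _ =>
      (contDiff_pi.1 (h2 k) l).const_smul _).const_smul _
  · have h := phiFin_con_const e c q z u ![v 1, -v 0]
    rw [hv] at h
    exact h.symm

theorem conjVec_smul (r : ℂ) (X : ι → ℂ) : conjVec ι (r • X) = starRingEnd ℂ r • conjVec ι X := by
  funext α
  simp [conjVec_apply]

theorem ev_pow_curvBar (q : ℕ) (u v : Spinor) (z : Jet ι) :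
    ev e z ((((gauge e c).nab u v) ^ q) ((gauge e c).Φb v v)) =
      conjVec ι (ev e z ((((gauge e c).nab (fun a => starRingEnd ℂ (v a))
        fun a => starRingEnd ℂ (u a)) ^ q) ((gauge e c).Φ (fun a => starRingEnd ℂ (v a))
          fun a => starRingEnd ℂ (v a)))) := by
  refine ((isCurvTensor_conj_phiLow e c q z).con_const v u).symm.trans ?_
  rw [← (isCurvTensor_phiLow e c q z).con_const]
  simp only [conTwo, con_apply, map_sum, conjVec_smul, map_prod, Complex.conj_conj]

/-- The symmetrized derivatives of `Φ̄` are the conjugates of those of `Φ`. -/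
theorem smoothPhi_pow_curvBar {m q : ℕ} (hq : q < m) (u v : Spinor) :
    toFun ((((gauge e c).nab u v) ^ q) ((gauge e c).Φb v v)) ∈ smoothPhi e c m := by
  convert smoothPhi_conj (smoothPhi_pow_curv e c hq (fun a => starRingEnd ℂ (v a))
    fun a => starRingEnd ℂ (u a)) using 1
  funext z
  exact ev_pow_curvBar e c q u v z

theorem ev_eq_zero_of_mem_eqIdeal {m : ℕ} {x : PolyField e} (hx : x ∈ eqIdeal e (m + 2))
    {z : Jet ι} (hz : z ∈ solutionManifold e (m + 1)) : ev e z x = 0 := by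
  change x ∈ LieSubmodule.lieSpan ℂ (PolyField e) _ at hx
  induction hx using LieSubmodule.lieSpan_induction with
  | mem x hx =>
    obtain ⟨k, i, hk, rfl⟩ := hx
    have h := hz k.length (by omega) k.get i
    rw [covs, List.ofFn_get] at h
    rw [ev_apply, toFun_covs_divF]
    funext α
    simp [toComplex, h]
  | zero => exact map_zero _
  | add x y _ _ hx hy => rw [map_add, hx, hy, add_zero]
  | smul r x _ hx => rw [map_smul, hx, smul_zero]
  | lie x y _ hy => rw [← brB_ev, hy, map_zero]

theorem smoothPhi_of_mem_symLow {m : ℕ} {x : PolyField e} (hx : x ∈ (gauge e c).symLow m) :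
    toFun x ∈ smoothPhi e c m := by
  obtain ⟨a, ha, j, hj, rfl⟩ := Submodule.mem_sup.1 hx
  rw [map_add]
  refine add_mem ?_ ⟨0, contDiff_const, fun z hz => ev_eq_zero_of_mem_eqIdeal e hj hz⟩
  clear hx
  change a ∈ LieSubalgebra.lieSpan ℂ (PolyField e) _ at ha
  induction ha using LieSubalgebra.lieSpan_induction with
  | mem x hx =>
    obtain ⟨q, hq, u, v, rfl | rfl⟩ := hx
    · exact smoothPhi_pow_curv e c hq u v
    · exact smoothPhi_pow_curvBar e c hq u v
  | zero =>
    rw [map_zero]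
    exact zero_mem _
  | add x y _ _ hx hy =>
    rw [map_add]
    exact add_mem hx hy
  | smul r x _ hx =>
    rw [map_smul]
    exact Submodule.smul_mem _ r hx
  | lie x y _ _ hx hy => exact smoothPhi_br hx hy

/-- An equality modulo `Low m` holds on the solution manifold up to a smooth function of the
symmetrized variables of order less than `m`. -/
theorem smoothPhi_of_mkQ_eq {m : ℕ} {x y : PolyField e}
    (h : ((gauge e c).Low m).mkQ x = ((gauge e c).Low m).mkQ y) :
    toFun (x - y) ∈ smoothPhi e c m :=
  smoothPhi_of_mem_symLow e c ((gauge e c).low_le_symLow m ((gauge e c).mkQ_eq.1 h))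

/-! ### The covariant derivative and the wave operator on the symmetrized variables -/

variable (m : ℕ) (z : Jet ι) (ξ χ : Spinor) (K K' : ℕ → Fin 2)

theorem conSeq_covUp :
    conSeq (m + 2) m ξ χ (fun K K' => covUp c e (K (m + 3)) (K' (m + 1)) (phi c e m K K') z) K K' =
      ev e z ((gauge e c).nab (Pi.single (K (m + 3)) 1) (raise (Pi.single (K' (m + 1)) 1))
        ((((gauge e c).nab ξ (raise χ)) ^ m) ((gauge e c).Φ ξ ξ))) := by
  rw [← conTwo_covUp]
  simp only [conSeq, conFirst, phi, bold_patch, patch_of_lt _ _ (show m + 2 < m + 3 by omega),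
    patch_of_lt _ _ (show m < m + 1 by omega)]
  rfl

theorem conSeq_phi_succ :
    conSeq (m + 2) m ξ χ (fun K K' => phi c e (m + 1) K K' z) K K' =
      (((m : ℂ) + 1) * ((m : ℂ) + 3))⁻¹ • ev e z ((gauge e c).polU ξ (Pi.single (K (m + 3)) 1)
        (raise χ) (raise (Pi.single (K' (m + 1)) 1)) (m + 1)) := by
  rw [← phiFin_con_both e c m z ξ _ χ _ (Fin.last (m + 2)) (Fin.last m), conSeq, conFirst_eq_succ]
  refine Eq.trans ?_ (conFirst_bold (m + 3) _ (fun k => con _ (phiFin c e (m + 1) k · z)) K)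
  congr 1
  funext K
  rw [conFirst_eq_succ]
  exact conFirst_bold (m + 1) _ (fun k => phiFin c e (m + 1) (bold (m + 3) K) k z) K'

theorem conSeq_term_unprimed :
    conSeq (m + 3) (m + 1) ξ χ (fun K K' => symFirst (m + 4) (fun K => symFirst (m + 1)
      (fun K' => eps (K' (m + 2)) (K' (m + 1)) •
        br e (phi2 c e (K (m + 4)) (K (m + 3)) z) (phi c e m K K' z)) K') K) K K' =
    ev e z ((-spinPair (raise χ) (raise (Pi.single (K' (m + 2)) 1)) / ((m : ℂ) + 1 + 3)) •
      ((2 : ℂ) • ⁅(gauge e c).Φ (Pi.single (K (m + 4)) 1) ξ,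
        (((gauge e c).nab ξ (raise χ)) ^ m) ((gauge e c).Φ ξ ξ)⁆ +
      ⁅(gauge e c).Φ ξ ξ,
        (gauge e c).polQ ξ (Pi.single (K (m + 4)) 1) (raise χ) m⁆)) := by
  refine (conSeq_bracket_unprimed (brB e) (fun I J => phi2 c e I J z)
    (fun K K' => phiFin c e m K K' z) ξ χ K K').trans ?_
  rw [phiFin_con_const, phiFin_sum_left, spBilin_phi2, spBilin_phi2, spBilin_phi2, ← map_add,
    brB_ev, brB_ev, spinPair_raise, (gauge e c).Φ_symm ξ (Pi.single _ 1), ← map_add, ← map_smul,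
    ← map_smul, ← two_smul ℂ, smul_lie, smul_smul]
  congr 2
  ring

theorem conSeq_term_conj :
    conSeq (m + 3) (m + 1) ξ χ (fun K K' => symFirst (m + 3) (fun K =>
      eps (K (m + 4)) (K (m + 3)) •
        br e (phi2 c e (K (m + 2)) (K (m + 1)) z) (phiBar c e m K' K z)) K) K K' =
    ev e z ((-spinPair ξ (Pi.single (K (m + 4)) 1) / ((m : ℂ) + 1 + 1)) •
      ⁅(gauge e c).Φ ξ ξ,
        (gauge e c).dual.polQ (raise χ) (raise (Pi.single (K' (m + 2)) 1)) ξ m⁆) := by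
  simp only [phiBar_eq]
  refine (conSeq_bracket_conj (brB e) (fun I J => phi2 c e I J z) ξ χ K K'
    (fun K' K => phiBarFin e c m K' K z)).trans ?_
  rw [phiBarFin_con_left, spBilin_phi2, map_smul, brB_ev, ← map_smul, ← map_smul, smul_smul]
  congr 2
  ring

theorem conSeq_term_primed :
    conSeq (m + 3) (m + 1) ξ χ (fun K K' => symFirst (m + 3) (fun K => symFirst (m + 2)
      (fun K' => eps (K (m + 4)) (K (m + 3)) •
        br e (phiBar2Up c e (K' (m + 2)) (K' (m + 1)) z) (phi c e m K K' z)) K') K) K K' =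
    ev e z ((-spinPair ξ (Pi.single (K (m + 4)) 1) / ((m : ℂ) + 1 + 1)) •
      ((2 : ℂ) • ⁅(gauge e c).Φb (raise (Pi.single (K' (m + 2)) 1)) (raise χ),
        (((gauge e c).nab ξ (raise χ)) ^ m) ((gauge e c).Φ ξ ξ)⁆ +
      ⁅(gauge e c).Φb (raise χ) (raise χ),
        (gauge e c).polV ξ (raise χ) (raise (Pi.single (K' (m + 2)) 1)) m⁆)) := by
  refine (conSeq_bracket_primed (brB e) (fun I J => phiBar2Up c e I J z)
    (fun K K' => phiFin c e m K K' z) ξ χ K K').trans ?_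
  rw [phiFin_con_const, phiFin_sum_right, spBilin_phiBar2Up, spBilin_phiBar2Up, spBilin_phiBar2Up,
    ← map_add, brB_ev, brB_ev, (gauge e c).Φb_symm (raise χ) (raise (Pi.single _ 1)), ← map_add,
    ← map_smul, ← map_smul, ← two_smul ℂ, smul_lie, smul_smul]
  congr 2
  ring

theorem conSeq_term_contract_unprimed :
    conSeq (m + 3) (m + 1) ξ χ (fun K K' => symFirst (m + 3) (fun K => symFirst (m + 1)
      (fun K' => (eps (K (m + 4)) (K (m + 3)) * eps (K' (m + 2)) (K' (m + 1))) •
        ∑ S, ∑ T, eps S T • br e (phi2 c e S (K (m + 2)) z)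
          (phi c e m (Function.update K (m + 2) T) K' z)) K') K) K K' =
    ev e z (spinPair (raise χ) (raise (Pi.single (K' (m + 2)) 1)) •
      (gauge e c).brUnprimed ξ (Pi.single (K (m + 4)) 1) (raise χ) m) := by
  refine (conSeq_contract_unprimed (brB e) (fun I J => phi2 c e I J z)
    (fun K K' => phiFin c e m K K' z) ξ χ K K').trans ?_
  rw [phi2_contract, spinPair_raise, map_smul]

theorem conSeq_term_contract_primed :
    conSeq (m + 4) (m + 2) ξ χ (fun K K' => symFirst (m + 4) (fun K => symFirst (m + 2)
      (fun K' => (eps (K' (m + 3)) (K' (m + 2)) * eps (K (m + 5)) (K (m + 4))) •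
        ∑ S, br e (phiBar2Mix c e S (K' (m + 1)) z)
          (phi c e (m + 1) K (Function.update K' (m + 1) S) z)) K') K) K K' =
    ev e z (spinPair ξ (Pi.single (K (m + 5)) 1) •
      (gauge e c).brPrimed ξ (raise χ) (raise (Pi.single (K' (m + 3)) 1)) (m + 1)) := by
  refine (conSeq_contract_primed (brB e) (fun I J => phiBar2Mix c e I J z) ξ χ K K'
    (fun K K' => phiFin c e (m + 1) K K' z)).trans ?_
  rw [mul_smul, ← spinPair_raise χ, phiBar2_contract, map_smul]

theorem conSeq_term_wave_unprimed {η : Spinor} (h : spinPair ξ η = 1) :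
    conSeq (m + 2) m ξ χ (fun K K' => symFirst (m + 2) (fun K =>
        ∑ S, ∑ T, eps S T • br e (phi2 c e S (K (m + 2)) z)
          (phi c e m (Function.update K (m + 2) T) K' z)) K) K K' =
      ev e z ((gauge e c).brUnprimed ξ η (raise χ) m) := by
  rw [← phi2_contract, ← conSeq_wave_unprimed (brB e) (fun I J => phi2 c e I J z)
    (fun K K' => phiFin c e m K K' z) ξ χ K K', h, one_smul]
  rfl

theorem conSeq_term_wave_primed {θ : Spinor} (h : spinPair (raise χ) θ = 1) :
    conSeq (m + 3) (m + 1) ξ χ (fun K K' => symFirst (m + 1) (fun K' =>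
        ∑ S, br e (phiBar2Mix c e S (K' (m + 1)) z)
          (phi c e (m + 1) K (Function.update K' (m + 1) S) z)) K') K K' =
      ev e z ((gauge e c).brPrimed ξ (raise χ) θ (m + 1)) := by
  rw [← phiBar2_contract, h, one_smul]
  exact conSeq_wave_primed (brB e) (fun I J => phiBar2Mix c e I J z) ξ χ K K'
    (fun K K' => phiFin c e (m + 1) K K' z)

theorem conSeq_wave {η θ : Spinor} (h : spinPair ξ η = 1) (h' : spinPair (raise χ) θ = 1) :
    conSeq (m + 2) m ξ χ (fun K K' => wave c e (phi c e m K K') z) K K' =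
      ev e z ((gauge e c).box ξ η (raise χ) θ
        ((((gauge e c).nab ξ (raise χ)) ^ m) ((gauge e c).Φ ξ ξ))) := by
  rw [← conTwo_wave e c m ξ η χ θ h h' z]
  simp only [conSeq, conFirst, phi, bold_patch]
  rfl

end PolyField

/-! ### The two spinor identities -/

namespace PolyField

variable {e c} in
theorem phiFin_comp_left (p : ℕ) (k : Fin (p + 2) → Fin 2) (s : Equiv.Perm (Fin (p + 2)))
    (K' : Fin p → Fin 2) : phiFin c e p (k ∘ s) K' = phiFin c e p k K' := by
  funext z α
  simp only [phiFin, phiLow, symAvg_comp_perm]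

variable {e c} in
theorem phiFin_comp_right (p : ℕ) (K : Fin (p + 2) → Fin 2) (k : Fin p → Fin 2)
    (s : Equiv.Perm (Fin p)) : phiFin c e p K (k ∘ s) = phiFin c e p K k := by
  funext z α
  refine (Fintype.sum_equiv (Equiv.arrowCongr s.symm (Equiv.refl (Fin 2))) _ _ fun L => ?_).symm
  have h : phiLow c e p K (L ∘ s) = phiLow c e p K L := by
    simp only [phiLow, symAvg_comp_perm]
  change _ = (∏ t, eps (k (s t)) (L (s t))) * phiLow c e p K (L ∘ s) z α
  rw [h, Equiv.prod_comp s fun t => eps (k t) (L t)]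

theorem phi_patch_left {n p : ℕ} (h : n ≤ p + 2) (k : Fin n → Fin 2) (s : Equiv.Perm (Fin n))
    (K K' : ℕ → Fin 2) : phi c e p (patch n (k ∘ s) K) K' = phi c e p (patch n k K) K' := by
  obtain ⟨d, hd⟩ := Nat.exists_eq_add_of_le h
  have := symmetric_bold_patch (m := n) d
    (f := fun l => phiFin c e p (fun j => l (Fin.cast hd j)) (bold p K'))
    (fun l t => phiFin_comp_left p (fun j => l (Fin.cast hd j))
      ((finCongr hd).symm.permCongr t) (bold p K')) k s K
  exact this

theorem phi_patch_right {n p : ℕ} (h : n ≤ p) (k : Fin n → Fin 2) (s : Equiv.Perm (Fin n))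
    (K K' : ℕ → Fin 2) : phi c e p K (patch n (k ∘ s) K') = phi c e p K (patch n k K') := by
  obtain ⟨d, rfl⟩ := Nat.exists_eq_add_of_le h
  exact symmetric_bold_patch d (phiFin_comp_right _ _) k s K'

variable {e c} in
theorem phiBarFin_comp_left (p : ℕ) (k : Fin (p + 2) → Fin 2) (s : Equiv.Perm (Fin (p + 2)))
    (K : Fin p → Fin 2) (z : Jet ι) : phiBarFin e c p (k ∘ s) K z = phiBarFin e c p k K z := by
  refine (Fintype.sum_equiv (Equiv.arrowCongr s.symm (Equiv.refl (Fin 2))) _ _ fun L => ?_).symm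
  have h : phiLow c e p (L ∘ s) K = phiLow c e p L K := by
    simp only [phiLow, symAvg_comp_perm]
  change _ = (∏ t, eps (k (s t)) (L (s t))) • conjVec ι (phiLow c e p (L ∘ s) K z)
  rw [h, Equiv.prod_comp s fun t => eps (k t) (L t)]

theorem phiBar_patch_left {n p : ℕ} (h : n ≤ p + 2) (k : Fin n → Fin 2) (s : Equiv.Perm (Fin n))
    (K K' : ℕ → Fin 2) (z : Jet ι) :
    phiBar c e p (patch n (k ∘ s) K') K z = phiBar c e p (patch n k K') K z := by
  obtain ⟨d, hd⟩ := Nat.exists_eq_add_of_le h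
  have := symmetric_bold_patch (m := n) d
    (f := fun l => phiBarFin e c p (fun j => l (Fin.cast hd j)) (bold p K) z)
    (fun l t => phiBarFin_comp_left p (fun j => l (Fin.cast hd j))
      ((finCongr hd).symm.permCongr t) (bold p K) z) k s K'
  simp only [phiBar_eq]
  exact this

/-- The difference of the two sides of the identity for the covariant derivative of the symmetrized
variables of order `p = m + 1`, without the lower order terms. -/
def gradDefect (m : ℕ) (K K' : ℕ → Fin 2) (z : Jet ι) : ι → ℂ :=
  covUp c e (K (m + 4)) (K' (m + 2)) (phi c e (m + 1) K K') z -
    (phi c e (m + 2) K K' z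
    + ((((m + 1 : ℕ) : ℝ) ^ 2 + ((m + 1 : ℕ) : ℝ) - 2 : ℝ) / (2 * (((m + 1 : ℕ) : ℝ) + 1))) •
        symFirst (m + 4) (fun K => symFirst (m + 1) (fun K' =>
          eps (K' (m + 2)) (K' (m + 1)) •
            br e (phi2 c e (K (m + 4)) (K (m + 3)) z) (phi c e m K K' z)) K') K
    - ((3 * (1 - if m + 1 = 1 then 1 else 0) : ℝ) / (((m + 1 : ℕ) : ℝ) + 3)) •
        symFirst (m + 3) (fun K =>
          eps (K (m + 4)) (K (m + 3)) •
            br e (phi2 c e (K (m + 2)) (K (m + 1)) z) (phiBar c e m K' K z)) K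
    + ((((m + 1 : ℕ) : ℝ) * (((m + 1 : ℕ) : ℝ) + 5) : ℝ) / (2 * (((m + 1 : ℕ) : ℝ) + 3))) •
        symFirst (m + 3) (fun K => symFirst (m + 2) (fun K' =>
          eps (K (m + 4)) (K (m + 3)) •
            br e (phiBar2Up c e (K' (m + 2)) (K' (m + 1)) z) (phi c e m K K' z)) K') K
    + ((((m + 1 : ℕ) : ℝ) + 1) * (((m + 1 : ℕ) : ℝ) + 2) / (((m + 1 : ℕ) : ℝ) + 3) -
          3 / 4 * (if m + 1 = 1 then 1 else 0) : ℝ) •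
        symFirst (m + 3) (fun K => symFirst (m + 1) (fun K' =>
          (eps (K (m + 4)) (K (m + 3)) * eps (K' (m + 2)) (K' (m + 1))) •
            ∑ S, ∑ T, eps S T •
              br e (phi2 c e S (K (m + 2)) z)
                (phi c e m (Function.update K (m + 2) T) K' z)) K') K
    + ((((m + 1 : ℕ) : ℝ) * (((m + 1 : ℕ) : ℝ) - 1) : ℝ) / (((m + 1 : ℕ) : ℝ) + 1)) •
        symFirst (m + 3) (fun K => symFirst (m + 1) (fun K' =>
          (eps (K' (m + 2)) (K' (m + 1)) * eps (K (m + 4)) (K (m + 3))) •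
            ∑ S', br e (phiBar2Mix c e S' (K' m) z)
              (phi c e m K (Function.update K' m S') z)) K') K)

/-- The difference of the two sides of the identity for the wave operator, without the lower
order terms. -/
def waveDefect (m : ℕ) (K K' : ℕ → Fin 2) (z : Jet ι) : ι → ℂ :=
  wave c e (phi c e m K K') z -
    ((2 * ((m : ℝ) + 2 - if m = 0 then 1 else 0) : ℝ) •
        symFirst (m + 2) (fun K =>
          ∑ S, ∑ T, eps S T •
            br e (phi2 c e S (K (m + 2)) z)
              (phi c e m (Function.update K (m + 2) T) K' z)) K
    + (2 * (m : ℝ) : ℝ) •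
        symFirst m (fun K' =>
          ∑ S', br e (phiBar2Mix c e S' (K' m) z)
            (phi c e m K (Function.update K' m S') z)) K')

theorem gradDefect_mem (m : ℕ) (K K' : ℕ → Fin 2) : gradDefect e c m K K' ∈ smoothPhi e c m := by
  refine mem_of_conSeq_mem (m := m + 3) (n := m + 1) (smoothPhi e c m) (gradDefect e c m)
    (fun K K' k s => ?_) (fun K K' k s => ?_) K K' fun τ τ' => ?_
  · funext z
    simp only [gradDefect, patch_of_lt _ _ (show m + 3 < m + 4 by omega),
      phi_patch_left e c (show m + 3 ≤ m + 1 + 2 by omega),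
      phi_patch_left e c (show m + 3 ≤ m + 2 + 2 by omega),
      symFirst_patch_comp (show m + 3 ≤ m + 4 by omega), symFirst_patch_comp (le_refl (m + 3))]
  · funext z
    simp only [gradDefect, patch_of_lt _ _ (show m + 1 < m + 2 by omega),
      phi_patch_right e c (le_refl (m + 1)),
      phi_patch_right e c (show m + 1 ≤ m + 2 by omega),
      phiBar_patch_left e c (show m + 1 ≤ m + 2 by omega),
      symFirst_patch_comp (show m + 1 ≤ m + 2 by omega), symFirst_patch_comp (le_refl (m + 1))]
  · set ξ : Spinor := ![1, τ]
    set χ : Spinor := ![1, τ']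
    convert smoothPhi_of_mkQ_eq e c ((gauge e c).mkQ_nab_pow_curv ξ (Pi.single (K (m + 4)) 1)
      (raise χ) (raise (Pi.single (K' (m + 2)) 1)) m rfl rfl) using 1
    funext z
    refine (map_conSeq (LinearMap.proj z : (Jet ι → ι → ℂ) →ₗ[ℂ] ι → ℂ) _).trans ?_
    -- For `m = 0` there is no primed index to contract with, and the coefficient vanishes.
    have h5 : (((((m + 1 : ℕ) : ℝ) * (((m + 1 : ℕ) : ℝ) - 1) : ℝ) /
        (((m + 1 : ℕ) : ℝ) + 1) : ℝ) : ℂ) •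
        conSeq (m + 3) (m + 1) ξ χ (fun K K' =>
          symFirst (m + 3) (fun K => symFirst (m + 1) (fun K' =>
            (eps (K' (m + 2)) (K' (m + 1)) * eps (K (m + 4)) (K (m + 3))) •
              ∑ S', br e (phiBar2Mix c e S' (K' m) z)
                (phi c e m K (Function.update K' m S') z)) K') K) K K' =
        ((((m : ℂ) + 1) * ((m : ℂ) + 1 - 1)) / ((m : ℂ) + 1 + 1)) •
          ev e z (spinPair ξ (Pi.single (K (m + 4)) 1) • (gauge e c).brPrimed ξ (raise χ)
            (raise (Pi.single (K' (m + 2)) 1)) m) := by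
      rcases m with _ | m
      · simp
      · rw [← conSeq_term_contract_primed e c m z ξ χ K K']
        push_cast
        rfl
    rw [← ev_apply]
    change conSeq (m + 3) (m + 1) ξ χ (fun K K' => gradDefect e c m K K' z) K K' = _
    simp only [gradDefect, conSeq_sub, conSeq_add, conSeq_smul]
    rw [h5, conSeq_term_unprimed, conSeq_term_conj, conSeq_term_primed,
      conSeq_term_contract_unprimed]
    refine (congrArg₂ (· - ·) (conSeq_covUp e c (m + 1) z ξ χ K K') (congrArg (· + _)
      (congrArg (· + _) (congrArg (· + _) (congrArg (· - _) (congrArg (· + _)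
        (conSeq_phi_succ e c (m + 1) z ξ χ K K'))))))).trans ?_
    simp only [← map_smul, ← map_add, ← map_sub]
    push_cast [apply_ite]
    simp

theorem waveDefect_mem (m : ℕ) (K K' : ℕ → Fin 2) : waveDefect e c m K K' ∈ smoothPhi e c m := by
  refine mem_of_conSeq_mem (m := m + 2) (n := m) (smoothPhi e c m) (waveDefect e c m)
    (fun K K' k s => ?_) (fun K K' k s => ?_) K K' fun τ τ' => ?_
  · funext z
    simp only [waveDefect, phi_patch_left e c (le_refl (m + 2)),
      symFirst_patch_comp (le_refl (m + 2))]
  · funext z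
    simp only [waveDefect, phi_patch_right e c (le_refl m), symFirst_patch_comp (le_refl m)]
  · set ξ : Spinor := ![1, τ]
    set χ : Spinor := ![1, τ']
    -- The choice of `η` and `θ` ensures `ε_{AB} ξ^A η^B = 1 = ε_{A'B'} ζ^{A'} θ^{B'}`, which is
    -- possible since the first components of `ξ` and `χ` are one.
    have hs : spinPair ξ ![0, 1] = 1 := by simp [spinPair, ξ]
    have ht : spinPair (raise χ) ![-1, 0] = 1 := by simp [spinPair, raise, eps, χ]
    convert smoothPhi_of_mkQ_eq e c ((gauge e c).mkQ_box_pow_curv ξ ![0, 1]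
      (raise χ) ![-1, 0] m rfl rfl) using 1
    funext z
    refine (map_conSeq (LinearMap.proj z : (Jet ι → ι → ℂ) →ₗ[ℂ] ι → ℂ) _).trans ?_
    -- For `m = 0` there is no primed index to contract with, and the coefficient vanishes.
    have h5 : ((2 * (m : ℝ) : ℝ) : ℂ) • conSeq (m + 2) m ξ χ (fun K K' => symFirst m (fun K' =>
          ∑ S', br e (phiBar2Mix c e S' (K' m) z)
            (phi c e m K (Function.update K' m S') z)) K') K K' =
        (2 * (m : ℂ)) • ev e z ((gauge e c).brPrimed ξ (raise χ) ![-1, 0] m) := by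
      rcases m with _ | m
      · simp
      · rw [← conSeq_term_wave_primed e c m z ξ χ K K' ht]
        push_cast
        rfl
    rw [← ev_apply]
    change conSeq (m + 2) m ξ χ (fun K K' => waveDefect e c m K K' z) K K' = _
    simp only [waveDefect, conSeq_sub, conSeq_add, conSeq_smul]
    rw [h5, conSeq_term_wave_unprimed e c m z ξ χ K K' hs, conSeq_wave e c m z ξ χ K K' hs ht]
    simp only [← map_smul, ← map_add, ← map_sub, hs, ht, one_smul]
    push_cast [apply_ite]
    simp

end PolyField
end
end YangMills

end

open YangMills in
theorem proposition2p6 {ι : Type*} [Fintype ι] {𝔤 : Type*} [LieRing 𝔤] [LieAlgebra ℝ 𝔤]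
    (e : Module.Basis ι ℝ 𝔤) (c : ℝ) (hc : c ≠ 0) :
    -- the total derivative of the symmetrized potential variables
    (∀ p : ℕ, 1 ≤ p → ∀ i : ℕ → Fin 4, ∃ b : Jet ι → ι → ℝ, HasOrder (p - 1) b ∧
      ∀ z, totalD (i (p + 1)) (aSym p i) z =
        aSym (p + 1) i z
        - (1 / (p + 1 : ℝ)) •
            symFirst p (fun i => covs e (bold (p - 1) i) (field e (i p) (i (p + 1)))) i z
        + b z) ∧
    -- the covariant derivative of the symmetrized spinor variables
    (∀ p : ℕ, 1 ≤ p → ∀ K K' : ℕ → Fin 2, ∃ Ψ : PhiVars ι (p - 1) → ι → ℂ, ContDiff ℝ ∞ Ψ ∧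
      ∀ z ∈ solutionManifold e p,
        covUp c e (K (p + 3)) (K' (p + 1)) (phi c e p K K') z =
          phi c e (p + 1) K K' z
          + ((p ^ 2 + p - 2 : ℝ) / (2 * (p + 1))) •
              symFirst (p + 3) (fun K => symFirst p (fun K' =>
                eps (K' (p + 1)) (K' p) •
                  br e (phi2 c e (K (p + 3)) (K (p + 2)) z) (phi c e (p - 1) K K' z)) K') K
          - ((3 * (1 - if p = 1 then 1 else 0) : ℝ) / (p + 3)) •
              symFirst (p + 2) (fun K =>
                eps (K (p + 3)) (K (p + 2)) •
                  br e (phi2 c e (K (p + 1)) (K p) z) (phiBar c e (p - 1) K' K z)) K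
          + ((p * (p + 5) : ℝ) / (2 * (p + 3))) •
              symFirst (p + 2) (fun K => symFirst (p + 1) (fun K' =>
                eps (K (p + 3)) (K (p + 2)) •
                  br e (phiBar2Up c e (K' (p + 1)) (K' p) z) (phi c e (p - 1) K K' z)) K') K
          + ((p + 1) * (p + 2) / (p + 3) - 3 / 4 * (if p = 1 then 1 else 0) : ℝ) •
              symFirst (p + 2) (fun K => symFirst p (fun K' =>
                (eps (K (p + 3)) (K (p + 2)) * eps (K' (p + 1)) (K' p)) •
                  ∑ S, ∑ T, eps S T •
                    br e (phi2 c e S (K (p + 1)) z)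
                      (phi c e (p - 1) (Function.update K (p + 1) T) K' z)) K') K
          + ((p * (p - 1) : ℝ) / (p + 1)) •
              symFirst (p + 2) (fun K => symFirst p (fun K' =>
                (eps (K' (p + 1)) (K' p) * eps (K (p + 3)) (K (p + 2))) •
                  ∑ S', br e (phiBar2Mix c e S' (K' (p - 1)) z)
                    (phi c e (p - 1) K (Function.update K' (p - 1) S') z)) K') K
          + Ψ (phiVars c e (p - 1) z)) ∧
    -- the wave operator applied to the symmetrized spinor variables
    (∀ p : ℕ, ∀ K K' : ℕ → Fin 2, ∃ Ψ : PhiVars ι p → ι → ℂ, ContDiff ℝ ∞ Ψ ∧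
      ∀ z ∈ solutionManifold e (p + 1),
        wave c e (phi c e p K K') z =
          (2 * (p + 2 - if p = 0 then 1 else 0) : ℝ) •
              symFirst (p + 2) (fun K =>
                ∑ S, ∑ T, eps S T •
                  br e (phi2 c e S (K (p + 2)) z)
                    (phi c e p (Function.update K (p + 2) T) K' z)) K
          + (2 * p : ℝ) •
              symFirst p (fun K' =>
                ∑ S', br e (phiBar2Mix c e S' (K' p) z)
                  (phi c e p K (Function.update K' p S') z)) K'
          + Ψ (phiVars c e p z)) := by
  refine ⟨fun p hp i => ?_, fun p hp K K' => ?_, fun p K K' => ?_⟩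
  · obtain ⟨n, rfl⟩ := Nat.exists_eq_add_of_le' hp
    refine ⟨_, hasOrder_of_mem_jetPolyVec (totalD_aSym_sub_mem e n i), fun z => ?_⟩
    have h (A B X : ι → ℝ) : A = B - (1 / (((n + 1 : ℕ) : ℝ) + 1)) • X +
        (A - B + (1 / ((n : ℝ) + 2)) • X) := by
      push_cast
      rw [add_assoc, one_add_one_eq_two]
      abel
    exact h _ _ _
  · obtain ⟨m, rfl⟩ := Nat.exists_eq_add_of_le' hp
    obtain ⟨Ψ, hΨ, h⟩ := PolyField.gradDefect_mem e c m K K'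
    refine ⟨Ψ, hΨ, fun z hz => ?_⟩
    exact sub_eq_iff_eq_add'.1 (h z hz)
  · obtain ⟨Ψ, hΨ, h⟩ := PolyField.waveDefect_mem e c p K K'
    refine ⟨Ψ, hΨ, fun z hz => ?_⟩
    exact sub_eq_iff_eq_add'.1 (h z hz)
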